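/- Let $d\ge 1$, $\kappa>0$, and let $\xi=\{\xi(x):x\in\mathbb Z^d\}$ be i.i.d. real random variables on a probability space with measure $\mathbf P$ and expectation $\langle\cdot\rangle$. Assume that $\xi(0)$ is unbounded from above, i.e. $\mathbf P(\xi(0)>h)>0$ for all $h\in\mathbb R$, and that $\langle e^{t\xi(0)}\rangle<\infty$ for all $t\ge 0$; put $H(t):=\log\langle e^{t\xi(0)}\rangle$. Assume (Assumption H) that there is $\rho\in[0,\infty]$ such that for all $c\in(0,1)$, \[\lim_{t\to\infty}\frac1t\big[H(ct)-cH(t)\big]=\rho\,c\log c .\] Let $u$ be the solution of the parabolic Anderson model with potential $\xi$ and initial condition $1$, given by the Feynman–Kac formula \[u(t,x)=\mathbb E_x\exp\Big\{\int_0^t\xi(X_s)\,\mathrm ds\Big\},\qquad t\ge 0,\ x\in\mathbb Z^d,\] where $X$ is the continuous-time simple symmetric random walk on $\mathbb Z^d$ with generator $\kappa\Delta$, $\Delta f(x)=\sum_{|y-x|_1=1}[f(y)-f(x)]$. For $r>0$ let $Q_r=[-r,r]^d\cap\mathbb Z^d$, and let $r(t)>0$ be such that the limit \[\lim_{t\to\infty}\frac1t\big(\log|Q_{r(t)}|-H(2t)+2H(t)\big)\]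 exists in $(0,\infty]$. Then: (i) almost surely, $u$ is nonnegative, $t\mapsto u(t,x)$ is continuous on $[0,\infty)$ for every $x$, and $\partial_t u(t,x)=\kappa\Delta u(t,x)+\xi(x)u(t,x)$ for all $t>0$, $x\in\mathbb Z^d$, with $u(0,x)=1$; (ii) for every sequence $(t_n)_{n\in\mathbb N}$ in $[0,\infty)$ with $\sum_n e^{-t_n}<\infty$, \[\frac{1}{|Q_{r(t_n)}|}\sum_{x\in Q_{r(t_n)}}\Big(\frac{u(t_n,x)}{\langle u(t_n,0)\rangle}-1\Big)\longrightarrow 0\qquad(n\to\infty)\quad\text{almost surely.}\] -/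

import Mathlib

open MeasureTheory ProbabilityTheory Filter Topology

namespace PAM

noncomputable section

/-- The lattice `ℤ^d`. -/
abbrev Lattice (d : ℕ) : Type := Fin d → ℤ

/-- The unit vector `e_i` (for `b = true`) or `-e_i` (for `b = false`). -/
def unitVec {d : ℕ} (s : Fin d × Bool) : Lattice d :=
  Pi.single s.1 (if s.2 then 1 else -1)

/-- The discrete Laplacian: the sum of `f y - f x` over the `2d` nearest neighbours `y` of `x`. -/
def laplacian {d : ℕ} (f : Lattice d → ℝ) (x : Lattice d) : ℝ :=
  ∑ s : Fin d × Bool, (f (x + unitVec s) - f x)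

/-- The centred box `[-r, r]^d ∩ ℤ^d`. -/
def box (d : ℕ) (r : ℝ) : Finset (Lattice d) :=
  Fintype.piFinset fun _ => Finset.Icc ⌈-r⌉ ⌊r⌋

/-- `v` is a nonnegative classical solution of `∂v/∂t = κ Δ v + V v` on `(0, ∞) × ℤ^d`,
continuous up to time `0`, with initial condition `v(0, ·) = 1`. -/
structure IsSolution {d : ℕ} (κ : ℝ) (V : Lattice d → ℝ) (v : ℝ → Lattice d → ℝ) : Prop where
  nonneg : ∀ t, 0 ≤ t → ∀ x, 0 ≤ v t x
  initial : ∀ x, v 0 x = 1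
  continuousOn : ∀ x, ContinuousOn (fun t => v t x) (Set.Ici 0)
  equation : ∀ t, 0 < t → ∀ x,
    HasDerivAt (fun s => v s x) (κ * laplacian (v t) x + V x * v t x) t

instance isProbabilityMeasure_exp_one : IsProbabilityMeasure (expMeasure 1) :=
  isProbabilityMeasure_expMeasure one_pos

/-- Law of the driving randomness of the walk: an i.i.d. sequence of pairs of an `Exp(1)` variable
and an independent uniformly chosen direction. -/
def walkMeasure (d : ℕ) [NeZero d] : Measure (ℕ → ℝ × (Fin d × Bool)) :=
  Measure.infinitePi fun _ : ℕ =>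
    (expMeasure 1).prod (PMF.uniformOfFintype (Fin d × Bool)).toMeasure

/-- Time of the `(n+1)`-st jump; holding times are `Exp(1)` divided by the total jump rate `2dκ`. -/
def jumpTime {d : ℕ} (κ : ℝ) (η : ℕ → ℝ × (Fin d × Bool)) (n : ℕ) : ℝ :=
  ∑ i ∈ Finset.range (n + 1), (η i).1 / (2 * d * κ)

/-- Number of jumps up to time `s`. -/
def jumpCount {d : ℕ} (κ : ℝ) (η : ℕ → ℝ × (Fin d × Bool)) (s : ℝ) : ℕ :=
  Set.ncard {n : ℕ | jumpTime κ η n ≤ s}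

/-- Under `walkMeasure d`, this is the continuous-time simple symmetric random walk with generator
`κ Δ` started at `x`, at time `s`. -/
def walk {d : ℕ} (κ : ℝ) (x : Lattice d) (η : ℕ → ℝ × (Fin d × Bool)) (s : ℝ) : Lattice d :=
  x + ∑ i ∈ Finset.range (jumpCount κ η s), unitVec (η i).2

/-- The solution of the parabolic Anderson model with potential `V` and initial condition `1`,
given by the Feynman-Kac formula `E_x exp (∫₀ᵗ V(X_s) ds)`. -/
def solution {d : ℕ} [NeZero d] (κ : ℝ) (V : Lattice d → ℝ) (t : ℝ) (x : Lattice d) : ℝ :=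
  ∫ η, Real.exp (∫ s in (0 : ℝ)..t, V (walk κ x η s)) ∂(walkMeasure d)

/-- The regularity assumption on the cumulant generating function `H`: for some `ρ ∈ [0, ∞]` and
all `c ∈ (0, 1)`, `(H(ct) - c H(t)) / t → ρ c log c` as `t → ∞`
(the limit is `-∞` if `ρ = ∞`). -/
def AssumptionH (H : ℝ → ℝ) : Prop :=
  ∃ ρ : ENNReal, ∀ c ∈ Set.Ioo (0 : ℝ) 1,
    Tendsto (fun t : ℝ => ((1 / t * (H (c * t) - c * H t) : ℝ) : EReal)) atTop
      (𝓝 ((ρ : EReal) * ((c * Real.log c : ℝ) : EReal)))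

end

end PAM

/-! For part (i), splitting the Feynman-Kac expectation at the first jump (`fk_add_one`) gives a
Volterra integral equation; once the expectations are finite locally uniformly in time, it
bootstraps to continuity and then to the differential equation.

For part (ii), write N for the number of sites of the box. Paths with more than a fixed multiple of
t jumps contribute a negligible share of the mean (`lintegral_fkRest_cutoff_le`). Without them the
values of u at sites further apart than O(t) are independent, so a weak law holds as soon as N beats
the ratio of the second moment to the squared mean.

The crucial estimate is `exists_lintegral_fk_sq_le`: up to e^{o(t)} this ratio is at most exp(H(2t)
- 2H(t)). Up to polynomial factors u is dominated by e^{tλ}, where λ is the principal Dirichlet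
eigenvalue of a cube of radius O(t). The maximizer of the Rayleigh quotient can be cut down to a
cube of fixed radius and rounded to a finite family of test functions, with an error that is uniform
in the potential (`exists_net`). For one test function g the exponential moment is explicit, namely
exp of the sum of H(2t g²) plus a kinetic term. Jensen's inequality for the spectral measure gives
the matching lower bound for the mean of u, and Assumption H compares the two
(`AssumptionH.sum_le`).

At a fixed time the failure probability is then e^{-ct} with c depending on the growth limit. It may
be that c < 1, while summability of e^{-t_n} allows nearly e^k indices with t_n in [k, k+1], so
Borel-Cantelli does not apply directly. Three regimes are distinguished. If N exceeds exp(H(2t) -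
2H(t)) by a large exponential factor, the second moment already gives e^{-t}. If H(2t) + H(t) -
2H(3t/2) is at least a large multiple of t, the moment of order 3/2 gives e^{-t}
(`eventually_measure_le_fractionalMoment`). Otherwise convexity in time replaces the individual
indices. The logarithm of the total Dirichlet mass is convex in t. The logarithm of the mean is
convex too, and on a unit window it differs from a line by a monotone function of size O(t).
Closeness on a grid of O(k) times therefore forces closeness on the whole window (`exists_grid`).
The box sizes occurring in the window fall into O(k) bins, each served by two cubes, and the union
bound costs only a polynomial factor. -/

namespace PAM

open scoped ENNReal

/-! ### Driving sequences: measurability and regeneration at the first jump -/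

section Paths

/-- The space of driving sequences of the walk. -/
abbrev Path (d : ℕ) : Type := ℕ → ℝ × (Fin d × Bool)

/-- A nonzero value of `ncard` forces the random set to be finite, and there are only countably many
finite sets of naturals to compare it with. The value 0, which `ncard` also assigns to infinite
sets, is what remains. -/
theorem measurable_ncard_setOf {α : Type*} [MeasurableSpace α] {p : ℕ → α → Prop}
    (hp : ∀ n, MeasurableSet {a | p n a}) : Measurable fun a => Set.ncard {n | p n a} := by
  have key : ∀ F : Finset ℕ, MeasurableSet {a | {n | p n a} = (F : Set ℕ)} := by
    intro F
    have : {a | {n | p n a} = (F : Set ℕ)} = ⋂ n, {a | p n a ↔ n ∈ F} := by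
      ext a
      simp [Set.ext_iff]
    rw [this]
    refine MeasurableSet.iInter fun n => ?_
    by_cases hn : n ∈ F
    · simpa [hn] using hp n
    · have h : {a | p n a ↔ n ∈ F} = {a | p n a}ᶜ := by
        ext a
        simp [hn]
      rw [h]
      exact (hp n).compl
  have hpos : ∀ c : ℕ, c ≠ 0 → MeasurableSet {a | Set.ncard {n | p n a} = c} := by
    intro c hc
    have : {a | Set.ncard {n | p n a} = c}
        = ⋃ F : Finset ℕ, ⋃ _ : F.card = c, {a | {n | p n a} = (F : Set ℕ)} := by
      ext a
      simp only [Set.mem_ofPred_eq, Set.mem_iUnion, exists_prop]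
      constructor
      · intro h
        have hf : {n | p n a}.Finite := Set.finite_of_ncard_ne_zero (by omega)
        refine ⟨hf.toFinset, ?_, by simp⟩
        rw [← h, Set.ncard_eq_toFinset_card _ hf]
      · rintro ⟨F, hF, h⟩
        rw [h, Set.ncard_coe_finset, hF]
    rw [this]
    exact MeasurableSet.iUnion fun F => MeasurableSet.iUnion fun _ => key F
  refine measurable_to_countable' fun c => ?_
  by_cases hc : c = 0
  · have : (fun a => Set.ncard {n | p n a}) ⁻¹' {c}
        = (⋃ c' : ℕ, ⋃ _ : c' ≠ 0, {a | Set.ncard {n | p n a} = c'})ᶜ := by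
      ext a
      simp only [hc, Set.mem_preimage, Set.mem_singleton_iff, Set.mem_compl_iff, Set.mem_iUnion,
        Set.mem_ofPred_eq, exists_prop, not_exists, not_and]
      constructor
      · intro h i hi h'
        exact hi (h'.symm.trans h)
      · intro h
        by_contra h0
        exact h _ h0 rfl
    rw [this]
    exact (MeasurableSet.iUnion fun c' => MeasurableSet.iUnion fun h => hpos c' h).compl
  · exact hpos c hc

variable {d : ℕ}

theorem measurable_jumpTime (κ : ℝ) (n : ℕ) :
    Measurable fun η : Path d => jumpTime κ η n := by
  unfold jumpTime
  fun_prop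

theorem measurable_jumpCount (κ : ℝ) :
    Measurable fun p : Path d × ℝ => jumpCount κ p.1 p.2 := by
  unfold jumpCount
  exact measurable_ncard_setOf fun n =>
    measurableSet_le ((measurable_jumpTime κ n).comp measurable_fst) measurable_snd

theorem measurable_walk (κ : ℝ) (x : Lattice d) :
    Measurable fun p : Path d × ℝ => walk κ x p.1 p.2 := by
  have h : Measurable fun q : Path d × ℕ =>
      x + ∑ i ∈ Finset.range q.2, unitVec (q.1 i).2 := by
    refine measurable_from_prod_countable_left fun c => ?_
    refine Measurable.add (f := fun _ => x)
      (g := fun η : Path d => ∑ i ∈ Finset.range c, unitVec (η i).2) measurable_const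
      (Finset.measurable_sum _ fun i _ => ?_)
    exact (measurable_of_countable (unitVec (d := d))).comp
      (measurable_snd.comp (measurable_pi_apply i))
  exact h.comp (measurable_fst.prodMk (measurable_jumpCount κ))

theorem measurable_potential_walk (κ : ℝ) (x : Lattice d) :
    Measurable fun p : (Lattice d → ℝ) × Path d × ℝ => p.1 (walk κ x p.2.1 p.2.2) := by
  have h : Measurable fun q : (Lattice d → ℝ) × Lattice d => q.1 q.2 :=
    measurable_from_prod_countable_left fun y => measurable_pi_apply y
  exact h.comp (measurable_fst.prodMk ((measurable_walk κ x).comp measurable_snd))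

/-- The exponent in the Feynman-Kac formula. -/
noncomputable def action (κ : ℝ) (V : Lattice d → ℝ) (x : Lattice d) (η : Path d) (t : ℝ) : ℝ :=
  ∫ s in (0 : ℝ)..t, V (walk κ x η s)

theorem measurable_action (κ : ℝ) (x : Lattice d) :
    Measurable fun p : (Lattice d → ℝ) × Path d × ℝ => action κ p.1 x p.2.1 p.2.2 := by
  -- The domain of integration varies with the parameter; as an indicator it becomes part of a
  -- jointly measurable integrand on a fixed space.
  have key : ∀ I : ℝ → Set ℝ, MeasurableSet {q : ℝ × ℝ | q.2 ∈ I q.1} → (∀ t, MeasurableSet (I t)) →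
      Measurable fun p : (Lattice d → ℝ) × Path d × ℝ =>
        ∫ s in I p.2.2, p.1 (walk κ x p.2.1 s) := by
    intro I hI hI'
    have h1 : (fun p : (Lattice d → ℝ) × Path d × ℝ => ∫ s in I p.2.2, p.1 (walk κ x p.2.1 s))
        = fun p => ∫ s, {q : ((Lattice d → ℝ) × Path d × ℝ) × ℝ | q.2 ∈ I q.1.2.2}.indicator
          (fun q => q.1.1 (walk κ x q.1.2.1 q.2)) (p, s) := by
      funext p
      rw [← integral_indicator (hI' _)]
      rfl
    rw [h1]
    refine (StronglyMeasurable.integral_prod_right ?_).measurable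
    refine (Measurable.indicator ?_ ?_).stronglyMeasurable
    · exact (measurable_potential_walk κ x).comp (f := fun q : ((Lattice d → ℝ) × Path d × ℝ) × ℝ =>
        (q.1.1, q.1.2.1, q.2)) (by fun_prop)
    · exact (measurable_snd.comp (measurable_snd.comp measurable_fst)).prodMk measurable_snd hI
  unfold action intervalIntegral
  refine (key (fun t => Set.Ioc 0 t) ?_ fun _ => measurableSet_Ioc).sub
    (key (fun t => Set.Ioc t 0) ?_ fun _ => measurableSet_Ioc)
  · exact (measurableSet_lt measurable_const measurable_snd).inter
      (measurableSet_le measurable_snd measurable_fst)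
  · exact (measurableSet_lt measurable_fst measurable_snd).inter
      (measurableSet_le measurable_snd measurable_const)

/-- Driving sequences with nonnegative holding times that do not accumulate. -/
structure IsGood (κ : ℝ) (η : Path d) : Prop where
  nonneg : ∀ i, 0 ≤ (η i).1
  finite : ∀ s, {n | jumpTime κ η n ≤ s}.Finite

/-- Prepend a holding time and a direction to a driving sequence. -/
def consPath (a : ℝ × (Fin d × Bool)) (η : Path d) : Path d
  | 0 => a
  | n + 1 => η n

@[simp] theorem consPath_zero (a : ℝ × (Fin d × Bool)) (η : Path d) : consPath a η 0 = a := rfl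

@[simp] theorem consPath_succ (a : ℝ × (Fin d × Bool)) (η : Path d) (n : ℕ) :
    consPath a η (n + 1) = η n := rfl

theorem measurable_consPath :
    Measurable fun p : (ℝ × (Fin d × Bool)) × Path d => consPath p.1 p.2 := by
  refine measurable_pi_lambda _ fun n => ?_
  cases n with
  | zero => exact measurable_fst
  | succ n => exact (measurable_pi_apply n).comp measurable_snd

instance [NeZero d] : IsProbabilityMeasure (walkMeasure d) := by
  unfold walkMeasure; infer_instance

/-- Regeneration of the walk at its first jump, the source of the recursion `fk_add_one`. A product
measure is determined by its finite cylinders. -/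
theorem walkMeasure_eq_map_consPath [NeZero d] :
    (((expMeasure 1).prod (PMF.uniformOfFintype (Fin d × Bool)).toMeasure).prod
      (walkMeasure d)).map (fun p => consPath p.1 p.2) = walkMeasure d := by
  conv_rhs => rw [walkMeasure]
  refine Measure.eq_infinitePi _ fun s t ht => ?_
  classical
  obtain ⟨n, hn⟩ : ∃ n, s ⊆ Finset.range (n + 1) :=
    ⟨s.sup id, fun i hi => Finset.mem_range.2 (Nat.lt_succ_of_le (Finset.le_sup (f := id) hi))⟩
  -- Padding by `univ` turns the cylinder into one over an initial segment, which splits into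
  -- coordinate 0 and a shifted cylinder.
  set t' : ℕ → Set (ℝ × (Fin d × Bool)) := fun i => if i ∈ s then t i else Set.univ with ht'
  have ht'm : ∀ i, MeasurableSet (t' i) := by
    intro i
    simp only [ht']
    split_ifs
    · exact ht i
    · exact MeasurableSet.univ
  have hset : Set.pi (s : Set ℕ) t = Set.pi (Finset.range (n + 1) : Set ℕ) t' := by
    ext η
    simp only [Set.mem_pi, Finset.mem_coe, ht']
    constructor
    · intro h i _
      split_ifs with his
      · exact h i his
      · trivial
    · intro h i his
      simpa [his] using h i (hn his)
  have hprod : ∏ i ∈ s, ((expMeasure 1).prod (PMF.uniformOfFintype (Fin d × Bool)).toMeasure) (t i)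
      = ∏ i ∈ Finset.range (n + 1),
        ((expMeasure 1).prod (PMF.uniformOfFintype (Fin d × Bool)).toMeasure) (t' i) := by
    rw [← Finset.prod_subset hn]
    · exact Finset.prod_congr rfl fun i hi => by simp [ht', hi]
    · intro i _ hi
      simp [ht', hi]
  rw [hprod, hset, Measure.map_apply measurable_consPath
    (MeasurableSet.pi (Finset.countable_toSet _) fun i _ => ht'm i)]
  have hpre : (fun p : (ℝ × (Fin d × Bool)) × Path d => consPath p.1 p.2) ⁻¹'
      (Set.pi (Finset.range (n + 1) : Set ℕ) t')
      = t' 0 ×ˢ Set.pi (Finset.range n : Set ℕ) (fun i => t' (i + 1)) := by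
    ext ⟨a, η⟩
    simp only [Set.mem_preimage, Set.mem_pi, Finset.mem_coe, Finset.mem_range, Set.mem_prod]
    constructor
    · intro h
      exact ⟨h 0 (by omega), fun i hi => h (i + 1) (by omega)⟩
    · rintro ⟨h0, h⟩ i hi
      cases i with
      | zero => exact h0
      | succ i => exact h i (by omega)
  rw [hpre, Measure.prod_prod, Finset.prod_range_succ', mul_comm, walkMeasure,
    Measure.infinitePi_pi _ fun i _ => ht'm (i + 1)]

theorem jumpTime_consPath_zero (κ : ℝ) (a : ℝ × (Fin d × Bool)) (η : Path d) :
    jumpTime κ (consPath a η) 0 = a.1 / (2 * d * κ) := by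
  simp [jumpTime]

theorem jumpTime_consPath_succ (κ : ℝ) (a : ℝ × (Fin d × Bool)) (η : Path d) (n : ℕ) :
    jumpTime κ (consPath a η) (n + 1) = a.1 / (2 * d * κ) + jumpTime κ η n := by
  simp only [jumpTime]
  rw [Finset.sum_range_succ', add_comm]
  simp

theorem jumpTime_mono {κ : ℝ} (hκ : 0 < κ) {η : Path d} (h : ∀ i, 0 ≤ (η i).1) :
    Monotone (jumpTime κ η) := by
  refine monotone_nat_of_le_succ fun n => ?_
  simp only [jumpTime]
  rw [Finset.sum_range_succ _ (n + 1)]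
  have : 0 ≤ (η (n + 1)).1 / (2 * d * κ) := div_nonneg (h _) (by positivity)
  linarith

theorem IsGood.jumpCount_mono {κ : ℝ} {η : Path d} (hη : IsGood κ η) :
    Monotone (jumpCount κ η) := fun _ t hst =>
  Set.ncard_le_ncard (fun _ hn => le_trans hn hst) (hη.finite t)

theorem IsGood.consPath {κ : ℝ} {a : ℝ × (Fin d × Bool)} {η : Path d}
    (ha : 0 ≤ a.1) (hη : IsGood κ η) : IsGood κ (consPath a η) := by
  refine ⟨fun i => ?_, fun s => ?_⟩
  · cases i with
    | zero => exact ha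
    | succ i => exact hη.nonneg i
  · refine Set.Finite.subset (((hη.finite (s - a.1 / (2 * d * κ))).image Nat.succ).insert 0) ?_
    intro n hn
    cases n with
    | zero => simp
    | succ n =>
      refine Set.mem_insert_of_mem _ ⟨n, ?_, rfl⟩
      have h : jumpTime κ (PAM.consPath a η) (n + 1) ≤ s := hn
      rw [jumpTime_consPath_succ] at h
      simp only [Set.mem_ofPred_eq]
      linarith

theorem jumpCount_consPath_of_lt {κ : ℝ} (hκ : 0 < κ) {a : ℝ × (Fin d × Bool)} {η : Path d}
    (ha : 0 ≤ a.1) (hη : IsGood κ η) {s : ℝ} (hs : s < a.1 / (2 * d * κ)) :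
    jumpCount κ (consPath a η) s = 0 := by
  have : {n | jumpTime κ (consPath a η) n ≤ s} = ∅ := by
    ext n
    simp only [Set.mem_ofPred_eq, Set.mem_empty_iff_false, iff_false, not_le]
    have h1 := jumpTime_mono hκ (hη.consPath ha).nonneg (Nat.zero_le n)
    rw [jumpTime_consPath_zero] at h1
    linarith
  simp [jumpCount, this]

theorem jumpCount_consPath_of_le {κ : ℝ} {a : ℝ × (Fin d × Bool)} {η : Path d}
    (hη : IsGood κ η) {s : ℝ} (hs : a.1 / (2 * d * κ) ≤ s) :
    jumpCount κ (consPath a η) s = jumpCount κ η (s - a.1 / (2 * d * κ)) + 1 := by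
  have : {n | jumpTime κ (consPath a η) n ≤ s}
      = insert 0 (Nat.succ '' {n | jumpTime κ η n ≤ s - a.1 / (2 * d * κ)}) := by
    ext n
    cases n with
    | zero => simp [jumpTime_consPath_zero, hs]
    | succ n =>
      simp only [Set.mem_ofPred_eq, jumpTime_consPath_succ, Set.mem_insert_iff,
        Nat.succ_ne_zero, false_or, Set.mem_image]
      constructor
      · intro h; exact ⟨n, by linarith, rfl⟩
      · rintro ⟨m, hm, hmn⟩
        obtain rfl : m = n := Nat.succ_injective hmn
        linarith
  rw [jumpCount, this, Set.ncard_insert_of_notMem (by simp) ((hη.finite _).image _),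
    Set.ncard_image_of_injective _ Nat.succ_injective]
  rfl

theorem walk_consPath_of_lt {κ : ℝ} (hκ : 0 < κ) (x : Lattice d) {a : ℝ × (Fin d × Bool)}
    {η : Path d} (ha : 0 ≤ a.1) (hη : IsGood κ η) {s : ℝ} (hs : s < a.1 / (2 * d * κ)) :
    walk κ x (consPath a η) s = x := by
  simp [walk, jumpCount_consPath_of_lt hκ ha hη hs]

theorem walk_consPath_of_le {κ : ℝ} (x : Lattice d) {a : ℝ × (Fin d × Bool)}
    {η : Path d} (hη : IsGood κ η) {s : ℝ} (hs : a.1 / (2 * d * κ) ≤ s) :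
    walk κ x (consPath a η) s = walk κ (x + unitVec a.2) η (s - a.1 / (2 * d * κ)) := by
  simp only [walk, jumpCount_consPath_of_le hη hs]
  rw [Finset.sum_range_succ', add_comm (∑ _ ∈ _, _), ← add_assoc]
  simp

/-- Along a good path the potential takes finitely many values up to a given time. -/
theorem IsGood.exists_bound {κ : ℝ} {η : Path d} (hη : IsGood κ η) (V : Lattice d → ℝ)
    (x : Lattice d) (t : ℝ) : ∃ C, ∀ s, s ≤ t → ‖V (walk κ x η s)‖ ≤ C := by
  refine ⟨∑ c ∈ Finset.range (jumpCount κ η t + 1),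
    ‖V (x + ∑ i ∈ Finset.range c, unitVec (η i).2)‖, fun s hs => ?_⟩
  exact Finset.single_le_sum (f := fun c => ‖V (x + ∑ i ∈ Finset.range c, unitVec (η i).2)‖)
    (fun _ _ => norm_nonneg _)
    (Finset.mem_range.2 (Nat.lt_succ_of_le (hη.jumpCount_mono hs)))

theorem measurable_potential_walk_time (κ : ℝ) (V : Lattice d → ℝ) (x : Lattice d) (η : Path d) :
    Measurable fun s => V (walk κ x η s) :=
  (measurable_potential_walk κ x).comp (f := fun s : ℝ => (V, η, s)) (by fun_prop)

theorem IsGood.intervalIntegrable {κ : ℝ} {η : Path d} (hη : IsGood κ η) (V : Lattice d → ℝ)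
    (x : Lattice d) (s t : ℝ) :
    IntervalIntegrable (fun s => V (walk κ x η s)) volume s t := by
  obtain ⟨C, hC⟩ := hη.exists_bound V x (max s t)
  refine intervalIntegrable_const (c := C) |>.mono_fun
    (measurable_potential_walk_time κ V x η).aestronglyMeasurable ?_
  refine (ae_restrict_iff' measurableSet_uIoc).2 (Eventually.of_forall fun r hr => ?_)
  exact (hC r (Set.mem_uIoc.1 hr |>.elim (fun h => h.2.trans (le_max_right _ _))
    fun h => h.2.trans (le_max_left _ _))).trans (le_abs_self C)

theorem action_consPath_of_lt {κ : ℝ} (hκ : 0 < κ) (V : Lattice d → ℝ) (x : Lattice d)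
    {a : ℝ × (Fin d × Bool)} {η : Path d} (ha : 0 ≤ a.1) (hη : IsGood κ η) {t : ℝ}
    (ht0 : 0 ≤ t) (ht : t < a.1 / (2 * d * κ)) :
    action κ V x (consPath a η) t = t * V x := by
  rw [action, intervalIntegral.integral_congr (g := fun _ => V x)]
  · simp
  · intro s hs
    rw [Set.uIcc_of_le ht0] at hs
    simp only
    rw [walk_consPath_of_lt hκ x ha hη (hs.2.trans_lt ht)]

theorem action_consPath_of_le {κ : ℝ} (hκ : 0 < κ) (V : Lattice d → ℝ) (x : Lattice d)
    {a : ℝ × (Fin d × Bool)} {η : Path d} (ha : 0 ≤ a.1) (hη : IsGood κ η) {t : ℝ}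
    (ht : a.1 / (2 * d * κ) ≤ t) :
    action κ V x (consPath a η) t = a.1 / (2 * d * κ) * V x
      + action κ V (x + unitVec a.2) η (t - a.1 / (2 * d * κ)) := by
  set σ := a.1 / (2 * d * κ) with hσ
  have hσ0 : 0 ≤ σ := div_nonneg ha (by positivity)
  have hgood := hη.consPath ha
  rw [action, ← intervalIntegral.integral_add_adjacent_intervals
    (hgood.intervalIntegrable V x 0 σ) (hgood.intervalIntegrable V x σ t)]
  congr 1
  · rw [intervalIntegral.integral_congr_ae (g := fun _ => V x)]
    · simp
    -- At the jump time itself the walk has already moved, so the path is constant only up to one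
    -- point.
    · have : ∀ᵐ s : ℝ, s ≠ σ := by simp [ae_iff]
      filter_upwards [this] with s hne hs
      rw [Set.uIoc_of_le hσ0] at hs
      rw [walk_consPath_of_lt hκ x ha hη (lt_of_le_of_ne hs.2 hne)]
  · rw [action, intervalIntegral.integral_congr
      (g := fun s => V (walk κ (x + unitVec a.2) η (s - σ)))]
    · rw [intervalIntegral.integral_comp_sub_right (fun s => V (walk κ (x + unitVec a.2) η s))]
      simp
    · intro s hs
      rw [Set.uIcc_of_le ht] at hs
      simp only
      rw [walk_consPath_of_le x hη hs.1]

end Paths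

end PAM

namespace PAM

open scoped ENNReal

/-! ### Jump counts and the first-jump decomposition -/

section FirstJump

variable {d : ℕ}

theorem lintegral_expMeasure_one (f : ℝ → ℝ≥0∞) (hf : Measurable f) :
    ∫⁻ y, f y ∂(expMeasure 1) = ∫⁻ y in Set.Ioi 0, ENNReal.ofReal (Real.exp (-y)) * f y := by
  have hm : Measurable (exponentialPDF 1) :=
    (measurable_exponentialPDFReal 1).ennreal_ofReal
  have h1 : ∫⁻ y, f y ∂(expMeasure 1) = ∫⁻ y, exponentialPDF 1 y * f y :=
    lintegral_withDensity_eq_lintegral_mul _ hm hf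
  rw [h1, ← lintegral_indicator measurableSet_Ioi]
  refine lintegral_congr_ae ?_
  have : ∀ᵐ y : ℝ, y ≠ 0 := by simp [ae_iff]
  filter_upwards [this] with y hy
  rcases lt_or_gt_of_ne hy with h | h
  · rw [exponentialPDF_of_neg h, Set.indicator_of_notMem (by simpa using h.le), zero_mul]
  · rw [exponentialPDF_of_nonneg h.le, Set.indicator_of_mem (by simpa using h)]
    simp

theorem lintegral_expMeasure_one_div {c : ℝ} (hc : 0 < c) (f : ℝ → ℝ≥0∞) (hf : Measurable f) :
    ∫⁻ y, f (y / c) ∂(expMeasure 1)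
      = ∫⁻ s in Set.Ioi 0, ENNReal.ofReal (c * Real.exp (-(c * s))) * f s := by
  rw [lintegral_expMeasure_one (fun y => f (y / c)) (hf.comp (measurable_id.div_const c))]
  have himg : (fun s : ℝ => c * s) '' Set.Ioi 0 = Set.Ioi 0 := by
    rw [Set.image_mul_left_Ioi hc, mul_zero]
  rw [← himg, lintegral_image_eq_lintegral_abs_deriv_mul (f' := fun _ => c) measurableSet_Ioi, himg]
  · refine lintegral_congr fun s => ?_
    rw [abs_of_pos hc, ← mul_assoc, ← ENNReal.ofReal_mul hc.le, mul_div_cancel_left₀ _ hc.ne']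
  · intro x _
    simpa using ((hasDerivAt_id x).const_mul c).hasDerivWithinAt
  · exact (mul_right_injective₀ hc.ne').injOn

theorem lintegral_uniform [NeZero d] (f : Fin d × Bool → ℝ≥0∞) :
    ∫⁻ e, f e ∂(PMF.uniformOfFintype (Fin d × Bool)).toMeasure
      = ENNReal.ofReal (1 / (2 * d)) * ∑ e, f e := by
  rw [lintegral_fintype, Finset.mul_sum]
  refine Finset.sum_congr rfl fun e _ => ?_
  rw [PMF.toMeasure_apply_singleton _ _ (measurableSet_singleton e), PMF.uniformOfFintype_apply,
    mul_comm]
  congr 1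
  simp only [Fintype.card_prod, Fintype.card_fin, Fintype.card_bool]
  have hd : (0 : ℝ) < d := by exact_mod_cast Nat.pos_of_ne_zero (NeZero.ne d)
  rw [one_div, ENNReal.ofReal_inv_of_pos (by positivity), mul_comm (2 : ℝ)]
  congr 1
  rw [ENNReal.ofReal_mul hd.le]
  simp

theorem lintegral_walkMeasure_consPath [NeZero d] (f : Path d → ℝ≥0∞) (hf : Measurable f) :
    ∫⁻ η, f η ∂(walkMeasure d) = ∫⁻ y, ENNReal.ofReal (1 / (2 * d)) *
      ∑ e, ∫⁻ η, f (consPath (y, e) η) ∂(walkMeasure d) ∂(expMeasure 1) := by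
  have hm : Measurable fun p : (ℝ × (Fin d × Bool)) × Path d => f (consPath p.1 p.2) :=
    hf.comp measurable_consPath
  conv_lhs => rw [← walkMeasure_eq_map_consPath]
  rw [lintegral_map hf measurable_consPath, lintegral_prod _ hm.aemeasurable,
    lintegral_prod _ hm.lintegral_prod_right'.aemeasurable]
  refine lintegral_congr fun y => ?_
  rw [lintegral_uniform]

theorem lintegral_Ioi_exp_neg {c : ℝ} (hc : 0 < c) (t : ℝ) :
    ∫⁻ s in Set.Ioi t, ENNReal.ofReal (c * Real.exp (-(c * s)))
      = ENNReal.ofReal (Real.exp (-(c * t))) := by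
  have h1 := integrableOn_exp_mul_Ioi (a := -c) (by linarith) t
  rw [← ofReal_integral_eq_lintegral_ofReal]
  · congr 1
    rw [integral_const_mul]
    have h2 := integral_exp_mul_Ioi (a := -c) (by linarith) t
    simp only [neg_mul] at h2
    rw [h2]
    field_simp
  · simpa [neg_mul] using h1.const_mul c
  · exact Eventually.of_forall fun s => by positivity

theorem lintegral_prod_walkMeasure [NeZero d] (g : ℝ → ℝ≥0∞) (hg : Measurable g) (n : ℕ) :
    ∫⁻ η, ∏ i ∈ Finset.range n, g (η i).1 ∂(walkMeasure d) = (∫⁻ y, g y ∂(expMeasure 1)) ^ n := by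
  induction n with
  | zero => simp
  | succ n ih =>
    rw [lintegral_walkMeasure_consPath _ (by fun_prop), pow_succ, ← ih,
      mul_comm (∫⁻ η, _ ∂(walkMeasure d)), ← lintegral_mul_const _ hg]
    refine lintegral_congr fun y => ?_
    have : ∀ e : Fin d × Bool, ∫⁻ η, ∏ i ∈ Finset.range (n + 1), g (consPath (y, e) η i).1
        ∂(walkMeasure d) = g y * ∫⁻ η, ∏ i ∈ Finset.range n, g (η i).1 ∂(walkMeasure d) := by
      intro e
      rw [← lintegral_const_mul _ (by fun_prop)]
      refine lintegral_congr fun η => ?_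
      rw [Finset.prod_range_succ', mul_comm]
      simp
    simp_rw [this]
    rw [Finset.sum_const, nsmul_eq_mul, ← mul_assoc]
    conv_rhs => rw [← one_mul (g y * _)]
    congr 1
    have hd : (0 : ℝ) < d := by exact_mod_cast Nat.pos_of_ne_zero (NeZero.ne d)
    simp only [Finset.card_univ, Fintype.card_prod, Fintype.card_fin, Fintype.card_bool]
    rw [← ENNReal.ofReal_natCast, ← ENNReal.ofReal_mul (by positivity)]
    push_cast
    rw [mul_comm (2 : ℝ), one_div_mul_cancel (by positivity)]
    simp

/-- Chernoff's bound with parameter θ = e - 1, for which the Laplace transform 1/(1 + θ) of the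
`Exp(1)` law is e^{-1}: every further jump costs exactly one factor e^{-1}. -/
theorem walkMeasure_jumpTime_le [NeZero d] {κ : ℝ} (hκ : 0 < κ) (t : ℝ) (n : ℕ) :
    walkMeasure d {η | jumpTime κ η n ≤ t}
      ≤ ENNReal.ofReal (Real.exp ((Real.exp 1 - 1) * (2 * d * κ) * t - (n + 1))) := by
  have hd : (0 : ℝ) < d := by exact_mod_cast Nat.pos_of_ne_zero (NeZero.ne d)
  set θ := Real.exp 1 - 1 with hθ
  have hθ0 : 0 < θ := by
    have := Real.add_one_lt_exp (one_ne_zero)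
    linarith
  have hg : Measurable fun y : ℝ => ENNReal.ofReal (Real.exp (-(θ * y))) := by fun_prop
  have hmean : ∫⁻ y, ENNReal.ofReal (Real.exp (-(θ * y))) ∂(expMeasure 1)
      = ENNReal.ofReal (Real.exp (-1)) := by
    rw [lintegral_expMeasure_one _ hg]
    have : ∀ y : ℝ, ENNReal.ofReal (Real.exp (-y)) * ENNReal.ofReal (Real.exp (-(θ * y)))
        = ENNReal.ofReal (Real.exp (-1)) *
          ENNReal.ofReal (Real.exp 1 * Real.exp (-(Real.exp 1 * y))) := by
      intro y
      rw [← ENNReal.ofReal_mul (Real.exp_pos _).le, ← ENNReal.ofReal_mul (Real.exp_pos _).le,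
        ← mul_assoc, ← Real.exp_add, ← Real.exp_add]
      congr 1
      rw [hθ]
      simp
      ring
    simp_rw [this]
    rw [lintegral_const_mul _ (by fun_prop), lintegral_Ioi_exp_neg (Real.exp_pos 1)]
    simp
  have hprod := lintegral_prod_walkMeasure (d := d) _ hg (n + 1)
  rw [hmean] at hprod
  have hmarkov : ∀ η ∈ {η : Path d | jumpTime κ η n ≤ t},
      ENNReal.ofReal (Real.exp (-(θ * (2 * d * κ) * t)))
        ≤ ∏ i ∈ Finset.range (n + 1), ENNReal.ofReal (Real.exp (-(θ * (η i).1))) := by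
    intro η hη
    rw [← ENNReal.ofReal_prod_of_nonneg fun _ _ => (Real.exp_pos _).le, ← Real.exp_sum]
    refine ENNReal.ofReal_le_ofReal (Real.exp_le_exp.2 ?_)
    have h : jumpTime κ η n ≤ t := hη
    simp only [jumpTime, ← Finset.sum_div] at h
    rw [div_le_iff₀ (by positivity)] at h
    rw [Finset.sum_neg_distrib, ← Finset.mul_sum, neg_le_neg_iff, mul_assoc]
    exact mul_le_mul_of_nonneg_left (by linarith) hθ0.le
  have h2 : ENNReal.ofReal (Real.exp (-(θ * (2 * d * κ) * t))) *
      walkMeasure d {η | jumpTime κ η n ≤ t} ≤ ENNReal.ofReal (Real.exp (-1)) ^ (n + 1) := by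
    rw [← hprod]
    have hms : MeasurableSet {η : Path d | jumpTime κ η n ≤ t} :=
      measurableSet_le (measurable_jumpTime κ n) measurable_const
    rw [← setLIntegral_const]
    refine (setLIntegral_mono' hms hmarkov).trans (setLIntegral_le_lintegral _ _)
  have h3 : walkMeasure d {η | jumpTime κ η n ≤ t}
      ≤ ENNReal.ofReal (Real.exp (θ * (2 * d * κ) * t)) * ENNReal.ofReal (Real.exp (-1)) ^ (n + 1) := by
    calc walkMeasure d {η | jumpTime κ η n ≤ t}
        = ENNReal.ofReal (Real.exp (θ * (2 * d * κ) * t)) *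
          (ENNReal.ofReal (Real.exp (-(θ * (2 * d * κ) * t))) *
            walkMeasure d {η | jumpTime κ η n ≤ t}) := by
          rw [← mul_assoc, ← ENNReal.ofReal_mul (Real.exp_pos _).le, ← Real.exp_add]
          simp
      _ ≤ _ := by gcongr
  refine h3.trans (le_of_eq ?_)
  rw [← ENNReal.ofReal_pow (Real.exp_pos _).le, ← ENNReal.ofReal_mul (Real.exp_pos _).le,
    ← Real.exp_nat_mul, ← Real.exp_add]
  congr 2
  push_cast
  ring

theorem ae_nonneg_expMeasure_one : ∀ᵐ y ∂(expMeasure 1), 0 ≤ y := by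
  rw [ae_iff, ← lintegral_indicator_one (by measurability),
    lintegral_expMeasure_one _ (by measurability)]
  rw [setLIntegral_congr_fun (g := fun _ => 0) measurableSet_Ioi]
  · simp
  · intro y hy
    have hy' : (0 : ℝ) < y := hy
    simp [hy'.le]

/-- Explosion before time `m` has probability at most the bound of `walkMeasure_jumpTime_le` for
every `n`, and that bound tends to 0. -/
theorem ae_isGood [NeZero d] {κ : ℝ} (hκ : 0 < κ) : ∀ᵐ η ∂(walkMeasure d), IsGood κ η := by
  have h1 : ∀ᵐ η ∂(walkMeasure d), ∀ i, 0 ≤ (η i).1 := by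
    refine ae_all_iff.2 fun i => ?_
    have hp : ∀ᵐ a ∂((expMeasure 1).prod (PMF.uniformOfFintype (Fin d × Bool)).toMeasure),
        0 ≤ a.1 :=
      Measure.quasiMeasurePreserving_fst.ae ae_nonneg_expMeasure_one
    exact (measurePreserving_eval_infinitePi (fun _ : ℕ =>
      (expMeasure 1).prod (PMF.uniformOfFintype (Fin d × Bool)).toMeasure) i).quasiMeasurePreserving.ae hp
  have h2 : ∀ᵐ η ∂(walkMeasure d), ∀ m : ℕ, ∃ n, (m : ℝ) < jumpTime κ η n := by
    refine ae_all_iff.2 fun m => ?_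
    rw [ae_iff]
    refine le_antisymm ?_ zero_le
    have hle : ∀ n : ℕ, walkMeasure d {η | ¬ ∃ n, (m : ℝ) < jumpTime κ η n}
        ≤ ENNReal.ofReal (Real.exp ((Real.exp 1 - 1) * (2 * d * κ) * m - (n + 1))) := fun n =>
      (measure_mono fun η hη => by
        simp only [Set.mem_ofPred_eq, not_exists, not_lt] at hη ⊢
        exact hη n).trans (walkMeasure_jumpTime_le hκ m n)
    refine ge_of_tendsto' (x := atTop) (f := fun n : ℕ =>
      ENNReal.ofReal (Real.exp ((Real.exp 1 - 1) * (2 * d * κ) * m - (n + 1)))) ?_ hle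
    rw [← ENNReal.ofReal_zero]
    refine ENNReal.tendsto_ofReal (Real.tendsto_exp_atBot.comp ?_)
    have : Tendsto (fun n : ℕ => (n : ℝ) + 1) atTop atTop :=
      tendsto_atTop_add_const_right _ _ tendsto_natCast_atTop_atTop
    simpa [sub_eq_add_neg] using
      tendsto_atBot_add_const_left atTop ((Real.exp 1 - 1) * (2 * d * κ) * m)
        (tendsto_neg_atTop_atBot.comp this)
  filter_upwards [h1, h2] with η h1 h2
  refine ⟨h1, fun s => ?_⟩
  obtain ⟨m, hm⟩ := exists_nat_ge s
  obtain ⟨n, hn⟩ := h2 m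
  refine (Set.finite_lt_nat n).subset fun k hk => ?_
  by_contra hkn
  have := jumpTime_mono hκ h1 (not_lt.1 hkn)
  have hk' : jumpTime κ η k ≤ s := hk
  linarith

/-- The Feynman-Kac expectation restricted to fewer than `n` jumps, with values in `[0, ∞]`. -/
noncomputable def fk [NeZero d] (n : ℕ∞) (κ : ℝ) (V : Lattice d → ℝ) (t : ℝ) (x : Lattice d) :
    ℝ≥0∞ :=
  ∫⁻ η, {η | (jumpCount κ η t : ℕ∞) < n}.indicator
    (fun η => ENNReal.ofReal (Real.exp (action κ V x η t))) η ∂(walkMeasure d)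

theorem measurable_fk_integrand (n : ℕ∞) (κ : ℝ) (x : Lattice d) :
    Measurable fun p : ((Lattice d → ℝ) × ℝ) × Path d =>
      {η | (jumpCount κ η p.1.2 : ℕ∞) < n}.indicator
        (fun η => ENNReal.ofReal (Real.exp (action κ p.1.1 x η p.1.2))) p.2 := by
  have hS : MeasurableSet {p : ((Lattice d → ℝ) × ℝ) × Path d |
      (jumpCount κ p.2 p.1.2 : ℕ∞) < n} := by
    have h := (measurable_jumpCount (d := d) κ).comp
      (f := fun p : ((Lattice d → ℝ) × ℝ) × Path d => (p.2, p.1.2)) (by fun_prop)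
    exact h (MeasurableSet.of_discrete (s := {c : ℕ | (c : ℕ∞) < n}))
  have h2 : Measurable fun p : ((Lattice d → ℝ) × ℝ) × Path d =>
      ENNReal.ofReal (Real.exp (action κ p.1.1 x p.2 p.1.2)) :=
    (Real.measurable_exp.comp ((measurable_action κ x).comp
      (f := fun p : ((Lattice d → ℝ) × ℝ) × Path d => (p.1.1, p.2, p.1.2))
        (by fun_prop))).ennreal_ofReal
  exact h2.indicator hS

theorem measurable_fk_prod [NeZero d] (n : ℕ∞) (κ : ℝ) (x : Lattice d) :
    Measurable fun p : (Lattice d → ℝ) × ℝ => fk n κ p.1 p.2 x :=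
  (measurable_fk_integrand n κ x).lintegral_prod_right'

theorem measurable_fk [NeZero d] (n : ℕ∞) (κ t : ℝ) (x : Lattice d) :
    Measurable fun V : Lattice d → ℝ => fk n κ V t x :=
  (measurable_fk_prod n κ x).comp (f := fun V => (V, t)) (by fun_prop)

theorem measurable_fk_time [NeZero d] (n : ℕ∞) (κ : ℝ) (V : Lattice d → ℝ) (x : Lattice d) :
    Measurable fun t : ℝ => fk n κ V t x :=
  (measurable_fk_prod n κ x).comp (f := fun t => (V, t)) (by fun_prop)

theorem fk_top [NeZero d] (κ : ℝ) (V : Lattice d → ℝ) (t : ℝ) (x : Lattice d) :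
    fk ⊤ κ V t x = ∫⁻ η, ENNReal.ofReal (Real.exp (action κ V x η t)) ∂(walkMeasure d) := by
  simp [fk]

theorem solution_eq_toReal_fk [NeZero d] (κ : ℝ) (V : Lattice d → ℝ) (t : ℝ) (x : Lattice d) :
    solution κ V t x = (fk ⊤ κ V t x).toReal := by
  rw [fk_top, solution, integral_eq_lintegral_of_nonneg_ae]
  · rfl
  · exact Eventually.of_forall fun η => (Real.exp_pos _).le
  · exact (Real.measurable_exp.comp ((measurable_action κ x).comp
      (f := fun η : Path d => (V, η, t)) (by fun_prop))).aestronglyMeasurable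

theorem fk_zero_left [NeZero d] (κ : ℝ) (V : Lattice d → ℝ) (t : ℝ) (x : Lattice d) :
    fk 0 κ V t x = 0 := by
  simp [fk]

/-- Decomposition of the Feynman-Kac expectation at the first jump of the walk. -/
theorem fk_add_one [NeZero d] (n : ℕ∞) {κ : ℝ} (hκ : 0 < κ) (V : Lattice d → ℝ) {t : ℝ}
    (ht : 0 ≤ t) (x : Lattice d) :
    fk (n + 1) κ V t x = ENNReal.ofReal (Real.exp ((V x - 2 * d * κ) * t)) +
      ∫⁻ s in Set.Ioc 0 t, ENNReal.ofReal (κ * Real.exp ((V x - 2 * d * κ) * s)) *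
        ∑ e, fk n κ V (t - s) (x + unitVec e) := by
  have hd : (0 : ℝ) < d := by exact_mod_cast Nat.pos_of_ne_zero (NeZero.ne d)
  set c : ℝ := 2 * d * κ with hc
  have hc0 : 0 < c := by positivity
  -- Contribution of a first jump at time `s` in direction `e`: if it comes after `t` the walk has
  -- stayed at `x`, otherwise the walk restarts from the neighbour with one jump used up.
  set G : ℝ → Fin d × Bool → ℝ≥0∞ := fun s e => if t < s then ENNReal.ofReal (Real.exp (t * V x))
    else ENNReal.ofReal (Real.exp (s * V x)) * fk n κ V (t - s) (x + unitVec e) with hG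
  have hGm : ∀ e, Measurable fun s => G s e := by
    intro e
    refine Measurable.ite measurableSet_Ioi measurable_const ?_
    refine Measurable.mul (by fun_prop) ?_
    exact (measurable_fk_time n κ V (x + unitVec e)).comp (by fun_prop)
  have hfm : Measurable fun η : Path d => {η | (jumpCount κ η t : ℕ∞) < n + 1}.indicator
      (fun η => ENNReal.ofReal (Real.exp (action κ V x η t))) η :=
    (measurable_fk_integrand (n + 1) κ x).comp (f := fun η : Path d => ((V, t), η)) (by fun_prop)
  have hinner : ∀ᵐ y ∂(expMeasure 1), ∀ e : Fin d × Bool,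
      ∫⁻ η, {η | (jumpCount κ η t : ℕ∞) < n + 1}.indicator
        (fun η => ENNReal.ofReal (Real.exp (action κ V x η t))) (consPath (y, e) η)
        ∂(walkMeasure d) = G (y / c) e := by
    filter_upwards [ae_nonneg_expMeasure_one] with y hy e
    simp only [hG]
    split_ifs with h
    · have : ∀ᵐ η ∂(walkMeasure d), {η | (jumpCount κ η t : ℕ∞) < n + 1}.indicator
          (fun η => ENNReal.ofReal (Real.exp (action κ V x η t))) (consPath (y, e) η)
          = ENNReal.ofReal (Real.exp (t * V x)) := by
        filter_upwards [ae_isGood hκ] with η hη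
        rw [Set.indicator_of_mem, action_consPath_of_lt hκ V x hy hη ht h]
        simp [jumpCount_consPath_of_lt hκ (a := (y, e)) hy hη h]
      rw [lintegral_congr_ae this]
      simp
    · rw [fk, ← lintegral_const_mul']
      · refine lintegral_congr_ae ?_
        filter_upwards [ae_isGood hκ] with η hη
        have hle : (y, e).1 / (2 * d * κ) ≤ t := not_lt.1 h
        by_cases hj : (jumpCount κ η (t - y / c) : ℕ∞) < n
        · rw [Set.indicator_of_mem, Set.indicator_of_mem, action_consPath_of_le hκ V x hy hη hle,
            Real.exp_add, ENNReal.ofReal_mul (Real.exp_pos _).le]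
          · exact hj
          · simp only [Set.mem_ofPred_eq]
            rw [jumpCount_consPath_of_le hη hle]
            push_cast
            exact (ENat.add_lt_add_iff_right (by simp)).2 hj
        · rw [Set.indicator_of_notMem, Set.indicator_of_notMem, mul_zero]
          · exact hj
          · simp only [Set.mem_ofPred_eq]
            rw [jumpCount_consPath_of_le hη hle]
            push_cast
            intro hlt
            exact hj ((ENat.add_lt_add_iff_right (by simp)).1 hlt)
      · exact ENNReal.ofReal_ne_top
  have hsum : Measurable fun s => ENNReal.ofReal (1 / (2 * d)) * ∑ e, G s e :=
    (Finset.measurable_sum _ fun e _ => hGm e).const_mul _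
  have h1 : fk (n + 1) κ V t x
      = ∫⁻ y, (fun s => ENNReal.ofReal (1 / (2 * d)) * ∑ e, G s e) (y / c) ∂(expMeasure 1) := by
    rw [fk, lintegral_walkMeasure_consPath _ hfm]
    refine lintegral_congr_ae ?_
    filter_upwards [hinner] with y hy
    simp_rw [hy]
  rw [h1, lintegral_expMeasure_one_div hc0 _ hsum, ← Set.Ioc_union_Ioi_eq_Ioi ht,
    lintegral_union measurableSet_Ioi (Set.disjoint_left.2 fun s hs hs' => not_lt.2 hs.2 hs'),
    add_comm]
  congr 1
  · rw [setLIntegral_congr_fun (g := fun s => ENNReal.ofReal (c * Real.exp (-(c * s))) *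
      ENNReal.ofReal (Real.exp (t * V x))) measurableSet_Ioi]
    · rw [lintegral_mul_const _ (by fun_prop), lintegral_Ioi_exp_neg hc0,
        ← ENNReal.ofReal_mul (Real.exp_pos _).le, ← Real.exp_add]
      congr 2
      ring
    · intro s hs
      have hs' : t < s := hs
      simp only [hG, hs', if_true, Finset.sum_const, nsmul_eq_mul]
      congr 1
      rw [← mul_assoc]
      conv_rhs => rw [← one_mul (ENNReal.ofReal (Real.exp (t * V x)))]
      congr 1
      simp only [Finset.card_univ, Fintype.card_prod, Fintype.card_fin, Fintype.card_bool]
      rw [← ENNReal.ofReal_natCast, ← ENNReal.ofReal_mul (by positivity)]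
      push_cast
      rw [mul_comm (2 : ℝ), one_div_mul_cancel (by positivity)]
      simp
  · refine setLIntegral_congr_fun measurableSet_Ioc fun s hs => ?_
    have hs' : ¬ t < s := not_lt.2 hs.2
    simp only [hG, hs', if_false]
    -- The jump density 2dκ e^{-2dκ s} times the weight 1/(2d) of a direction leaves the factor κ.
    rw [← Finset.mul_sum, ← mul_assoc, ← mul_assoc, ← ENNReal.ofReal_mul (by positivity),
      ← ENNReal.ofReal_mul (by positivity)]
    congr 2
    have hexp : Real.exp ((V x - c) * s) = Real.exp (-(c * s)) * Real.exp (s * V x) := by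
      rw [← Real.exp_add]
      ring_nf
    rw [hexp, hc]
    field_simp

end FirstJump

end PAM

namespace PAM

open scoped ENNReal

/-! ### Moment bounds, truncation of the number of jumps, locality -/

section Annealed

variable {d : ℕ}

/-- The law of an i.i.d. field with marginal `μ`. -/
noncomputable def fieldMeasure (d : ℕ) (μ : Measure ℝ) [IsProbabilityMeasure μ] :
    Measure (Lattice d → ℝ) :=
  Measure.infinitePi fun _ : Lattice d => μ

instance (μ : Measure ℝ) [IsProbabilityMeasure μ] : IsProbabilityMeasure (fieldMeasure d μ) := by
  unfold fieldMeasure; infer_instance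

theorem map_shift_fieldMeasure (μ : Measure ℝ) [IsProbabilityMeasure μ] (x : Lattice d) :
    (fieldMeasure d μ).map (fun V y => V (y + x)) = fieldMeasure d μ :=
  Measure.map_infinitePi_infinitePi_of_inj (P := fun _ : Lattice d => μ) (f := fun y => y + x)
    (add_left_injective x)

theorem measurePreserving_shift (μ : Measure ℝ) [IsProbabilityMeasure μ] (x : Lattice d) :
    MeasurePreserving (fun (V : Lattice d → ℝ) y => V (y + x)) (fieldMeasure d μ)
      (fieldMeasure d μ) :=
  ⟨by fun_prop, map_shift_fieldMeasure μ x⟩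

theorem measurePreserving_eval_field (μ : Measure ℝ) [IsProbabilityMeasure μ] (x : Lattice d) :
    MeasurePreserving (fun V : Lattice d → ℝ => V x) (fieldMeasure d μ) μ :=
  measurePreserving_eval_infinitePi (fun _ : Lattice d => μ) x

/-- Jensen's inequality for the occupation measure of a path. -/
theorem lintegral_exp_action_le (μ : Measure ℝ) [IsProbabilityMeasure μ] {κ : ℝ} {η : Path d}
    (hη : IsGood κ η) {g : ℝ → ℝ} (hg : Measurable g) (x : Lattice d) {t : ℝ} (ht : 0 ≤ t) :
    ∫⁻ V, ENNReal.ofReal (Real.exp (action κ (fun y => g (V y)) x η t)) ∂(fieldMeasure d μ)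
      ≤ ∫⁻ y, ENNReal.ofReal (Real.exp (t * g y)) ∂μ := by
  rcases ht.eq_or_lt with rfl | ht
  · simp [action]
  have hV : ∀ V : Lattice d → ℝ, ENNReal.ofReal (Real.exp (action κ (fun y => g (V y)) x η t))
      ≤ ENNReal.ofReal (1 / t) *
        ∫⁻ s in Set.Ioc 0 t, ENNReal.ofReal (Real.exp (t * g (V (walk κ x η s)))) := by
    intro V
    have hm := measurable_potential_walk_time κ (fun y => g (V y)) x η
    obtain ⟨C, hC⟩ := hη.exists_bound (fun y => g (V y)) x t
    have hint : IntegrableOn (fun s => t * g (V (walk κ x η s))) (Set.Ioc 0 t) := by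
      have := (hη.intervalIntegrable (fun y => g (V y)) x 0 t).const_mul t
      rwa [intervalIntegrable_iff_integrableOn_Ioc_of_le ht.le] at this
    have hint2 : IntegrableOn (Real.exp ∘ fun s => t * g (V (walk κ x η s))) (Set.Ioc 0 t) := by
      refine Measure.integrableOn_of_bounded (M := Real.exp (t * C)) (by simp)
        (Real.measurable_exp.comp (hm.const_mul t)).aestronglyMeasurable ?_
      refine (ae_restrict_iff' measurableSet_Ioc).2 (Eventually.of_forall fun s hs => ?_)
      rw [Function.comp_apply, Real.norm_of_nonneg (Real.exp_pos _).le]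
      refine Real.exp_le_exp.2 (mul_le_mul_of_nonneg_left ?_ ht.le)
      exact (le_abs_self _).trans (hC s hs.2)
    have hvol : volume (Set.Ioc 0 t) = ENNReal.ofReal t := by simp
    have hJ := convexOn_exp.map_set_average_le (μ := volume) (t := Set.Ioc 0 t)
      (f := fun s => t * g (V (walk κ x η s))) Real.continuous_exp.continuousOn isClosed_univ
      (by simp [hvol, ht]) (by simp) (by simp) hint hint2
    rw [setAverage_eq, setAverage_eq, measureReal_def, hvol, ENNReal.toReal_ofReal ht.le,
      smul_eq_mul, smul_eq_mul, integral_const_mul, inv_mul_cancel_left₀ ht.ne',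
      ← intervalIntegral.integral_of_le ht.le] at hJ
    calc ENNReal.ofReal (Real.exp (action κ (fun y => g (V y)) x η t))
        ≤ ENNReal.ofReal (t⁻¹ * ∫ s in Set.Ioc 0 t, Real.exp (t * g (V (walk κ x η s)))) :=
          ENNReal.ofReal_le_ofReal hJ
      _ = _ := by
          rw [ENNReal.ofReal_mul (by positivity), one_div]
          congr 1
          refine ofReal_integral_eq_lintegral_ofReal hint2 ?_
          exact Eventually.of_forall fun s => (Real.exp_pos _).le
  have hjm : Measurable fun p : (Lattice d → ℝ) × ℝ =>
      ENNReal.ofReal (Real.exp (t * g (p.1 (walk κ x η p.2)))) := by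
    refine (Real.measurable_exp.comp (Measurable.const_mul (hg.comp ?_) t)).ennreal_ofReal
    exact (measurable_potential_walk κ x).comp
      (f := fun p : (Lattice d → ℝ) × ℝ => (p.1, η, p.2)) (by fun_prop)
  refine (lintegral_mono hV).trans ?_
  rw [lintegral_const_mul _ hjm.lintegral_prod_right', lintegral_lintegral_swap hjm.aemeasurable]
  -- With the path frozen, the potential at the occupied site has law `μ` at every time, so the time
  -- average is that of a constant.
  have hin : ∀ s, ∫⁻ V, ENNReal.ofReal (Real.exp (t * g (V (walk κ x η s)))) ∂(fieldMeasure d μ)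
      = ∫⁻ y, ENNReal.ofReal (Real.exp (t * g y)) ∂μ := fun s =>
    (measurePreserving_eval_field μ (walk κ x η s)).lintegral_comp
      (f := fun y => ENNReal.ofReal (Real.exp (t * g y)))
      (Real.measurable_exp.comp (hg.const_mul t)).ennreal_ofReal
  simp_rw [hin]
  rw [setLIntegral_const, Real.volume_Ioc, sub_zero, mul_comm _ (ENNReal.ofReal t), ← mul_assoc,
    ← ENNReal.ofReal_mul (by positivity), one_div, inv_mul_cancel₀ ht.ne']
  simp

theorem measurable_exp_action (κ : ℝ) (x : Lattice d) (t : ℝ) :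
    Measurable fun p : (Lattice d → ℝ) × Path d =>
      ENNReal.ofReal (Real.exp (action κ p.1 x p.2 t)) :=
  (Real.measurable_exp.comp ((measurable_action κ x).comp
    (f := fun p : (Lattice d → ℝ) × Path d => (p.1, p.2, t)) (by fun_prop))).ennreal_ofReal

theorem lintegral_setLIntegral_exp_action_le [NeZero d] (μ : Measure ℝ) [IsProbabilityMeasure μ]
    {κ : ℝ} (hκ : 0 < κ) {g : ℝ → ℝ} (hg : Measurable g) (x : Lattice d) {t : ℝ} (ht : 0 ≤ t)
    (S : Set (Path d)) :
    ∫⁻ V, ∫⁻ η in S, ENNReal.ofReal (Real.exp (action κ (fun y => g (V y)) x η t)) ∂(walkMeasure d)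
      ∂(fieldMeasure d μ)
      ≤ (∫⁻ y, ENNReal.ofReal (Real.exp (t * g y)) ∂μ) * walkMeasure d S := by
  have hm : Measurable fun p : (Lattice d → ℝ) × Path d =>
      ENNReal.ofReal (Real.exp (action κ (fun y => g (p.1 y)) x p.2 t)) :=
    (measurable_exp_action κ x t).comp
      (f := fun p : (Lattice d → ℝ) × Path d => ((fun y => g (p.1 y)), p.2)) (by fun_prop)
  rw [lintegral_lintegral_swap hm.aemeasurable, ← setLIntegral_const]
  refine lintegral_mono_ae ?_
  filter_upwards [ae_restrict_of_ae (ae_isGood hκ)] with η hη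
  exact lintegral_exp_action_le μ hη hg x ht

theorem lintegral_fk_top_comp_le [NeZero d] (μ : Measure ℝ) [IsProbabilityMeasure μ]
    {κ : ℝ} (hκ : 0 < κ) {g : ℝ → ℝ} (hg : Measurable g) (x : Lattice d) {t : ℝ} (ht : 0 ≤ t) :
    ∫⁻ V, fk ⊤ κ (fun y => g (V y)) t x ∂(fieldMeasure d μ)
      ≤ ∫⁻ y, ENNReal.ofReal (Real.exp (t * g y)) ∂μ := by
  have := lintegral_setLIntegral_exp_action_le μ hκ hg x ht Set.univ
  simpa [fk_top] using this

theorem lintegral_rpow_le_rpow {α : Type*} [MeasurableSpace α] (μ : Measure α)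
    [IsProbabilityMeasure μ] {f : α → ℝ≥0∞} (hf : AEMeasurable f μ) {p : ℝ} (hp : 1 < p) :
    (∫⁻ a, f a ∂μ) ^ p ≤ ∫⁻ a, f a ^ p ∂μ := by
  have hpq := Real.HolderConjugate.conjExponent hp
  have h := ENNReal.lintegral_mul_le_Lp_mul_Lq μ hpq hf (aemeasurable_const (b := (1 : ℝ≥0∞)))
  have h1 : (∫⁻ a, f a ∂μ) ≤ (∫⁻ a, f a ^ p ∂μ) ^ (1 / p) := by
    simpa using h
  calc (∫⁻ a, f a ∂μ) ^ p ≤ ((∫⁻ a, f a ^ p ∂μ) ^ (1 / p)) ^ p :=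
        ENNReal.rpow_le_rpow h1 (by linarith)
    _ = _ := by rw [← ENNReal.rpow_mul, one_div_mul_cancel (by linarith), ENNReal.rpow_one]

/-- Jensen's inequality turns a power into a rescaling of the potential at the same time `t`. The
first moment bound then controls moments of order `p` by `exp (H (p * t))`. -/
theorem fk_top_rpow_le [NeZero d] (κ : ℝ) (V : Lattice d → ℝ) (t : ℝ) (x : Lattice d) {p : ℝ}
    (hp : 1 < p) : fk ⊤ κ V t x ^ p ≤ fk ⊤ κ (fun y => p * V y) t x := by
  rw [fk_top, fk_top]
  have hm : Measurable fun η : Path d => ENNReal.ofReal (Real.exp (action κ V x η t)) :=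
    (measurable_exp_action κ x t).comp (f := fun η : Path d => (V, η)) (by fun_prop)
  refine (lintegral_rpow_le_rpow _ hm.aemeasurable hp).trans (le_of_eq ?_)
  refine lintegral_congr fun η => ?_
  rw [ENNReal.ofReal_rpow_of_pos (Real.exp_pos _), ← Real.exp_mul, action, action,
    intervalIntegral.integral_const_mul, mul_comm]

theorem lintegral_fk_top_rpow_le [NeZero d] (μ : Measure ℝ) [IsProbabilityMeasure μ]
    {κ : ℝ} (hκ : 0 < κ) (x : Lattice d) {t : ℝ} (ht : 0 ≤ t) {p : ℝ} (hp : 1 < p) :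
    ∫⁻ V, fk ⊤ κ V t x ^ p ∂(fieldMeasure d μ)
      ≤ ∫⁻ y, ENNReal.ofReal (Real.exp (p * t * y)) ∂μ := by
  refine (lintegral_mono fun V => fk_top_rpow_le κ V t x hp).trans ?_
  refine (lintegral_fk_top_comp_le μ hκ (g := fun y => p * y) (by fun_prop) x ht).trans ?_
  refine le_of_eq (lintegral_congr fun y => ?_)
  ring_nf

/-- The contribution to the Feynman-Kac expectation of at least `n` jumps. -/
noncomputable def fkRest [NeZero d] (n : ℕ) (κ : ℝ) (V : Lattice d → ℝ) (t : ℝ) (x : Lattice d) :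
    ℝ≥0∞ :=
  ∫⁻ η in {η | n ≤ jumpCount κ η t}, ENNReal.ofReal (Real.exp (action κ V x η t)) ∂(walkMeasure d)

theorem measurableSet_le_jumpCount (n : ℕ) (κ t : ℝ) :
    MeasurableSet {η : Path d | n ≤ jumpCount κ η t} :=
  ((measurable_jumpCount κ).comp (f := fun η : Path d => (η, t)) (by fun_prop))
    (MeasurableSet.of_discrete (s := {c : ℕ | n ≤ c}))

theorem fk_top_eq_add [NeZero d] (n : ℕ) (κ : ℝ) (V : Lattice d → ℝ) (t : ℝ) (x : Lattice d) :
    fk ⊤ κ V t x = fk n κ V t x + fkRest n κ V t x := by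
  have hS := measurableSet_le_jumpCount (d := d) n κ t
  rw [fk_top, fk, fkRest, ← lintegral_add_compl _ hS, add_comm]
  congr 1
  rw [← lintegral_indicator hS.compl]
  refine lintegral_congr fun η => ?_
  congr 1
  ext η
  simp

theorem walkMeasure_le_jumpCount [NeZero d] {κ : ℝ} (hκ : 0 < κ) (t : ℝ) {n : ℕ} (hn : n ≠ 0) :
    walkMeasure d {η | n ≤ jumpCount κ η t}
      ≤ ENNReal.ofReal (Real.exp ((Real.exp 1 - 1) * (2 * d * κ) * t - n)) := by
  -- At least `m + 1` jumps by time `t` means that the jump with index `m`, counted from 0, has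
  -- occurred.
  obtain ⟨m, rfl⟩ := Nat.exists_eq_succ_of_ne_zero hn
  have h := walkMeasure_jumpTime_le (d := d) hκ t m
  rw [Nat.succ_eq_add_one, Nat.cast_add_one]
  refine (measure_mono_ae ?_).trans h
  filter_upwards [ae_isGood hκ] with η hη hle
  by_contra hlt
  have hlt' : t < jumpTime κ η m := not_le.1 hlt
  have hsub : {k | jumpTime κ η k ≤ t} ⊆ (Finset.range m : Set ℕ) := by
    intro k hk
    simp only [Finset.coe_range, Set.mem_Iio]
    by_contra hkm
    have h1 := jumpTime_mono hκ hη.nonneg (not_lt.1 hkm)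
    have hk' : jumpTime κ η k ≤ t := hk
    linarith
  have h2 := Set.ncard_le_ncard hsub (Finset.finite_toSet _)
  rw [Set.ncard_coe_finset, Finset.card_range] at h2
  have h3 : m + 1 ≤ jumpCount κ η t := hle
  unfold jumpCount at h3
  omega

theorem lintegral_fkRest_le [NeZero d] (μ : Measure ℝ) [IsProbabilityMeasure μ] {κ : ℝ}
    (hκ : 0 < κ) (x : Lattice d) {t : ℝ} (ht : 0 ≤ t) {n : ℕ} (hn : n ≠ 0) :
    ∫⁻ V, fkRest n κ V t x ∂(fieldMeasure d μ)
      ≤ (∫⁻ y, ENNReal.ofReal (Real.exp (t * y)) ∂μ) *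
        ENNReal.ofReal (Real.exp ((Real.exp 1 - 1) * (2 * d * κ) * t - n)) :=
  (lintegral_setLIntegral_exp_action_le μ hκ measurable_id x ht _).trans
    (by gcongr; · rfl
        · exact walkMeasure_le_jumpCount hκ t hn)

theorem action_shift (κ : ℝ) (V : Lattice d → ℝ) (x : Lattice d) (η : Path d) (t : ℝ) :
    action κ V x η t = action κ (fun y => V (y + x)) 0 η t := by
  simp only [action, walk, zero_add, add_comm x]

theorem fk_shift [NeZero d] (n : ℕ∞) (κ : ℝ) (V : Lattice d → ℝ) (t : ℝ) (x : Lattice d) :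
    fk n κ V t x = fk n κ (fun y => V (y + x)) t 0 := by
  simp only [fk, action_shift κ V x]

theorem abs_unitVec_le (e : Fin d × Bool) (i : Fin d) : |unitVec e i| ≤ 1 := by
  unfold unitVec
  by_cases h : i = e.1
  · subst h
    simp only [Pi.single_eq_same]
    split_ifs <;> simp
  · simp [Pi.single_eq_of_ne h]

theorem abs_sum_unitVec_le (η : Path d) (c : ℕ) (i : Fin d) :
    |(∑ j ∈ Finset.range c, unitVec (η j).2) i| ≤ c := by
  rw [Finset.sum_apply]
  refine (Finset.abs_sum_le_sum_abs _ _).trans ?_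
  refine (Finset.sum_le_sum fun j _ => abs_unitVec_le (η j).2 i).trans ?_
  simp

/-- With fewer than `n` jumps only the potential within distance `n` matters. -/
theorem fk_congr [NeZero d] (n : ℕ) {κ : ℝ} (hκ : 0 < κ) {V V' : Lattice d → ℝ} {t : ℝ}
    (ht : 0 ≤ t) (x : Lattice d) (h : ∀ y : Lattice d, (∀ i, |y i - x i| ≤ n) → V y = V' y) :
    fk n κ V t x = fk n κ V' t x := by
  refine lintegral_congr_ae ?_
  filter_upwards [ae_isGood hκ] with η hη
  by_cases hj : (jumpCount κ η t : ℕ∞) < n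
  · rw [Set.indicator_of_mem (by exact hj), Set.indicator_of_mem (by exact hj), action, action]
    congr 2
    refine intervalIntegral.integral_congr fun s hs => ?_
    rw [Set.uIcc_of_le ht] at hs
    refine h _ fun i => ?_
    simp only [walk, Pi.add_apply, add_sub_cancel_left]
    refine (abs_sum_unitVec_le η _ i).trans ?_
    have h1 := hη.jumpCount_mono hs.2
    have h2 : jumpCount κ η t < n := by exact_mod_cast hj
    exact_mod_cast h1.trans h2.le
  · rw [Set.indicator_of_notMem (by exact hj), Set.indicator_of_notMem (by exact hj)]

/-- For a nonnegative potential the exponent increases with time. Passing to the positive part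
reduces finiteness at all times up to `T` to finiteness at `T`, which leaves countably many
conditions for `ae_finiteFK`. -/
theorem fk_top_mono_posPart [NeZero d] {κ : ℝ} (hκ : 0 < κ) (V : Lattice d → ℝ) {t T : ℝ}
    (ht : 0 ≤ t) (htT : t ≤ T) (x : Lattice d) :
    fk ⊤ κ V t x ≤ fk ⊤ κ (fun y => max (V y) 0) T x := by
  rw [fk_top, fk_top]
  refine lintegral_mono_ae ?_
  filter_upwards [ae_isGood hκ] with η hη
  refine ENNReal.ofReal_le_ofReal (Real.exp_le_exp.2 ?_)
  unfold action
  have h1 : ∫ s in (0 : ℝ)..t, V (walk κ x η s)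
      ≤ ∫ s in (0 : ℝ)..t, max (V (walk κ x η s)) 0 :=
    intervalIntegral.integral_mono_on ht (hη.intervalIntegrable V x 0 t)
      (hη.intervalIntegrable (fun y => max (V y) 0) x 0 t) fun s _ => le_max_left _ _
  refine h1.trans ?_
  exact intervalIntegral.integral_mono_interval le_rfl ht htT
    (Eventually.of_forall fun s => le_max_right _ _)
    (hη.intervalIntegrable (fun y => max (V y) 0) x 0 T)

end Annealed

/-! ### The Feynman-Kac formula solves the parabolic Anderson equation -/

section Equation

variable {d : ℕ}

/-- Potentials for which all Feynman-Kac expectations are finite, locally uniformly in time. -/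
def FiniteFK [NeZero d] (κ : ℝ) (V : Lattice d → ℝ) : Prop :=
  ∀ (T : ℕ) (x : Lattice d), fk ⊤ κ (fun y => max (V y) 0) T x < ∞

theorem FiniteFK.lt_top [NeZero d] {κ : ℝ} (hκ : 0 < κ) {V : Lattice d → ℝ} (h : FiniteFK κ V)
    {t : ℝ} (ht : 0 ≤ t) (x : Lattice d) : fk ⊤ κ V t x < ∞ := by
  obtain ⟨T, hT⟩ := exists_nat_ge t
  exact (fk_top_mono_posPart hκ V ht hT x).trans_lt (h T x)

theorem FiniteFK.solution_le [NeZero d] {κ : ℝ} (hκ : 0 < κ) {V : Lattice d → ℝ}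
    (h : FiniteFK κ V) {t : ℝ} (ht : 0 ≤ t) {T : ℕ} (htT : t ≤ T) (x : Lattice d) :
    solution κ V t x ≤ (fk ⊤ κ (fun y => max (V y) 0) T x).toReal := by
  rw [solution_eq_toReal_fk]
  exact ENNReal.toReal_mono (h T x).ne (fk_top_mono_posPart hκ V ht htT x)

theorem solution_nonneg [NeZero d] (κ : ℝ) (V : Lattice d → ℝ) (t : ℝ) (x : Lattice d) :
    0 ≤ solution κ V t x := by
  rw [solution_eq_toReal_fk]
  exact ENNReal.toReal_nonneg

theorem solution_zero_left [NeZero d] (κ : ℝ) (V : Lattice d → ℝ) (x : Lattice d) :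
    solution κ V 0 x = 1 := by
  simp [solution]

theorem measurable_solution_time [NeZero d] (κ : ℝ) (V : Lattice d → ℝ) (x : Lattice d) :
    Measurable fun t => solution κ V t x := by
  simp_rw [solution_eq_toReal_fk]
  exact (measurable_fk_time ⊤ κ V x).ennreal_toReal

theorem FiniteFK.intervalIntegrable [NeZero d] {κ : ℝ} (hκ : 0 < κ) {V : Lattice d → ℝ}
    (h : FiniteFK κ V) (a : ℝ) (x : Lattice d) {t : ℝ} (ht : 0 ≤ t) :
    IntervalIntegrable (fun s => κ * Real.exp (-(a * s)) * ∑ e, solution κ V s (x + unitVec e))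
      volume 0 t := by
  obtain ⟨T, hT⟩ := exists_nat_ge t
  have hb : IntervalIntegrable (fun s => ∑ e, solution κ V s (x + unitVec e)) volume 0 t := by
    rw [intervalIntegrable_iff_integrableOn_Ioc_of_le ht]
    refine Measure.integrableOn_of_bounded
      (M := ∑ e, (fk ⊤ κ (fun y => max (V y) 0) T (x + unitVec e)).toReal) (by simp)
      (Finset.measurable_sum _ fun e _ =>
        measurable_solution_time κ V _).aestronglyMeasurable ?_
    refine (ae_restrict_iff' measurableSet_Ioc).2 (Eventually.of_forall fun s hs => ?_)
    rw [Real.norm_of_nonneg (Finset.sum_nonneg fun e _ => solution_nonneg κ V s _)]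
    exact Finset.sum_le_sum fun e _ => h.solution_le hκ hs.1.le (hs.2.trans hT) _
  exact hb.continuousOn_mul (by fun_prop)

/-- The integral form of the parabolic Anderson equation. -/
theorem FiniteFK.solution_eq [NeZero d] {κ : ℝ} (hκ : 0 < κ) {V : Lattice d → ℝ}
    (h : FiniteFK κ V) {t : ℝ} (ht : 0 ≤ t) (x : Lattice d) :
    solution κ V t x = Real.exp ((V x - 2 * d * κ) * t) * (1 + ∫ s in (0 : ℝ)..t,
      κ * Real.exp (-((V x - 2 * d * κ) * s)) * ∑ e, solution κ V s (x + unitVec e)) := by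
  set a := V x - 2 * d * κ with ha
  have hrec := fk_add_one ⊤ hκ V ht x
  rw [top_add, ← ha] at hrec
  have hfin : ∫⁻ s in Set.Ioc 0 t, ENNReal.ofReal (κ * Real.exp (a * s)) *
        ∑ e, fk ⊤ κ V (t - s) (x + unitVec e) ≠ ∞ := by
    intro htop
    rw [htop, add_top] at hrec
    exact (h.lt_top hκ ht x).ne hrec
  have hval : (∫⁻ s in Set.Ioc 0 t, ENNReal.ofReal (κ * Real.exp (a * s)) *
        ∑ e, fk ⊤ κ V (t - s) (x + unitVec e)).toReal
      = ∫ s in (0 : ℝ)..t, κ * Real.exp (a * s) * ∑ e, solution κ V (t - s) (x + unitVec e) := by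
    rw [intervalIntegral.integral_of_le ht, integral_eq_lintegral_of_nonneg_ae]
    · congr 1
      refine setLIntegral_congr_fun measurableSet_Ioc fun s hs => ?_
      rw [ENNReal.ofReal_mul (q := ∑ e, _) (by positivity), ENNReal.ofReal_sum_of_nonneg
        fun e _ => solution_nonneg κ V _ _]
      congr 1
      refine Finset.sum_congr rfl fun e _ => ?_
      rw [solution_eq_toReal_fk, ENNReal.ofReal_toReal (h.lt_top hκ (by linarith [hs.2]) _).ne]
    · refine Eventually.of_forall fun s => ?_
      exact mul_nonneg (by positivity) (Finset.sum_nonneg fun e _ => solution_nonneg κ V _ _)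
    · refine Measurable.aestronglyMeasurable (Measurable.mul (by fun_prop)
        (Finset.measurable_sum _ fun e _ => ?_))
      exact (measurable_solution_time κ V _).comp (by fun_prop)
  -- Reversing time lets `t` enter only through an exponential prefactor and the endpoint of
  -- integration, so the formula can be differentiated in `t`.
  have hsub := intervalIntegral.integral_comp_sub_left (a := 0) (b := t)
    (fun s => κ * Real.exp (a * (t - s)) * ∑ e, solution κ V s (x + unitVec e)) t
  simp only [sub_sub_cancel, sub_self, sub_zero] at hsub
  rw [solution_eq_toReal_fk, hrec, ENNReal.toReal_add ENNReal.ofReal_ne_top hfin, hval,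
    ENNReal.toReal_ofReal (Real.exp_pos _).le, hsub, mul_add, mul_one,
    ← intervalIntegral.integral_const_mul]
  congr 1
  refine intervalIntegral.integral_congr fun s _ => ?_
  have : Real.exp (a * (t - s)) = Real.exp (a * t) * Real.exp (-(a * s)) := by
    rw [← Real.exp_add]
    ring_nf
  simp only [this]
  ring

/-- First half of a bootstrap: a bounded measurable integrand in the integral equation gives a
continuous solution. The integrand is then itself continuous at positive times, which gives the
derivative in `FiniteFK.hasDerivAt`. -/
theorem FiniteFK.continuousOn [NeZero d] {κ : ℝ} (hκ : 0 < κ) {V : Lattice d → ℝ}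
    (h : FiniteFK κ V) (x : Lattice d) :
    ContinuousOn (fun t => solution κ V t x) (Set.Ici 0) := by
  intro t ht
  have ht0 : (0 : ℝ) ≤ t := ht
  have hprim := intervalIntegral.continuousOn_primitive_interval'
    (h.intervalIntegrable hκ (V x - 2 * d * κ) x (t := t + 1) (by linarith))
    (Set.left_mem_uIcc (a := 0) (b := t + 1))
  have hc : ContinuousOn (fun t => solution κ V t x) (Set.Icc 0 (t + 1)) := by
    have : ContinuousOn (fun t => Real.exp ((V x - 2 * d * κ) * t) * (1 + ∫ s in (0 : ℝ)..t,
        κ * Real.exp (-((V x - 2 * d * κ) * s)) * ∑ e, solution κ V s (x + unitVec e)))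
        (Set.Icc 0 (t + 1)) := by
      rw [Set.uIcc_of_le (by linarith)] at hprim
      exact ContinuousOn.mul (by fun_prop) (continuousOn_const.add hprim)
    exact this.congr fun s hs => h.solution_eq hκ hs.1 x
  have := hc t ⟨ht0, by linarith⟩
  refine this.mono_of_mem_nhdsWithin ?_
  rw [← Set.Ici_inter_Iic]
  exact inter_mem self_mem_nhdsWithin (mem_nhdsWithin_of_mem_nhds (Iic_mem_nhds (by linarith)))

theorem FiniteFK.hasDerivAt [NeZero d] {κ : ℝ} (hκ : 0 < κ) {V : Lattice d → ℝ}
    (h : FiniteFK κ V) {t : ℝ} (ht : 0 < t) (x : Lattice d) :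
    HasDerivAt (fun s => solution κ V s x)
      (κ * laplacian (solution κ V t) x + V x * solution κ V t x) t := by
  set a := V x - 2 * d * κ with ha
  set F : ℝ → ℝ := fun s => κ * Real.exp (-(a * s)) * ∑ e, solution κ V s (x + unitVec e) with hF
  have hFc : ContinuousAt F t := by
    refine ContinuousAt.mul (by fun_prop) ?_
    refine tendsto_finsetSum _ fun e _ => ?_
    exact (h.continuousOn hκ (x + unitVec e)).continuousAt (Ici_mem_nhds ht)
  have hFm : StronglyMeasurableAtFilter F (𝓝 t) := by
    refine Measurable.stronglyMeasurable ?_ |>.stronglyMeasurableAtFilter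
    exact Measurable.mul (by fun_prop)
      (Finset.measurable_sum _ fun e _ => measurable_solution_time κ V _)
  have hI := intervalIntegral.integral_hasDerivAt_right
    (h.intervalIntegrable hκ a x ht.le) hFm hFc
  have hE : HasDerivAt (fun s => Real.exp (a * s)) (Real.exp (a * t) * a) t := by
    simpa using ((hasDerivAt_id t).const_mul a).exp
  have hprod := hE.mul (hI.const_add 1)
  have heq : (fun s => solution κ V s x) =ᶠ[𝓝 t]
      fun s => Real.exp (a * s) * (1 + ∫ r in (0 : ℝ)..s, F r) := by
    filter_upwards [Ioi_mem_nhds ht] with s hs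
    exact h.solution_eq hκ (le_of_lt hs) x
  refine (hprod.congr_of_eventuallyEq heq).congr_deriv ?_
  have h1 : Real.exp (a * t) * (1 + ∫ r in (0 : ℝ)..t, F r) = solution κ V t x :=
    (h.solution_eq hκ ht.le x).symm
  have h2 : Real.exp (a * t) * F t = κ * ∑ e, solution κ V t (x + unitVec e) := by
    simp only [hF]
    rw [mul_comm κ, mul_assoc, ← mul_assoc, ← Real.exp_add]
    simp
  have hlap : laplacian (solution κ V t) x
      = ∑ e, solution κ V t (x + unitVec e) - 2 * d * solution κ V t x := by
    simp only [laplacian, Finset.sum_sub_distrib, Finset.sum_const, nsmul_eq_mul,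
      Finset.card_univ, Fintype.card_prod, Fintype.card_fin, Fintype.card_bool]
    push_cast
    ring
  rw [h2, mul_right_comm, h1, hlap, ha]
  ring

theorem FiniteFK.isSolution [NeZero d] {κ : ℝ} (hκ : 0 < κ) {V : Lattice d → ℝ}
    (h : FiniteFK κ V) : IsSolution κ V (solution κ V) where
  nonneg t _ x := solution_nonneg κ V t x
  initial x := solution_zero_left κ V x
  continuousOn x := h.continuousOn hκ x
  equation _ ht x := h.hasDerivAt hκ ht x

theorem ae_finiteFK [NeZero d] {κ : ℝ} (hκ : 0 < κ) (μ : Measure ℝ) [IsProbabilityMeasure μ]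
    (hexp : ∀ t : ℝ, 0 ≤ t → Integrable (fun y => Real.exp (t * y)) μ) :
    ∀ᵐ V ∂(fieldMeasure d μ), FiniteFK κ V := by
  refine ae_all_iff.2 fun T => ae_all_iff.2 fun x => ?_
  refine ae_lt_top ((measurable_fk ⊤ κ T x).comp
    (f := fun (V : Lattice d → ℝ) y => max (V y) 0) (by fun_prop)) ?_
  refine ((lintegral_fk_top_comp_le μ hκ (g := fun y => max y 0) (by fun_prop) x
    (Nat.cast_nonneg T)).trans_lt ?_).ne
  have hle : ∀ y : ℝ, ENNReal.ofReal (Real.exp (T * max y 0))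
      ≤ 1 + ENNReal.ofReal (Real.exp (T * y)) := by
    intro y
    rcases le_total y 0 with hy | hy
    · simp [max_eq_right hy]
    · rw [max_eq_left hy]
      exact le_add_self
  refine (lintegral_mono hle).trans_lt ?_
  rw [lintegral_add_left measurable_const]
  have := (hexp T (Nat.cast_nonneg T)).lintegral_lt_top
  simpa using this

end Equation

end PAM

namespace PAM

open scoped ENNReal

/-! ### Semigroups of symmetric matrices -/

section SymmetricExp

variable {ι : Type*} [Fintype ι] [DecidableEq ι]

/-- The matrix semigroup generated by `A`. -/
noncomputable def matExp (A : Matrix ι ι ℝ) (t : ℝ) : Matrix ι ι ℝ := NormedSpace.exp (t • A)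

theorem exp_apply_nonneg {B : Matrix ι ι ℝ} (hB : ∀ x y, 0 ≤ B x y) (x y : ι) :
    0 ≤ NormedSpace.exp B x y := by
  let _ := Matrix.linftyOpNormedRing (α := ℝ) (n := ι)
  let _ := Matrix.linftyOpNormedAlgebra (R := ℝ) (α := ℝ) (n := ι)
  have h := NormedSpace.exp_series_hasSum_exp' (𝕂 := ℝ) B
  have h2 : HasSum (fun n : ℕ => ((n.factorial : ℝ)⁻¹ • B ^ n) x y) (NormedSpace.exp B x y) :=
    Pi.hasSum.1 (Pi.hasSum.1 h x) y
  refine h2.nonneg fun n => ?_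
  have hpow : ∀ n : ℕ, ∀ x y, 0 ≤ (B ^ n) x y := by
    intro n
    induction n with
    | zero =>
      intro x y
      rw [pow_zero, Matrix.one_apply]
      split_ifs <;> norm_num
    | succ n ih =>
      intro x y
      rw [pow_succ, Matrix.mul_apply]
      exact Finset.sum_nonneg fun z _ => mul_nonneg (ih x z) (hB z y)
  rw [Matrix.smul_apply, smul_eq_mul]
  exact mul_nonneg (by positivity) (hpow n x y)

/-- Adding a large multiple of the identity makes all entries nonnegative, and it changes the
exponential only by a positive scalar. -/
theorem matExp_nonneg {A : Matrix ι ι ℝ} (hA : ∀ x y, x ≠ y → 0 ≤ A x y) {t : ℝ} (ht : 0 ≤ t)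
    (x y : ι) : 0 ≤ matExp A t x y := by
  set c : ℝ := ∑ z, |A z z| with hc
  have h1 : t • A = (t • (A + c • (1 : Matrix ι ι ℝ))) + Matrix.diagonal (fun _ : ι => -(t * c)) := by
    ext i j
    by_cases hij : i = j
    · subst hij; simp
    · simp [hij]
  have hcomm : Commute (t • (A + c • (1 : Matrix ι ι ℝ)))
      (Matrix.diagonal (fun _ : ι => -(t * c))) := by
    have : Matrix.diagonal (fun _ : ι => -(t * c)) = (-(t * c)) • (1 : Matrix ι ι ℝ) := by
      rw [Matrix.smul_one_eq_diagonal]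
    rw [this]
    exact (Commute.one_right _).smul_right _
  rw [matExp, h1, Matrix.exp_add_of_commute _ _ hcomm, Matrix.exp_diagonal, Matrix.mul_diagonal]
  refine mul_nonneg (exp_apply_nonneg (fun i j => ?_) x y) ?_
  · rw [Matrix.smul_apply, smul_eq_mul]
    refine mul_nonneg ht ?_
    by_cases hij : i = j
    · subst hij
      have : |A i i| ≤ c := Finset.single_le_sum (f := fun z => |A z z|)
        (fun _ _ => abs_nonneg _) (Finset.mem_univ i)
      simp only [Matrix.add_apply, Matrix.smul_apply, Matrix.one_apply_eq, smul_eq_mul, mul_one]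
      linarith [neg_abs_le (A i i)]
    · simpa [hij] using hA i j hij
  · rw [Pi.coe_exp, ← Real.exp_eq_exp_ℝ]
    exact (Real.exp_pos _).le

/-- Spectral data of a symmetric matrix. -/
structure SpectralData (A : Matrix ι ι ℝ) where
  val : ι → ℝ
  vec : ι → ι → ℝ
  orthonormal : ∀ i j, ∑ x, vec i x * vec j x = if i = j then 1 else 0
  complete : ∀ x y, ∑ i, vec i x * vec i y = if x = y then 1 else 0
  matrix_eq : ∀ x y, A x y = ∑ i, val i * (vec i x * vec i y)
  exp_eq : ∀ t x y, matExp A t x y = ∑ i, Real.exp (t * val i) * (vec i x * vec i y)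

/-- Spectral data of a symmetric matrix exist. -/
noncomputable def spectralData {A : Matrix ι ι ℝ} (hA : A.IsSymm) : SpectralData A := by
  have hH : A.IsHermitian := by
    rw [Matrix.IsHermitian, Matrix.conjTranspose_eq_transpose_of_trivial]
    exact hA
  have hU1 : (hH.eigenvectorUnitary : Matrix ι ι ℝ) * star (hH.eigenvectorUnitary : Matrix ι ι ℝ)
      = 1 := Unitary.coe_mul_star_self _
  have hU2 : star (hH.eigenvectorUnitary : Matrix ι ι ℝ) * (hH.eigenvectorUnitary : Matrix ι ι ℝ)
      = 1 := Unitary.coe_star_mul_self _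
  have hspec : A = (hH.eigenvectorUnitary : Matrix ι ι ℝ) * Matrix.diagonal hH.eigenvalues *
      star (hH.eigenvectorUnitary : Matrix ι ι ℝ) := by
    have := hH.spectral_theorem
    rwa [Unitary.conjStarAlgAut_apply] at this
  refine ⟨hH.eigenvalues, fun i x => (hH.eigenvectorUnitary : Matrix ι ι ℝ) x i, ?_, ?_, ?_, ?_⟩
  · intro i j
    have := congrFun (congrFun hU2 i) j
    rw [Matrix.mul_apply, Matrix.one_apply] at this
    simpa [Matrix.star_apply] using this
  · intro x y
    have := congrFun (congrFun hU1 x) y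
    rw [Matrix.mul_apply, Matrix.one_apply] at this
    simpa [Matrix.star_apply] using this
  · intro x y
    have := congrFun (congrFun hspec x) y
    rw [Matrix.mul_apply] at this
    rw [this]
    refine Finset.sum_congr rfl fun i _ => ?_
    rw [Matrix.mul_diagonal, Matrix.star_apply, star_trivial]
    ring
  · intro t x y
    have h1 : t • A = ((Unitary.toUnits hH.eigenvectorUnitary : (Matrix ι ι ℝ)ˣ) : Matrix ι ι ℝ) *
        Matrix.diagonal (t • hH.eigenvalues) *
        ((Unitary.toUnits hH.eigenvectorUnitary)⁻¹ : (Matrix ι ι ℝ)ˣ) := by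
      conv_lhs => rw [hspec]
      rw [Matrix.diagonal_smul, Matrix.mul_smul, Matrix.smul_mul]
      rfl
    have h2 : matExp A t = (hH.eigenvectorUnitary : Matrix ι ι ℝ) *
        Matrix.diagonal (NormedSpace.exp (t • hH.eigenvalues)) *
        star (hH.eigenvectorUnitary : Matrix ι ι ℝ) := by
      rw [matExp, h1, Matrix.exp_units_conj, Matrix.exp_diagonal]
      rfl
    rw [h2, Matrix.mul_apply]
    refine Finset.sum_congr rfl fun i _ => ?_
    rw [Matrix.mul_diagonal, Matrix.star_apply, star_trivial, Pi.coe_exp, ← Real.exp_eq_exp_ℝ,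
      Pi.smul_apply, smul_eq_mul]
    ring

variable {A : Matrix ι ι ℝ}

theorem SpectralData.matExp_zero (D : SpectralData A) (x y : ι) :
    matExp A 0 x y = if x = y then 1 else 0 := by
  rw [D.exp_eq, ← D.complete]
  simp

theorem SpectralData.sum_mul_vec (D : SpectralData A) (i x : ι) :
    ∑ y, A x y * D.vec i y = D.val i * D.vec i x := by
  simp_rw [D.matrix_eq, Finset.sum_mul]
  rw [Finset.sum_comm]
  have : ∀ j, ∑ y, D.val j * (D.vec j x * D.vec j y) * D.vec i y
      = D.val j * D.vec j x * if j = i then 1 else 0 := by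
    intro j
    rw [← D.orthonormal, Finset.mul_sum]
    exact Finset.sum_congr rfl fun y _ => by ring
  simp [this]

theorem SpectralData.sum_mul_matExp (D : SpectralData A) (t : ℝ) (x y : ι) :
    ∑ z, A x z * matExp A t z y
      = ∑ i, Real.exp (t * D.val i) * D.val i * (D.vec i x * D.vec i y) := by
  simp_rw [D.exp_eq, Finset.mul_sum]
  rw [Finset.sum_comm]
  refine Finset.sum_congr rfl fun i _ => ?_
  have : ∀ z, A x z * (Real.exp (t * D.val i) * (D.vec i z * D.vec i y))
      = Real.exp (t * D.val i) * D.vec i y * (A x z * D.vec i z) := fun z => by ring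
  simp_rw [this]
  rw [← Finset.mul_sum, D.sum_mul_vec]
  ring

theorem SpectralData.matExp_symm (D : SpectralData A) (t : ℝ) (x y : ι) :
    matExp A t x y = matExp A t y x := by
  rw [D.exp_eq, D.exp_eq]
  exact Finset.sum_congr rfl fun i _ => by ring

theorem SpectralData.hasDerivAt (D : SpectralData A) (t : ℝ) (x y : ι) :
    HasDerivAt (fun t => matExp A t x y) (∑ z, A x z * matExp A t z y) t := by
  rw [D.sum_mul_matExp]
  have : (fun t => matExp A t x y)
      = fun t => ∑ i, Real.exp (t * D.val i) * (D.vec i x * D.vec i y) :=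
    funext fun t => D.exp_eq t x y
  rw [this]
  refine HasDerivAt.fun_sum fun i _ => ?_
  have := (((hasDerivAt_id t).mul_const (D.val i)).exp).mul_const (D.vec i x * D.vec i y)
  simpa using this

/-- The quadratic form of `A`. -/
noncomputable def quadForm (A : Matrix ι ι ℝ) (f : ι → ℝ) : ℝ := ∑ x, ∑ y, f x * A x y * f y

theorem SpectralData.sum_coeff_sq (D : SpectralData A) (f : ι → ℝ) :
    ∑ i, (∑ x, f x * D.vec i x) ^ 2 = ∑ x, f x ^ 2 := by
  have h1 : ∀ i, (∑ x, f x * D.vec i x) ^ 2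
      = ∑ x, ∑ y, f x * f y * (D.vec i x * D.vec i y) := by
    intro i
    rw [sq, Finset.sum_mul_sum]
    exact Finset.sum_congr rfl fun x _ => Finset.sum_congr rfl fun y _ => by ring
  simp_rw [h1]
  rw [Finset.sum_comm]
  refine Finset.sum_congr rfl fun x _ => ?_
  rw [Finset.sum_comm]
  simp_rw [← Finset.mul_sum, D.complete]
  simp [sq]

theorem SpectralData.quadForm_eq (D : SpectralData A) (f : ι → ℝ) :
    quadForm A f = ∑ i, D.val i * (∑ x, f x * D.vec i x) ^ 2 := by
  have h1 : ∀ i, D.val i * (∑ x, f x * D.vec i x) ^ 2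
      = ∑ x, ∑ y, f x * f y * (D.val i * (D.vec i x * D.vec i y)) := by
    intro i
    rw [sq, Finset.sum_mul_sum, Finset.mul_sum]
    refine Finset.sum_congr rfl fun x _ => ?_
    rw [Finset.mul_sum]
    exact Finset.sum_congr rfl fun y _ => by ring
  simp_rw [h1]
  rw [Finset.sum_comm, quadForm]
  refine Finset.sum_congr rfl fun x _ => ?_
  rw [Finset.sum_comm]
  refine Finset.sum_congr rfl fun y _ => ?_
  rw [← Finset.mul_sum, ← D.matrix_eq]
  ring

theorem SpectralData.sum_matExp_eq (D : SpectralData A) (t : ℝ) (f : ι → ℝ) :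
    ∑ x, ∑ y, f x * matExp A t x y * f y
      = ∑ i, Real.exp (t * D.val i) * (∑ x, f x * D.vec i x) ^ 2 := by
  have h1 : ∀ i, Real.exp (t * D.val i) * (∑ x, f x * D.vec i x) ^ 2
      = ∑ x, ∑ y, f x * f y * (Real.exp (t * D.val i) * (D.vec i x * D.vec i y)) := by
    intro i
    rw [sq, Finset.sum_mul_sum, Finset.mul_sum]
    refine Finset.sum_congr rfl fun x _ => ?_
    rw [Finset.mul_sum]
    exact Finset.sum_congr rfl fun y _ => by ring
  simp_rw [h1]
  conv_rhs => rw [Finset.sum_comm]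
  refine Finset.sum_congr rfl fun x _ => ?_
  conv_rhs => rw [Finset.sum_comm]
  refine Finset.sum_congr rfl fun y _ => ?_
  rw [← Finset.mul_sum, ← D.exp_eq]
  ring

/-- Jensen's inequality for the spectral measure of a unit vector. -/
theorem SpectralData.exp_quadForm_le (D : SpectralData A) (t : ℝ) {f : ι → ℝ}
    (hf : ∑ x, f x ^ 2 = 1) :
    Real.exp (t * quadForm A f) ≤ ∑ x, ∑ y, f x * matExp A t x y * f y := by
  rw [D.sum_matExp_eq, D.quadForm_eq]
  have hw : ∑ i, (∑ x, f x * D.vec i x) ^ 2 = 1 := by rw [D.sum_coeff_sq, hf]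
  have := convexOn_exp.map_sum_le (t := Finset.univ)
    (w := fun i => (∑ x, f x * D.vec i x) ^ 2) (p := fun i => t * D.val i)
    (fun i _ => sq_nonneg _) hw (fun i _ => Set.mem_univ _)
  simp only [smul_eq_mul] at this
  calc Real.exp (t * ∑ i, D.val i * (∑ x, f x * D.vec i x) ^ 2)
      = Real.exp (∑ i, (∑ x, f x * D.vec i x) ^ 2 * (t * D.val i)) := by
        rw [Finset.mul_sum]
        congr 1
        exact Finset.sum_congr rfl fun i _ => by ring
    _ ≤ _ := this
    _ = _ := Finset.sum_congr rfl fun i _ => by ring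

/-- Schur's bound for a nonnegative symmetric kernel. -/
theorem SpectralData.sum_matExp_le (D : SpectralData A) {t : ℝ}
    (h0 : ∀ x y, 0 ≤ matExp A t x y) (f : ι → ℝ) :
    ∑ x, ∑ y, f x * matExp A t x y * f y ≤ ∑ x, f x ^ 2 * ∑ y, matExp A t x y := by
  have h1 : ∑ x, ∑ y, f x * matExp A t x y * f y
      ≤ ∑ x, ∑ y, (f x ^ 2 * matExp A t x y / 2 + f y ^ 2 * matExp A t x y / 2) := by
    refine Finset.sum_le_sum fun x _ => Finset.sum_le_sum fun y _ => ?_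
    nlinarith [mul_nonneg (h0 x y) (sq_nonneg (f x - f y))]
  refine h1.trans (le_of_eq ?_)
  simp_rw [Finset.sum_add_distrib]
  have h2 : ∑ x, ∑ y, f y ^ 2 * matExp A t x y / 2 = ∑ x, ∑ y, f x ^ 2 * matExp A t x y / 2 := by
    rw [Finset.sum_comm]
    exact Finset.sum_congr rfl fun x _ => Finset.sum_congr rfl fun y _ => by
      rw [D.matExp_symm]
  rw [h2, ← Finset.sum_add_distrib]
  refine Finset.sum_congr rfl fun x _ => ?_
  rw [← Finset.sum_add_distrib, Finset.mul_sum]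
  exact Finset.sum_congr rfl fun y _ => by ring

/-- The row sums of the semigroup are controlled by the top eigenvalue. -/
theorem SpectralData.sq_rowSum_le (D : SpectralData A) {t : ℝ} (ht : 0 ≤ t) {i₀ : ι}
    (hi₀ : ∀ i, D.val i ≤ D.val i₀) (x : ι) :
    (∑ y, matExp A t x y) ^ 2 ≤ Fintype.card ι * Real.exp (2 * t * D.val i₀) := by
  have h1 : ∑ y, matExp A t x y
      = ∑ i, D.vec i x * (Real.exp (t * D.val i) * ∑ y, D.vec i y) := by
    simp_rw [D.exp_eq]
    rw [Finset.sum_comm]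
    refine Finset.sum_congr rfl fun i _ => ?_
    rw [Finset.mul_sum, Finset.mul_sum]
    exact Finset.sum_congr rfl fun y _ => by ring
  -- Cauchy-Schwarz in the eigenbasis, with Parseval's identity for the point mass at `x` (`h2`) and
  -- for the constant 1 (`h3`).
  have h2 : ∑ i, D.vec i x ^ 2 = 1 := by
    have := D.complete x x
    simpa [sq] using this
  have h3 : ∑ i, (∑ y, D.vec i y) ^ 2 = Fintype.card ι := by
    have := D.sum_coeff_sq fun _ => 1
    simpa using this
  rw [h1]
  refine (Finset.sum_mul_sq_le_sq_mul_sq _ _ _).trans ?_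
  rw [h2, one_mul, ← h3, Finset.sum_mul]
  refine Finset.sum_le_sum fun i _ => ?_
  rw [mul_pow, mul_comm, ← Real.exp_nat_mul]
  refine mul_le_mul_of_nonneg_left (Real.exp_le_exp.2 ?_) (sq_nonneg _)
  push_cast
  nlinarith [mul_le_mul_of_nonneg_left (hi₀ i) ht]

theorem SpectralData.quadForm_le (D : SpectralData A) {i₀ : ι}
    (hi₀ : ∀ i, D.val i ≤ D.val i₀) (f : ι → ℝ) :
    quadForm A f ≤ D.val i₀ * ∑ x, f x ^ 2 := by
  rw [D.quadForm_eq, ← D.sum_coeff_sq, Finset.mul_sum]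
  exact Finset.sum_le_sum fun i _ => mul_le_mul_of_nonneg_right (hi₀ i) (sq_nonneg _)

theorem SpectralData.quadForm_vec (D : SpectralData A) (i : ι) :
    quadForm A (D.vec i) = D.val i := by
  rw [D.quadForm_eq]
  simp_rw [D.orthonormal]
  simp

theorem SpectralData.sum_vec_sq (D : SpectralData A) (i : ι) : ∑ x, D.vec i x ^ 2 = 1 := by
  simpa [sq] using D.orthonormal i i

/-- A nonnegative normalized maximizer of the quadratic form, whose value bounds the semigroup. -/
theorem exists_top_vector [Nonempty ι] (hA : A.IsSymm) (hoff : ∀ x y, x ≠ y → 0 ≤ A x y) :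
    ∃ f : ι → ℝ, (∀ x, 0 ≤ f x) ∧ ∑ x, f x ^ 2 = 1 ∧
      (∀ g : ι → ℝ, quadForm A g ≤ quadForm A f * ∑ x, g x ^ 2) ∧
      ∀ t, 0 ≤ t → ∀ x, (∑ y, matExp A t x y) ^ 2
        ≤ Fintype.card ι * Real.exp (2 * t * quadForm A f) := by
  set D := spectralData hA
  obtain ⟨i₀, hi₀⟩ := Finite.exists_max D.val
  have hsq : ∑ x, |D.vec i₀ x| ^ 2 = 1 := by simpa using D.sum_vec_sq i₀
  -- The Perron-Frobenius argument: since off-diagonal entries are nonnegative, taking absolute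
  -- values cannot lower the form, so a top eigenvector may be chosen nonnegative.
  have h1 : quadForm A (fun x => |D.vec i₀ x|) = D.val i₀ := by
    refine le_antisymm ?_ ?_
    · have := D.quadForm_le hi₀ (fun x => |D.vec i₀ x|)
      rwa [hsq, mul_one] at this
    · rw [← D.quadForm_vec i₀]
      refine Finset.sum_le_sum fun x _ => Finset.sum_le_sum fun y _ => ?_
      by_cases hxy : x = y
      · subst hxy
        have : |D.vec i₀ x| * A x x * |D.vec i₀ x| = D.vec i₀ x * A x x * D.vec i₀ x := by
          have h := abs_mul_abs_self (D.vec i₀ x)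
          linear_combination A x x * h
        rw [this]
      · have h := le_abs_self (D.vec i₀ x * D.vec i₀ y)
        rw [abs_mul] at h
        nlinarith [mul_le_mul_of_nonneg_left h (hoff x y hxy)]
  refine ⟨fun x => |D.vec i₀ x|, fun x => abs_nonneg _, hsq, ?_, ?_⟩
  · intro g
    rw [h1]
    exact D.quadForm_le hi₀ g
  · intro t ht x
    rw [h1]
    exact D.sq_rowSum_le ht hi₀ x

/-- Finite positive combinations of exponentials are logarithmically convex. -/
theorem convexOn_log_sum_exp {ι : Type*} (s : Finset ι) {c v : ι → ℝ} (hc : ∀ i ∈ s, 0 ≤ c i)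
    (hpos : ∀ t, 0 < ∑ i ∈ s, c i * Real.exp (t * v i)) :
    ConvexOn ℝ Set.univ fun t => Real.log (∑ i ∈ s, c i * Real.exp (t * v i)) := by
  refine ⟨convex_univ, fun p _ q _ a b ha hb hab => ?_⟩
  set P := ∑ i ∈ s, c i * Real.exp (p * v i)
  set R := ∑ i ∈ s, c i * Real.exp (q * v i)
  have hP : 0 < P := hpos p
  have hR : 0 < R := hpos q
  have hkey : ∑ i ∈ s, c i * Real.exp ((a * p + b * q) * v i)
      ≤ Real.exp (a * Real.log P + b * Real.log R) := by
    -- Convexity of exp term by term, after normalizing both sums to 1, as in the proof of Hölder's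
    -- inequality.
    have hterm : ∀ i ∈ s, c i * Real.exp ((a * p + b * q) * v i)
        ≤ Real.exp (a * Real.log P + b * Real.log R) *
          (a * (c i * Real.exp (p * v i) / P) + b * (c i * Real.exp (q * v i) / R)) := by
      intro i hi
      have hconv := convexOn_exp.2 (Set.mem_univ (p * v i - Real.log P))
        (Set.mem_univ (q * v i - Real.log R)) ha hb hab
      simp only [smul_eq_mul, Real.exp_sub, Real.exp_log hP, Real.exp_log hR] at hconv
      have heq : Real.exp ((a * p + b * q) * v i) = Real.exp (a * Real.log P + b * Real.log R) *
          Real.exp (a * (p * v i - Real.log P) + b * (q * v i - Real.log R)) := by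
        rw [← Real.exp_add]
        ring_nf
      rw [heq]
      calc c i * (Real.exp (a * Real.log P + b * Real.log R) *
            Real.exp (a * (p * v i - Real.log P) + b * (q * v i - Real.log R)))
          ≤ c i * (Real.exp (a * Real.log P + b * Real.log R) *
            (a * (Real.exp (p * v i) / P) + b * (Real.exp (q * v i) / R))) := by
            gcongr
            exact hc i hi
        _ = _ := by ring
    refine (Finset.sum_le_sum hterm).trans (le_of_eq ?_)
    rw [← Finset.mul_sum, Finset.sum_add_distrib, ← Finset.mul_sum, ← Finset.mul_sum,
      ← Finset.sum_div, ← Finset.sum_div, div_self hP.ne', div_self hR.ne', mul_one, mul_one, hab,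
      mul_one]
  simp only [smul_eq_mul]
  rw [← Real.log_exp (a * Real.log P + b * Real.log R)]
  exact Real.log_le_log (hpos _) hkey

end SymmetricExp

end PAM

namespace PAM

open scoped ENNReal

/-! ### The Dirichlet problem in a finite set -/

section Dirichlet

variable {d : ℕ}

/-- The matrix of `κ Δ + V` on `Q` with Dirichlet boundary condition. -/
noncomputable def dirMatrix (κ : ℝ) (V : Lattice d → ℝ) (Q : Finset (Lattice d)) :
    Matrix Q Q ℝ := fun x y =>
  (if x = y then V x - 2 * d * κ else 0) +
    κ * ∑ e : Fin d × Bool, if (x : Lattice d) + unitVec e = y then 1 else 0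

/-- The solution with initial condition `1` on `Q` and Dirichlet boundary condition. -/
noncomputable def dirSol (κ : ℝ) (V : Lattice d → ℝ) (Q : Finset (Lattice d)) (t : ℝ)
    (x : Lattice d) : ℝ :=
  if h : x ∈ Q then ∑ y : Q, matExp (dirMatrix κ V Q) t ⟨x, h⟩ y else 0

/-- The total mass of the Dirichlet solution. -/
noncomputable def dirMass (κ : ℝ) (V : Lattice d → ℝ) (Q : Finset (Lattice d)) (t : ℝ) : ℝ :=
  ∑ x ∈ Q, dirSol κ V Q t x

/-- The quadratic form of `κ Δ + V` on functions supported in `Q`. -/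
noncomputable def dirForm (κ : ℝ) (V : Lattice d → ℝ) (Q : Finset (Lattice d))
    (f : Lattice d → ℝ) : ℝ :=
  ∑ x ∈ Q, ((V x - 2 * d * κ) * f x ^ 2 +
    κ * ∑ e : Fin d × Bool, f x * if x + unitVec e ∈ Q then f (x + unitVec e) else 0)

variable (κ : ℝ) (V : Lattice d → ℝ) (Q : Finset (Lattice d))

theorem unitVec_not (e : Fin d × Bool) : unitVec (e.1, !e.2) = -unitVec e := by
  unfold unitVec
  rw [← Pi.single_neg]
  cases e.2 <;> simp

theorem dirMatrix_isSymm : (dirMatrix κ V Q).IsSymm := by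
  ext x y
  simp only [Matrix.transpose_apply, dirMatrix]
  congr 1
  · by_cases h : x = y
    · simp [h]
    · simp [h, Ne.symm h]
  · congr 1
    let σ : Fin d × Bool ≃ Fin d × Bool :=
      ⟨fun e => (e.1, !e.2), fun e => (e.1, !e.2), fun e => by simp, fun e => by simp⟩
    rw [← Equiv.sum_comp σ]
    refine Finset.sum_congr rfl fun e _ => ?_
    have : (y : Lattice d) + unitVec (σ e) = x ↔ (x : Lattice d) + unitVec e = y := by
      change (y : Lattice d) + unitVec (e.1, !e.2) = x ↔ _
      rw [unitVec_not]
      constructor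
      · intro h; rw [← h]; abel
      · intro h; rw [← h]; abel
    simp [this]

theorem dirMatrix_offDiag (hκ : 0 ≤ κ) (x y : Q) (h : x ≠ y) : 0 ≤ dirMatrix κ V Q x y := by
  simp only [dirMatrix, h, if_false, zero_add]
  refine mul_nonneg hκ (Finset.sum_nonneg fun e _ => ?_)
  split_ifs <;> norm_num

theorem sum_dirMatrix_mul (F : Lattice d → ℝ) (x : Q) :
    ∑ y : Q, dirMatrix κ V Q x y * F y = (V x - 2 * d * κ) * F x +
      κ * ∑ e : Fin d × Bool, if (x : Lattice d) + unitVec e ∈ Q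
        then F ((x : Lattice d) + unitVec e) else 0 := by
  simp only [dirMatrix, add_mul, Finset.sum_add_distrib]
  congr 1
  · simp
  · simp_rw [mul_assoc]
    rw [← Finset.mul_sum]
    congr 1
    simp_rw [Finset.sum_mul]
    rw [Finset.sum_comm]
    refine Finset.sum_congr rfl fun e _ => ?_
    split_ifs with h
    · rw [Finset.sum_eq_single ⟨_, h⟩]
      · simp
      · intro y _ hy
        have : (x : Lattice d) + unitVec e ≠ y := fun h' => hy (Subtype.ext h'.symm)
        simp [this]
      · simp
    · refine Finset.sum_eq_zero fun y _ => ?_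
      have : (x : Lattice d) + unitVec e ≠ y := fun h' => h (h' ▸ y.2)
      simp [this]

theorem quadForm_dirMatrix (f : Lattice d → ℝ) :
    quadForm (dirMatrix κ V Q) (fun x : Q => f x) = dirForm κ V Q f := by
  rw [quadForm, dirForm, ← Finset.sum_coe_sort Q]
  refine Finset.sum_congr rfl fun x _ => ?_
  have := sum_dirMatrix_mul κ V Q f x
  simp_rw [mul_assoc, ← Finset.mul_sum, this]
  ring

variable {κ V Q}

theorem matExp_dirMatrix_nonneg (hκ : 0 ≤ κ) {t : ℝ} (ht : 0 ≤ t) (x y : Q) :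
    0 ≤ matExp (dirMatrix κ V Q) t x y :=
  matExp_nonneg (dirMatrix_offDiag κ V Q hκ) ht x y

theorem dirSol_of_mem {x : Lattice d} (hx : x ∈ Q) (t : ℝ) :
    dirSol κ V Q t x = ∑ y : Q, matExp (dirMatrix κ V Q) t ⟨x, hx⟩ y := by
  simp [dirSol, hx]

theorem dirSol_of_notMem {x : Lattice d} (hx : x ∉ Q) (t : ℝ) : dirSol κ V Q t x = 0 := by
  simp [dirSol, hx]

theorem dirSol_nonneg (hκ : 0 ≤ κ) {t : ℝ} (ht : 0 ≤ t) (x : Lattice d) :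
    0 ≤ dirSol κ V Q t x := by
  by_cases hx : x ∈ Q
  · rw [dirSol_of_mem hx]
    exact Finset.sum_nonneg fun y _ => matExp_dirMatrix_nonneg hκ ht _ y
  · rw [dirSol_of_notMem hx]

theorem dirSol_zero {x : Lattice d} (hx : x ∈ Q) : dirSol κ V Q 0 x = 1 := by
  rw [dirSol_of_mem hx]
  simp_rw [(spectralData (dirMatrix_isSymm κ V Q)).matExp_zero]
  simp

theorem hasDerivAt_dirSol {x : Lattice d} (hx : x ∈ Q) (t : ℝ) :
    HasDerivAt (fun t => dirSol κ V Q t x) ((V x - 2 * d * κ) * dirSol κ V Q t x +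
      κ * ∑ e : Fin d × Bool, dirSol κ V Q t (x + unitVec e)) t := by
  have h1 : (fun t => dirSol κ V Q t x)
      = fun t => ∑ y : Q, matExp (dirMatrix κ V Q) t ⟨x, hx⟩ y :=
    funext fun t => dirSol_of_mem hx t
  have h2 := HasDerivAt.fun_sum (u := Finset.univ) fun (y : Q) _ =>
    (spectralData (dirMatrix_isSymm κ V Q)).hasDerivAt t ⟨x, hx⟩ y
  rw [h1]
  refine h2.congr_deriv ?_
  rw [Finset.sum_comm]
  simp_rw [← Finset.mul_sum]
  have h3 := sum_dirMatrix_mul κ V Q (dirSol κ V Q t) ⟨x, hx⟩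
  have h4 : ∀ z : Q, dirSol κ V Q t z = ∑ y : Q, matExp (dirMatrix κ V Q) t z y := fun z =>
    dirSol_of_mem z.2 t
  simp_rw [h4] at h3
  rw [h3]
  congr 2
  refine Finset.sum_congr rfl fun e _ => ?_
  split_ifs with h
  · rfl
  · rw [dirSol_of_notMem h]

theorem continuous_dirSol (x : Lattice d) : Continuous fun t => dirSol κ V Q t x := by
  by_cases hx : x ∈ Q
  · exact continuous_iff_continuousAt.2 fun t => (hasDerivAt_dirSol hx t).continuousAt
  · simp_rw [dirSol_of_notMem hx]
    exact continuous_const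

/-- Duhamel's formula for the Dirichlet solution. -/
theorem dirSol_eq {x : Lattice d} (hx : x ∈ Q) (t : ℝ) :
    dirSol κ V Q t x = Real.exp ((V x - 2 * d * κ) * t) +
      ∫ s in (0 : ℝ)..t, κ * Real.exp ((V x - 2 * d * κ) * s) *
        ∑ e : Fin d × Bool, dirSol κ V Q (t - s) (x + unitVec e) := by
  set a := V x - 2 * d * κ with ha
  have hder : ∀ s ∈ Set.uIcc 0 t, HasDerivAt (fun s => Real.exp (-(a * s)) * dirSol κ V Q s x)
      (κ * Real.exp (-(a * s)) * ∑ e : Fin d × Bool, dirSol κ V Q s (x + unitVec e)) s := by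
    intro s _
    have h1 : HasDerivAt (fun s => Real.exp (-(a * s))) (Real.exp (-(a * s)) * (-a)) s := by
      simpa using ((hasDerivAt_id s).const_mul a).neg.exp
    refine (h1.mul (hasDerivAt_dirSol hx s)).congr_deriv ?_
    ring
  have hcont : Continuous fun s =>
      κ * Real.exp (-(a * s)) * ∑ e : Fin d × Bool, dirSol κ V Q s (x + unitVec e) :=
    Continuous.mul (by fun_prop) (continuous_finsetSum _ fun e _ => continuous_dirSol _)
  have hI := intervalIntegral.integral_eq_sub_of_hasDerivAt hder (hcont.intervalIntegrable _ _)
  simp only [mul_zero, neg_zero, Real.exp_zero, one_mul, dirSol_zero hx] at hI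
  have hsub := intervalIntegral.integral_comp_sub_left (a := 0) (b := t)
    (fun s => κ * Real.exp (a * (t - s)) *
      ∑ e : Fin d × Bool, dirSol κ V Q s (x + unitVec e)) t
  simp only [sub_sub_cancel, sub_self, sub_zero] at hsub
  rw [hsub]
  have hfac : ∫ s in (0 : ℝ)..t, κ * Real.exp (a * (t - s)) *
        ∑ e : Fin d × Bool, dirSol κ V Q s (x + unitVec e)
      = Real.exp (a * t) * ∫ s in (0 : ℝ)..t, κ * Real.exp (-(a * s)) *
        ∑ e : Fin d × Bool, dirSol κ V Q s (x + unitVec e) := by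
    rw [← intervalIntegral.integral_const_mul]
    refine intervalIntegral.integral_congr fun s _ => ?_
    have : Real.exp (a * (t - s)) = Real.exp (a * t) * Real.exp (-(a * s)) := by
      rw [← Real.exp_add]
      ring_nf
    simp only [this]
    ring
  rw [hfac, hI, mul_sub, ← mul_assoc, ← Real.exp_add]
  simp

theorem exp_le_dirSol (hκ : 0 ≤ κ) {x : Lattice d} (hx : x ∈ Q) {t : ℝ} (ht : 0 ≤ t) :
    Real.exp ((V x - 2 * d * κ) * t) ≤ dirSol κ V Q t x := by
  rw [dirSol_eq hx]
  refine le_add_of_nonneg_right (intervalIntegral.integral_nonneg ht fun s hs => ?_)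
  exact mul_nonneg (by positivity) (Finset.sum_nonneg fun e _ =>
    dirSol_nonneg hκ (by linarith [hs.2]) _)

/-- Expectations over paths confined to `Q` are dominated by the Dirichlet solution. -/
theorem fk_le_dirSol [NeZero d] (hκ : 0 < κ) (n : ℕ) {x : Lattice d}
    (hx : ∀ y : Lattice d, (∀ i, |y i - x i| ≤ n) → y ∈ Q) {t : ℝ} (ht : 0 ≤ t) :
    fk n κ V t x ≤ ENNReal.ofReal (dirSol κ V Q t x) := by
  -- Both sides obey the same recursion, by the first jump and by Duhamel's formula. The ball of
  -- radius `n + 1` around `x` contains those of radius `n` around its neighbours.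
  induction n generalizing x t with
  | zero => simp [fk_zero_left]
  | succ n ih =>
    have hxQ : x ∈ Q := hx x fun i => by simp; positivity
    have hrec := fk_add_one n hκ V ht x
    push_cast
    rw [hrec, dirSol_eq hxQ, ENNReal.ofReal_add (Real.exp_pos _).le]
    · gcongr
      have hcont : Continuous fun s => κ * Real.exp ((V x - 2 * d * κ) * s) *
          ∑ e : Fin d × Bool, dirSol κ V Q (t - s) (x + unitVec e) :=
        Continuous.mul (by fun_prop) (continuous_finsetSum _ fun e _ =>
          (continuous_dirSol _).comp (by fun_prop))
      rw [intervalIntegral.integral_of_le ht, ofReal_integral_eq_lintegral_ofReal]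
      · refine setLIntegral_mono' measurableSet_Ioc fun s hs => ?_
        have hts : 0 ≤ t - s := by linarith [hs.2]
        rw [ENNReal.ofReal_mul (q := ∑ e, _) (by positivity), ENNReal.ofReal_sum_of_nonneg
          fun e _ => dirSol_nonneg hκ.le hts _]
        gcongr with e _
        refine ih (fun y hy => hx y fun i => ?_) hts
        have h1 := hy i
        have h2 := abs_unitVec_le e i
        rw [Pi.add_apply, ← sub_sub] at h1
        push_cast
        have h3 : |y i - x i| ≤ |y i - x i - unitVec e i| + |unitVec e i| := by
          have := abs_add_le (y i - x i - unitVec e i) (unitVec e i)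
          simpa using this
        linarith
      · exact (hcont.integrableOn_Icc).mono_set Set.Ioc_subset_Icc_self
      · refine (ae_restrict_iff' measurableSet_Ioc).2 (Eventually.of_forall fun s hs => ?_)
        exact mul_nonneg (by positivity) (Finset.sum_nonneg fun e _ =>
          dirSol_nonneg hκ.le (by linarith [hs.2]) _)
    · refine intervalIntegral.integral_nonneg ht fun s hs => ?_
      exact mul_nonneg (by positivity) (Finset.sum_nonneg fun e _ =>
        dirSol_nonneg hκ.le (by linarith [hs.2]) _)

/-- The Dirichlet solution is dominated by the solution on the whole lattice. -/
theorem dirSol_le_solution [NeZero d] (hκ : 0 < κ) (hV : FiniteFK κ V) {T : ℝ} (hT : 0 ≤ T)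
    (x : Lattice d) : dirSol κ V Q T x ≤ solution κ V T x := by
  by_cases hx : x ∈ Q
  swap
  · rw [dirSol_of_notMem hx]
    exact solution_nonneg κ V T x
  set D := spectralData (dirMatrix_isSymm κ V Q)
  -- `z` interpolates between the Dirichlet solution at `s = 0` and the full solution at `s = T`.
  -- Its derivative is the inflow from sites outside `Q`, which is nonnegative.
  set z : ℝ → ℝ := fun s => ∑ y : Q, matExp (dirMatrix κ V Q) (T - s) ⟨x, hx⟩ y *
    solution κ V s y with hz
  have hEc : ∀ y : Q, Continuous fun s => matExp (dirMatrix κ V Q) (T - s) ⟨x, hx⟩ y := by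
    intro y
    have : Continuous fun s => matExp (dirMatrix κ V Q) s ⟨x, hx⟩ y :=
      continuous_iff_continuousAt.2 fun s => (D.hasDerivAt s _ _).continuousAt
    exact this.comp (by fun_prop)
  have hzc : ContinuousOn z (Set.Icc 0 T) := by
    refine continuousOn_finsetSum _ fun y _ => (hEc y).continuousOn.mul ?_
    exact (hV.continuousOn hκ y).mono Set.Icc_subset_Ici_self
  have hzd : ∀ s ∈ Set.Ioo 0 T, HasDerivAt z (∑ y : Q,
      matExp (dirMatrix κ V Q) (T - s) ⟨x, hx⟩ y * (κ * ∑ e : Fin d × Bool,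
        if (y : Lattice d) + unitVec e ∈ Q then 0 else solution κ V s (y + unitVec e))) s := by
    intro s hs
    have h1 : ∀ y : Q, HasDerivAt (fun s => matExp (dirMatrix κ V Q) (T - s) ⟨x, hx⟩ y)
        (-∑ w : Q, matExp (dirMatrix κ V Q) (T - s) ⟨x, hx⟩ w * dirMatrix κ V Q w y) s := by
      intro y
      have h2 := (D.hasDerivAt (T - s) y ⟨x, hx⟩).comp_const_sub T s
      have h3 : (fun s => matExp (dirMatrix κ V Q) (T - s) ⟨x, hx⟩ y)
          = fun s => matExp (dirMatrix κ V Q) (T - s) y ⟨x, hx⟩ :=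
        funext fun s => D.matExp_symm _ _ _
      rw [h3]
      refine h2.congr_deriv ?_
      congr 1
      refine Finset.sum_congr rfl fun w _ => ?_
      rw [D.matExp_symm, mul_comm, (dirMatrix_isSymm κ V Q).apply]
    have h4 := HasDerivAt.fun_sum (u := Finset.univ) fun (y : Q) _ =>
      (h1 y).mul (hV.hasDerivAt hκ hs.1 (y : Lattice d))
    refine h4.congr_deriv ?_
    simp only [Finset.sum_add_distrib, neg_mul, Finset.sum_neg_distrib, Finset.sum_mul]
    rw [Finset.sum_comm]
    have h5 : ∀ w : Q, ∑ y : Q, matExp (dirMatrix κ V Q) (T - s) ⟨x, hx⟩ w * dirMatrix κ V Q w y *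
        solution κ V s y = matExp (dirMatrix κ V Q) (T - s) ⟨x, hx⟩ w *
          ((V w - 2 * d * κ) * solution κ V s w +
            κ * ∑ e : Fin d × Bool, if (w : Lattice d) + unitVec e ∈ Q
              then solution κ V s ((w : Lattice d) + unitVec e) else 0) := by
      intro w
      rw [← sum_dirMatrix_mul, Finset.mul_sum]
      exact Finset.sum_congr rfl fun y _ => by ring
    simp_rw [h5]
    rw [← Finset.sum_neg_distrib, ← Finset.sum_add_distrib]
    refine Finset.sum_congr rfl fun w _ => ?_
    have hlap : laplacian (solution κ V s) w
        = (∑ e : Fin d × Bool, if (w : Lattice d) + unitVec e ∈ Q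
              then solution κ V s ((w : Lattice d) + unitVec e) else 0) +
          (∑ e : Fin d × Bool, if (w : Lattice d) + unitVec e ∈ Q
              then 0 else solution κ V s ((w : Lattice d) + unitVec e))
          - 2 * d * solution κ V s w := by
      rw [← Finset.sum_add_distrib]
      simp only [laplacian, Finset.sum_sub_distrib, Finset.sum_const, nsmul_eq_mul,
        Finset.card_univ, Fintype.card_prod, Fintype.card_fin, Fintype.card_bool]
      push_cast
      congr 1
      · exact Finset.sum_congr rfl fun e _ => by split_ifs <;> simp
      · ring
    rw [hlap]
    ring
  have hmono : MonotoneOn z (Set.Icc 0 T) := by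
    refine monotoneOn_of_deriv_nonneg (convex_Icc 0 T) hzc ?_ ?_
    · rw [interior_Icc]
      exact fun s hs => (hzd s hs).differentiableAt.differentiableWithinAt
    · rw [interior_Icc]
      intro s hs
      rw [(hzd s hs).deriv]
      refine Finset.sum_nonneg fun y _ => mul_nonneg
        (matExp_dirMatrix_nonneg hκ.le (by linarith [hs.2]) _ _) (mul_nonneg hκ.le ?_)
      refine Finset.sum_nonneg fun e _ => ?_
      split_ifs
      · exact le_rfl
      · exact solution_nonneg κ V s _
  have h0 : z 0 = dirSol κ V Q T x := by
    simp [hz, dirSol_of_mem hx, solution_zero_left]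
  have hTT : z T = solution κ V T x := by
    simp only [hz, sub_self, D.matExp_zero]
    simp
  rw [← h0, ← hTT]
  exact hmono (Set.left_mem_Icc.2 hT) (Set.right_mem_Icc.2 hT) hT

theorem continuous_dirSol_potential (t : ℝ) (x : Lattice d) :
    Continuous fun V : Lattice d → ℝ => dirSol κ V Q t x := by
  by_cases hx : x ∈ Q
  · simp_rw [dirSol_of_mem hx]
    refine continuous_finsetSum _ fun y _ => ?_
    let _ := Matrix.linftyOpNormedRing (α := ℝ) (n := Q)
    let _ := Matrix.linftyOpNormedAlgebra (R := ℝ) (α := ℝ) (n := Q)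
    let _ := NormedAlgebra.restrictScalars ℚ ℝ (Matrix Q Q ℝ)
    have h1 : Continuous fun V : Lattice d → ℝ => t • dirMatrix κ V Q := by
      have h : Continuous fun V : Lattice d → ℝ => dirMatrix κ V Q := by
        refine continuous_matrix fun i j => ?_
        unfold dirMatrix
        refine Continuous.add ?_ continuous_const
        split_ifs <;> fun_prop
      exact h.const_smul t
    have h2 : Continuous fun V : Lattice d → ℝ => matExp (dirMatrix κ V Q) t :=
      NormedSpace.exp_continuous.comp h1
    exact h2.matrix_elem _ _
  · simp_rw [dirSol_of_notMem hx]
    exact continuous_const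

theorem measurable_dirMass (t : ℝ) : Measurable fun V : Lattice d → ℝ => dirMass κ V Q t :=
  (continuous_finsetSum _ fun x _ => continuous_dirSol_potential t x).measurable

theorem dirMass_eq (t : ℝ) :
    dirMass κ V Q t = ∑ x : Q, ∑ y : Q, matExp (dirMatrix κ V Q) t x y := by
  rw [dirMass, ← Finset.sum_coe_sort Q]
  exact Finset.sum_congr rfl fun x _ => dirSol_of_mem x.2 t

/-- The mass is the quadratic form of the semigroup at the constant 1, hence a mixture of
exponentials weighted by squared coefficients. Nonnegative weights make the total mass log-convex in
time; the value of the solution at a single site has no such representation. -/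
theorem exists_dirMass_eq_sum_exp (κ : ℝ) (V : Lattice d → ℝ) (Q : Finset (Lattice d)) :
    ∃ c v : Q → ℝ, (∀ i, 0 ≤ c i) ∧ ∑ i, c i = Q.card ∧
      ∀ t, dirMass κ V Q t = ∑ i, c i * Real.exp (t * v i) := by
  set D := spectralData (dirMatrix_isSymm κ V Q)
  refine ⟨fun i => (∑ x, 1 * D.vec i x) ^ 2, D.val, fun i => sq_nonneg _, ?_, fun t => ?_⟩
  · rw [D.sum_coeff_sq fun _ => 1]
    simp
  · have := D.sum_matExp_eq t fun _ => 1
    simp only [one_mul, mul_one] at this ⊢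
    rw [dirMass_eq, this]
    exact Finset.sum_congr rfl fun i _ => mul_comm _ _

theorem dirMass_pos (κ : ℝ) (V : Lattice d → ℝ) (hQ : Q.Nonempty) (t : ℝ) :
    0 < dirMass κ V Q t := by
  obtain ⟨c, v, hc, hsum, h⟩ := exists_dirMass_eq_sum_exp κ V Q
  rw [h]
  have hcard : (0 : ℝ) < ∑ i, c i := by
    rw [hsum]
    exact_mod_cast hQ.card_pos
  obtain ⟨i, hi, hci⟩ := Finset.exists_lt_of_sum_lt (s := Finset.univ) (f := fun _ : Q => (0 : ℝ))
    (g := c) (by simpa using hcard)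
  exact Finset.sum_pos' (fun i _ => mul_nonneg (hc i) (Real.exp_pos _).le)
    ⟨i, hi, mul_pos hci (Real.exp_pos _)⟩

theorem convexOn_log_dirMass (κ : ℝ) (V : Lattice d → ℝ) (hQ : Q.Nonempty) :
    ConvexOn ℝ Set.univ fun t => Real.log (dirMass κ V Q t) := by
  obtain ⟨c, v, hc, -, h⟩ := exists_dirMass_eq_sum_exp κ V Q
  simp_rw [h]
  refine convexOn_log_sum_exp _ (fun i _ => hc i) fun t => ?_
  rw [← h]
  exact dirMass_pos κ V hQ t

/-- Exponential moments of the quadratic form are dominated by the solution. -/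
theorem exp_dirForm_le (hκ : 0 ≤ κ) {t : ℝ} (ht : 0 ≤ t) {f : Lattice d → ℝ}
    (hf : ∑ x ∈ Q, f x ^ 2 = 1) :
    Real.exp (t * dirForm κ V Q f) ≤ ∑ x ∈ Q, f x ^ 2 * dirSol κ V Q t x := by
  set D := spectralData (dirMatrix_isSymm κ V Q)
  have hf' : ∑ x : Q, f x ^ 2 = 1 := by
    rw [← hf, ← Finset.sum_coe_sort Q]
  have h1 := D.exp_quadForm_le t (f := fun x : Q => f x) hf'
  rw [quadForm_dirMatrix] at h1
  refine h1.trans ((D.sum_matExp_le (matExp_dirMatrix_nonneg hκ ht) _).trans (le_of_eq ?_))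
  rw [← Finset.sum_coe_sort Q]
  exact Finset.sum_congr rfl fun x _ => by rw [dirSol_of_mem x.2]

/-- A normalized maximizer of the quadratic form on `Q`. -/
theorem exists_top_dirForm (hκ : 0 ≤ κ) (V : Lattice d → ℝ) (hQ : Q.Nonempty) :
    ∃ f : Lattice d → ℝ, (∀ x, 0 ≤ f x) ∧ (∀ x, x ∉ Q → f x = 0) ∧ ∑ x ∈ Q, f x ^ 2 = 1 ∧
      (∀ x ∈ Q, V x - 2 * d * κ ≤ dirForm κ V Q f) ∧
      ∀ t, 0 ≤ t → ∀ x, dirSol κ V Q t x ^ 2 ≤ Q.card * Real.exp (2 * t * dirForm κ V Q f) := by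
  have : Nonempty Q := hQ.to_subtype
  obtain ⟨f, hf0, hf1, hmax, hexp⟩ := exists_top_vector (dirMatrix_isSymm κ V Q)
    (dirMatrix_offDiag κ V Q hκ)
  set F : Lattice d → ℝ := fun x => if h : x ∈ Q then f ⟨x, h⟩ else 0 with hF
  have hFf : (fun x : Q => F x) = f := by
    funext x
    simp [hF]
  have hq : dirForm κ V Q F = quadForm (dirMatrix κ V Q) f := by
    rw [← quadForm_dirMatrix, hFf]
  refine ⟨F, fun x => ?_, fun x hx => by simp [hF, hx], ?_, fun x hx => ?_, fun t ht x => ?_⟩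
  · simp only [hF]
    split_ifs
    · exact hf0 _
    · exact le_rfl
  · rw [← hf1, ← Finset.sum_coe_sort Q]
    exact Finset.sum_congr rfl fun x _ => by rw [← hFf]
  · rw [hq]
    -- Testing the maximality with a point mass at `x` bounds the diagonal entry; the neighbour
    -- terms are nonnegative.
    have h1 := hmax (Pi.single ⟨x, hx⟩ 1)
    have h2 : quadForm (dirMatrix κ V Q) (Pi.single ⟨x, hx⟩ 1)
        = dirMatrix κ V Q ⟨x, hx⟩ ⟨x, hx⟩ := by
      rw [quadForm, Finset.sum_eq_single ⟨x, hx⟩, Finset.sum_eq_single ⟨x, hx⟩]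
      · simp
      · intro y _ hy
        simp [Pi.single_eq_of_ne hy]
      · simp
      · intro y _ hy
        simp [Pi.single_eq_of_ne hy]
      · simp
    have h3 : ∑ y : Q, (Pi.single (⟨x, hx⟩ : Q) (1 : ℝ) : Q → ℝ) y ^ 2 = 1 := by
      rw [Finset.sum_eq_single ⟨x, hx⟩]
      · simp
      · intro y _ hy
        simp [Pi.single_eq_of_ne hy]
      · simp
    rw [h2, h3, mul_one] at h1
    refine le_trans ?_ h1
    simp only [dirMatrix, if_true]
    refine le_add_of_nonneg_right (mul_nonneg hκ (Finset.sum_nonneg fun e _ => ?_))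
    split_ifs <;> norm_num
  · rw [hq]
    by_cases hx : x ∈ Q
    · rw [dirSol_of_mem hx]
      have := hexp t ht ⟨x, hx⟩
      rwa [Fintype.card_coe] at this
    · rw [dirSol_of_notMem hx]
      simp only [ne_eq, OfNat.ofNat_ne_zero, not_false_eq_true, zero_pow]
      positivity

end Dirichlet

end PAM

namespace PAM

open scoped ENNReal

/-! ### Counting in lattice cubes -/

section Cubes

variable {d : ℕ}

/-- The cube of radius `n` around `x`. -/
noncomputable def cube (x : Lattice d) (n : ℕ) : Finset (Lattice d) :=
  Fintype.piFinset fun i => Finset.Icc (x i - n) (x i + n)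

theorem mem_cube {x y : Lattice d} {n : ℕ} : y ∈ cube x n ↔ ∀ i, |y i - x i| ≤ n := by
  simp only [cube, Fintype.mem_piFinset, Finset.mem_Icc, abs_le]
  refine forall_congr' fun i => ⟨fun h => ⟨by linarith [h.1], by linarith [h.2]⟩,
    fun h => ⟨by linarith [h.1], by linarith [h.2]⟩⟩

theorem mem_cube_comm {x y : Lattice d} {n : ℕ} : y ∈ cube x n ↔ x ∈ cube y n := by
  simp only [mem_cube]
  exact forall_congr' fun i => by rw [abs_sub_comm]

theorem self_mem_cube (x : Lattice d) (n : ℕ) : x ∈ cube x n := by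
  simp [mem_cube]

theorem cube_nonempty (x : Lattice d) (n : ℕ) : (cube x n).Nonempty := ⟨x, self_mem_cube x n⟩

theorem card_cube (x : Lattice d) (n : ℕ) : (cube x n).card = (2 * n + 1) ^ d := by
  rw [cube, Fintype.card_piFinset]
  have : ∀ i, (Finset.Icc (x i - (n : ℤ)) (x i + n)).card = 2 * n + 1 := by
    intro i
    rw [Int.card_Icc]
    omega
  simp [this]

theorem cube_subset_cube {x y : Lattice d} {m n k : ℕ} (hx : x ∈ cube y m) (h : m + n ≤ k) :
    cube x n ⊆ cube y k := by
  intro z hz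
  rw [mem_cube] at *
  intro i
  have h1 := abs_sub_le (z i) (x i) (y i)
  have h2 := hz i
  have h3 := hx i
  have : ((m + n : ℕ) : ℤ) ≤ k := by exact_mod_cast h
  push_cast at this
  linarith

theorem cube_mono (x : Lattice d) {m n : ℕ} (h : m ≤ n) : cube x m ⊆ cube x n :=
  cube_subset_cube (self_mem_cube x 0) (by omega)

theorem add_mem_cube_iff {x y z : Lattice d} {n : ℕ} : y + z ∈ cube (x + z) n ↔ y ∈ cube x n := by
  simp only [mem_cube, Pi.add_apply]
  exact forall_congr' fun i => by rw [add_sub_add_right_eq_sub]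

theorem box_eq_cube {r : ℝ} (hr : 0 ≤ r) : box d r = cube 0 ⌊r⌋₊ := by
  have h1 : (⌊r⌋ : ℤ) = (⌊r⌋₊ : ℤ) := (Int.natCast_floor_eq_floor hr).symm
  simp only [box, cube, Int.ceil_neg, h1, Pi.zero_apply, zero_sub, zero_add]

/-- Few points of a cube leave it under a unit shift. -/
theorem card_cube_sdiff_le (x : Lattice d) (e : Fin d × Bool) (R : ℕ) :
    (2 * R + 1) * (cube x R \ cube (x + unitVec e) R).card ≤ (2 * R + 1) ^ d := by
  -- The one face lost under the shift: the lower face for a positive direction, the upper face for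
  -- a negative one.
  set b : ℤ := if e.2 then x e.1 - R else x e.1 + R with hb
  set S : Finset (Lattice d) := Fintype.piFinset fun i =>
    if i = e.1 then {b} else Finset.Icc (x i - R) (x i + R) with hS
  have hsub : cube x R \ cube (x + unitVec e) R ⊆ S := by
    intro y hy
    rw [Finset.mem_sdiff, mem_cube, mem_cube] at hy
    obtain ⟨h1, h2⟩ := hy
    rw [not_forall] at h2
    obtain ⟨i, hi⟩ := h2
    have hi1 := h1 i
    have hie : i = e.1 := by
      by_contra hne
      apply hi
      simpa [unitVec, Pi.single_eq_of_ne hne] using hi1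
    rw [hS, Fintype.mem_piFinset]
    intro j
    by_cases hj : j = e.1
    · subst hie
      simp only [hj, if_true, Finset.mem_singleton, hb]
      rw [Pi.add_apply, unitVec, Pi.single_eq_same, abs_le] at hi
      rw [abs_le] at hi1
      split_ifs at hi ⊢ <;> omega
    · simp only [hj, if_false, Finset.mem_Icc]
      have := abs_le.1 (h1 j)
      constructor <;> linarith [this.1, this.2]
  have hcard : (2 * R + 1) * S.card = (2 * R + 1) ^ d := by
    rw [hS, Fintype.card_piFinset, ← Finset.mul_prod_erase _ _ (Finset.mem_univ e.1)]
    have h1 : ∀ i ∈ Finset.univ.erase e.1,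
        (if i = e.1 then {b} else Finset.Icc (x i - (R : ℤ)) (x i + R)).card = 2 * R + 1 := by
      intro i hi
      rw [if_neg (Finset.ne_of_mem_erase hi), Int.card_Icc]
      omega
    rw [Finset.prod_congr rfl h1, Finset.prod_const, Finset.card_erase_of_mem (Finset.mem_univ _)]
    simp only [if_true, Finset.card_singleton, one_mul, Finset.card_univ, Fintype.card_fin]
    rw [← pow_succ']
    congr 1
    have := e.1.pos
    omega
  rw [← hcard]
  exact Nat.mul_le_mul_left _ (Finset.card_le_card hsub)

end Cubes

/-! ### Localizing and discretizing the Rayleigh quotient -/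

section Localization

variable {d : ℕ} {κ : ℝ} {V : Lattice d → ℝ} {Q : Finset (Lattice d)}

theorem dirForm_eq_of_support {f : Lattice d → ℝ} (hf : ∀ x, x ∉ Q → f x = 0) :
    dirForm κ V Q f = ∑ x ∈ Q, (V x - 2 * d * κ) * f x ^ 2 +
      κ * ∑ x ∈ Q, ∑ e : Fin d × Bool, f x * f (x + unitVec e) := by
  rw [dirForm, Finset.sum_add_distrib, Finset.mul_sum]
  congr 1
  refine Finset.sum_congr rfl fun x _ => ?_
  congr 1
  refine Finset.sum_congr rfl fun e _ => ?_
  split_ifs with h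
  · rfl
  · rw [hf _ h]

theorem dirForm_eq_of_support_inter {Q' : Finset (Lattice d)} {f : Lattice d → ℝ}
    (hf : ∀ x, x ∉ Q → f x = 0) (hf' : ∀ x, x ∉ Q' → f x = 0) :
    dirForm κ V Q f = dirForm κ V Q' f := by
  classical
  have key : ∀ F : Lattice d → ℝ, (∀ x, f x = 0 → F x = 0) → ∑ x ∈ Q, F x = ∑ x ∈ Q', F x := by
    intro F hF
    rw [← Finset.sum_subset (Finset.inter_subset_left (s₁ := Q) (s₂ := Q')),
      ← Finset.sum_subset (Finset.inter_subset_right (s₁ := Q) (s₂ := Q'))]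
    · intro x hx hx'
      refine hF x (hf x fun h => hx' (Finset.mem_inter.2 ⟨h, hx⟩))
    · intro x hx hx'
      refine hF x (hf' x fun h => hx' (Finset.mem_inter.2 ⟨hx, h⟩))
  rw [dirForm_eq_of_support hf, dirForm_eq_of_support hf', key _ fun x hx => by simp [hx],
    key _ fun x hx => by simp [hx]]

theorem dirForm_smul (c : ℝ) (f : Lattice d → ℝ) :
    dirForm κ V Q (fun x => c * f x) = c ^ 2 * dirForm κ V Q f := by
  rw [dirForm, dirForm, Finset.mul_sum]
  refine Finset.sum_congr rfl fun x _ => ?_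
  rw [mul_add, Finset.mul_sum, Finset.mul_sum, Finset.mul_sum]
  congr 1
  · ring
  · refine Finset.sum_congr rfl fun e _ => ?_
    split_ifs <;> ring

theorem sum_mul_shift_le {f : Lattice d → ℝ} (hf : ∀ x, x ∉ Q → f x = 0) (e : Fin d × Bool) :
    ∑ x ∈ Q, f x * f (x + unitVec e) ≤ ∑ x ∈ Q, f x ^ 2 := by
  classical
  have h1 : ∑ x ∈ Q, f (x + unitVec e) ^ 2 ≤ ∑ x ∈ Q, f x ^ 2 := by
    rw [← Finset.sum_image (s := Q) (g := fun x => x + unitVec e) (f := fun x => f x ^ 2)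
      (fun x _ y _ h => add_right_cancel h)]
    rw [← Finset.sum_filter_add_sum_filter_not _ (fun x => x ∈ Q)]
    have : ∑ x ∈ (Q.image fun x => x + unitVec e) with x ∉ Q, f x ^ 2 = 0 :=
      Finset.sum_eq_zero fun x hx => by rw [hf x (Finset.mem_filter.1 hx).2]; simp
    rw [this, add_zero]
    exact Finset.sum_le_sum_of_subset_of_nonneg
      (fun x hx => (Finset.mem_filter.1 hx).2) fun x _ _ => sq_nonneg _
  have h2 : ∑ x ∈ Q, f x * f (x + unitVec e)
      ≤ ∑ x ∈ Q, (f x ^ 2 / 2 + f (x + unitVec e) ^ 2 / 2) :=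
    Finset.sum_le_sum fun x _ => by nlinarith [sq_nonneg (f x - f (x + unitVec e))]
  rw [Finset.sum_add_distrib, ← Finset.sum_div, ← Finset.sum_div] at h2
  linarith

theorem sum_sum_mul_shift_le {f : Lattice d → ℝ} (hf : ∀ x, x ∉ Q → f x = 0) :
    ∑ x ∈ Q, ∑ e : Fin d × Bool, f x * f (x + unitVec e) ≤ 2 * d * ∑ x ∈ Q, f x ^ 2 := by
  rw [Finset.sum_comm]
  refine (Finset.sum_le_sum fun e _ => sum_mul_shift_le hf e).trans (le_of_eq ?_)
  simp only [Finset.sum_const, nsmul_eq_mul, Finset.card_univ, Fintype.card_prod,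
    Fintype.card_fin, Fintype.card_bool]
  push_cast
  ring

/-- Localization of the quadratic form: some restriction to a cube of radius `R` has almost the
same Rayleigh quotient. -/
theorem exists_localized (hκ : 0 ≤ κ) {f : Lattice d → ℝ} (hf0 : ∀ x, 0 ≤ f x)
    (hf : ∀ x, x ∉ Q → f x = 0) (hf1 : ∑ x ∈ Q, f x ^ 2 = 1) (R : ℕ) {Z : Finset (Lattice d)}
    (hZ : ∀ x ∈ Q, cube x R ⊆ Z) :
    ∃ z ∈ Z, 0 < ∑ x ∈ Q, (if x ∈ cube z R then f x else 0) ^ 2 ∧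
      (dirForm κ V Q f - 2 * d * κ / (2 * R + 1)) *
        (∑ x ∈ Q, (if x ∈ cube z R then f x else 0) ^ 2)
        ≤ dirForm κ V Q fun x => if x ∈ cube z R then f x else 0 := by
  classical
  set C : ℝ := (2 * R + 1) ^ d with hC
  have hC0 : 0 < C := by positivity
  -- Averaging over the centre `z`: squared mass and potential energy are each counted exactly `C`
  -- times, while a bond is lost only when the boundary of the cube cuts it, which happens for a
  -- fraction at most 1/(2R+1) of the centres. Hence some `z` does at least as well as the average.
  set fz : Lattice d → Lattice d → ℝ := fun z x => if x ∈ cube z R then f x else 0 with hfz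
  have hfzs : ∀ z x, x ∉ Q → fz z x = 0 := fun z x hx => by simp [hfz, hf x hx]
  have hcount : ∀ x ∈ Q, ∑ z ∈ Z, (if x ∈ cube z R then (1 : ℝ) else 0) = C := by
    intro x hx
    rw [← Finset.sum_filter, Finset.sum_const, nsmul_eq_mul, mul_one]
    have : Z.filter (fun z => x ∈ cube z R) = cube x R := by
      ext z
      rw [Finset.mem_filter, mem_cube_comm]
      exact ⟨fun h => h.2, fun h => ⟨hZ x hx h, h⟩⟩
    rw [this, card_cube, hC]
    push_cast
    rfl
  have hcount2 : ∀ x ∈ Q, ∀ e : Fin d × Bool, C - C / (2 * R + 1)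
      ≤ ∑ z ∈ Z, (if x ∈ cube z R ∧ x + unitVec e ∈ cube z R then (1 : ℝ) else 0) := by
    intro x hx e
    rw [← Finset.sum_filter, Finset.sum_const, nsmul_eq_mul, mul_one]
    have : Z.filter (fun z => x ∈ cube z R ∧ x + unitVec e ∈ cube z R)
        = cube x R \ (cube x R \ cube (x + unitVec e) R) := by
      ext z
      rw [Finset.mem_filter, Finset.sdiff_sdiff_self_left, Finset.mem_inter, mem_cube_comm,
        mem_cube_comm (y := x + unitVec e)]
      exact ⟨fun h => h.2, fun h => ⟨hZ x hx h.1, h⟩⟩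
    rw [this, Finset.card_sdiff_of_subset Finset.sdiff_subset,
      Nat.cast_sub (Finset.card_le_card Finset.sdiff_subset), card_cube]
    have h1 := card_cube_sdiff_le x e R
    have h2 : ((2 * R + 1 : ℕ) : ℝ) * (cube x R \ cube (x + unitVec e) R).card ≤ C := by
      rw [hC]
      exact_mod_cast h1
    have h3 : ((cube x R \ cube (x + unitVec e) R).card : ℝ) ≤ C / (2 * R + 1) := by
      rw [le_div_iff₀ (by positivity), mul_comm]
      push_cast at h2
      exact h2
    push_cast
    linarith
  have hmass : ∑ z ∈ Z, ∑ x ∈ Q, fz z x ^ 2 = C := by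
    rw [Finset.sum_comm]
    have : ∀ x ∈ Q, ∑ z ∈ Z, fz z x ^ 2 = C * f x ^ 2 := by
      intro x hx
      rw [← hcount x hx, Finset.sum_mul]
      refine Finset.sum_congr rfl fun z _ => ?_
      simp only [hfz]
      split_ifs <;> simp
    rw [Finset.sum_congr rfl this, ← Finset.mul_sum, hf1, mul_one]
  have hpot : ∑ z ∈ Z, ∑ x ∈ Q, (V x - 2 * d * κ) * fz z x ^ 2
      = C * ∑ x ∈ Q, (V x - 2 * d * κ) * f x ^ 2 := by
    rw [Finset.sum_comm, Finset.mul_sum]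
    refine Finset.sum_congr rfl fun x hx => ?_
    rw [← hcount x hx, Finset.sum_mul]
    refine Finset.sum_congr rfl fun z _ => ?_
    simp only [hfz]
    split_ifs <;> simp
  have hkin : (C - C / (2 * R + 1)) * ∑ x ∈ Q, ∑ e : Fin d × Bool, f x * f (x + unitVec e)
      ≤ ∑ z ∈ Z, ∑ x ∈ Q, ∑ e : Fin d × Bool, fz z x * fz z (x + unitVec e) := by
    conv_rhs => rw [Finset.sum_comm]
    rw [Finset.mul_sum]
    refine Finset.sum_le_sum fun x hx => ?_
    conv_rhs => rw [Finset.sum_comm]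
    rw [Finset.mul_sum]
    refine Finset.sum_le_sum fun e _ => ?_
    refine (mul_le_mul_of_nonneg_right (hcount2 x hx e)
      (mul_nonneg (hf0 x) (hf0 (x + unitVec e)))).trans (le_of_eq ?_)
    rw [Finset.sum_mul]
    refine Finset.sum_congr rfl fun z _ => ?_
    simp only [hfz]
    by_cases h1 : x ∈ cube z R <;> by_cases h2 : x + unitVec e ∈ cube z R <;> simp [h1, h2]
  have hform : C * (dirForm κ V Q f - 2 * d * κ / (2 * R + 1)) ≤ ∑ z ∈ Z, dirForm κ V Q (fz z) := by
    simp_rw [fun z => dirForm_eq_of_support (κ := κ) (V := V) (hfzs z)]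
    rw [Finset.sum_add_distrib, hpot, ← Finset.mul_sum, dirForm_eq_of_support hf]
    have h1 := sum_sum_mul_shift_le hf
    rw [hf1, mul_one] at h1
    have h2 := mul_le_mul_of_nonneg_left hkin hκ
    have h3 : κ * (C / (2 * R + 1)) * ∑ x ∈ Q, ∑ e : Fin d × Bool, f x * f (x + unitVec e)
        ≤ κ * (C / (2 * R + 1)) * (2 * d) := mul_le_mul_of_nonneg_left h1 (by positivity)
    have h4 : C * (2 * d * κ / (2 * R + 1)) = κ * (C / (2 * R + 1)) * (2 * d) := by ring
    rw [mul_sub, mul_add, h4]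
    nlinarith [h2, h3]
  -- If every nonzero restriction did strictly worse, summation over `z` would contradict `hform`.
  by_contra hcon
  push Not at hcon
  have hle : ∀ z ∈ Z, dirForm κ V Q (fz z)
      ≤ (dirForm κ V Q f - 2 * d * κ / (2 * R + 1)) * ∑ x ∈ Q, fz z x ^ 2 := by
    intro z hz
    by_cases hp : 0 < ∑ x ∈ Q, fz z x ^ 2
    · exact (hcon z hz hp).le
    · have h0 : ∑ x ∈ Q, fz z x ^ 2 = 0 :=
        le_antisymm (not_lt.1 hp) (Finset.sum_nonneg fun x _ => sq_nonneg _)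
      have hz0 : ∀ x ∈ Q, fz z x = 0 := fun x hx =>
        pow_eq_zero_iff (two_ne_zero (α := ℕ)) |>.1 ((Finset.sum_eq_zero_iff_of_nonneg
          (f := fun x => fz z x ^ 2) fun x _ => sq_nonneg (fz z x)).1 h0 x hx)
      rw [h0, mul_zero, dirForm]
      exact (Finset.sum_eq_zero fun x hx => by simp [hz0 x hx]).le
  obtain ⟨z, hz, hzp⟩ : ∃ z ∈ Z, 0 < ∑ x ∈ Q, fz z x ^ 2 := by
    by_contra h
    push Not at h
    have := Finset.sum_nonpos (f := fun z => ∑ x ∈ Q, fz z x ^ 2) h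
    rw [hmass] at this
    linarith
  have hlt := Finset.sum_lt_sum hle ⟨z, hz, hcon z hz hzp⟩
  rw [← Finset.mul_sum, hmass, mul_comm] at hlt
  linarith

/-- Discretization of a normalized nonnegative function. -/
theorem exists_discretized (hκ : 0 ≤ κ) {B : Finset (Lattice d)} {h : Lattice d → ℝ}
    (h0 : ∀ x, 0 ≤ h x) (hQ : ∀ x, x ∉ Q → h x = 0) (hB : ∀ x, x ∉ B → h x = 0)
    (h1 : ∑ x ∈ Q, h x ^ 2 = 1) {Λ ε : ℝ} (hΛ : ∀ x ∈ Q, V x - 2 * d * κ ≤ Λ)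
    (hform : Λ - ε ≤ dirForm κ V Q h) {n : ℕ} (hn : B.card < n) :
    ∃ k : Lattice d → ℕ, (∀ x, k x ≤ n) ∧ (∀ x, x ∉ Q → k x = 0) ∧ (∀ x, x ∉ B → k x = 0) ∧
      0 < ∑ x ∈ B, k x ∧
      Λ - ε - (((n : ℝ) / (n - B.card) - 1) * (ε + 2 * d * κ) + κ * (B.card * (4 * d)) / √n) ≤
        dirForm κ V Q fun x => √(k x / ∑ y ∈ B, (k y : ℝ)) := by
  classical
  -- The squared function is rounded down to multiples of 1/n and renormalized; the total `s` of the
  -- integers stays between `n - B.card` and `n`.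
  set k : Lattice d → ℕ := fun x => ⌊n * h x ^ 2⌋₊ with hk
  have hn0 : (0 : ℝ) < n := by exact_mod_cast (Nat.zero_le _).trans_lt hn
  have hle1 : ∀ x, h x ^ 2 ≤ 1 := by
    intro x
    by_cases hx : x ∈ Q
    · rw [← h1]
      exact Finset.single_le_sum (f := fun x => h x ^ 2) (fun _ _ => sq_nonneg _) hx
    · rw [hQ x hx]; norm_num
  have hle1' : ∀ x, h x ≤ 1 := fun x => by nlinarith [hle1 x, h0 x]
  have hBsum : ∀ F : Lattice d → ℝ, (∀ x, h x = 0 → F x = 0) → ∑ x ∈ Q, F x = ∑ x ∈ B, F x := by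
    intro F hF
    rw [← Finset.sum_subset (Finset.inter_subset_left (s₁ := Q) (s₂ := B)),
      ← Finset.sum_subset (Finset.inter_subset_right (s₁ := Q) (s₂ := B))]
    · intro x hx hx'
      exact hF x (hQ x fun h => hx' (Finset.mem_inter.2 ⟨h, hx⟩))
    · intro x hx hx'
      exact hF x (hB x fun h => hx' (Finset.mem_inter.2 ⟨hx, h⟩))
  have hkle : ∀ x, (k x : ℝ) ≤ n * h x ^ 2 := fun x => Nat.floor_le (by positivity)
  have hkge : ∀ x, n * h x ^ 2 - 1 ≤ k x := fun x => (Nat.sub_one_lt_floor _).le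
  set s : ℝ := ∑ y ∈ B, (k y : ℝ) with hs
  have hsum1 : ∑ x ∈ B, h x ^ 2 = 1 := by rw [← h1, hBsum _ fun x hx => by simp [hx]]
  have hs_le : s ≤ n := by
    refine (Finset.sum_le_sum fun x _ => hkle x).trans ?_
    rw [← Finset.mul_sum, hsum1, mul_one]
  have hs_ge : (n : ℝ) - B.card ≤ s := by
    have := Finset.sum_le_sum (s := B) fun x _ => hkge x
    rw [Finset.sum_sub_distrib, ← Finset.mul_sum, hsum1, mul_one, Finset.sum_const, nsmul_eq_mul,
      mul_one] at this
    exact this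
  have hnB : (0 : ℝ) < n - B.card := by
    have : (B.card : ℝ) < n := by exact_mod_cast hn
    linarith
  have hs0 : 0 < s := hnB.trans_le hs_ge
  set g : Lattice d → ℝ := fun x => √(k x / s) with hg
  have hk0 : ∀ x, h x = 0 → k x = 0 := fun x hx => by simp [hk, hx]
  have hg0 : ∀ x, h x = 0 → g x = 0 := fun x hx => by simp [hg, hk0 x hx]
  have hgn : ∀ x, 0 ≤ g x := fun x => Real.sqrt_nonneg _
  have hgsq : ∀ x, g x ^ 2 = k x / s := fun x => Real.sq_sqrt (by positivity)
  have hgQ : ∀ x, x ∉ Q → g x = 0 := fun x hx => hg0 x (hQ x hx)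
  have hgsum : ∑ x ∈ Q, g x ^ 2 = 1 := by
    rw [hBsum _ fun x hx => by simp [hg0 x hx]]
    simp_rw [hgsq]
    rw [← Finset.sum_div, ← hs, div_self hs0.ne']
  have hgle1 : ∀ x, g x ≤ 1 := by
    intro x
    by_cases hx : x ∈ Q
    · have : g x ^ 2 ≤ 1 := by
        rw [← hgsum]
        exact Finset.single_le_sum (f := fun x => g x ^ 2) (fun _ _ => sq_nonneg _) hx
      nlinarith [hgn x]
    · rw [hgQ x hx]; norm_num
  -- Rounding lowers the function by at most 1/√n, and renormalizing can only raise it. One-sided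
  -- control is enough for the kinetic term.
  have hgge : ∀ x, h x - 1 / √n ≤ g x := by
    intro x
    have h2 : h x ^ 2 - 1 / n ≤ g x ^ 2 := by
      rw [hgsq]
      calc h x ^ 2 - 1 / n = ((n : ℝ) * h x ^ 2 - 1) / n := by field_simp
        _ ≤ (k x : ℝ) / n := by gcongr; exact hkge x
        _ ≤ (k x : ℝ) / s := by gcongr
    have hr0 : 0 < 1 / √(n : ℝ) := by positivity
    have hr : (1 / √(n : ℝ)) ^ 2 = 1 / n := by
      rw [div_pow, Real.sq_sqrt hn0.le, one_pow]
    rw [← hr] at h2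
    by_contra hcon
    push Not at hcon
    have hgn' := hgn x
    nlinarith
  -- The potential may be arbitrarily negative, so its energy is written as `Λ` minus a deficit with
  -- nonnegative coefficients. For `h` the deficit is at most ε + 2dκ, and rounding enlarges it by a
  -- factor of at most n/(n - |B|). This makes the error uniform in `V`.
  have hid : ∀ F : Lattice d → ℝ, (∑ x ∈ Q, F x ^ 2 = 1) →
      ∑ x ∈ Q, (V x - 2 * d * κ) * F x ^ 2
        = Λ - ∑ x ∈ Q, (Λ + 2 * d * κ - V x) * F x ^ 2 := by
    intro F hF
    have : Λ = ∑ x ∈ Q, Λ * F x ^ 2 := by rw [← Finset.mul_sum, hF, mul_one]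
    conv_rhs => rw [this]
    rw [← Finset.sum_sub_distrib]
    rw [← this]
    exact Finset.sum_congr rfl fun x _ => by ring
  have hfh := dirForm_eq_of_support (κ := κ) (V := V) hQ
  have hfg := dirForm_eq_of_support (κ := κ) (V := V) hgQ
  rw [hid h h1] at hfh
  rw [hid g hgsum] at hfg
  have hkin := sum_sum_mul_shift_le hQ
  rw [h1, mul_one] at hkin
  set Ph := ∑ x ∈ Q, (Λ + 2 * d * κ - V x) * h x ^ 2
  set Pg := ∑ x ∈ Q, (Λ + 2 * d * κ - V x) * g x ^ 2
  set Kh := ∑ x ∈ Q, ∑ e : Fin d × Bool, h x * h (x + unitVec e)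
  set Kg := ∑ x ∈ Q, ∑ e : Fin d × Bool, g x * g (x + unitVec e)
  have hPh : Ph ≤ ε + 2 * d * κ := by
    have := mul_le_mul_of_nonneg_left hkin hκ
    nlinarith
  have hPh0 : 0 ≤ Ph := Finset.sum_nonneg fun x hx =>
    mul_nonneg (by linarith [hΛ x hx]) (sq_nonneg _)
  have hPg : Pg ≤ n / (n - B.card) * Ph := by
    rw [Finset.mul_sum]
    refine Finset.sum_le_sum fun x hx => ?_
    have h2 : g x ^ 2 ≤ n / (n - B.card) * h x ^ 2 := by
      rw [hgsq]
      calc (k x : ℝ) / s ≤ n * h x ^ 2 / s := by gcongr; exact hkle x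
        _ ≤ n * h x ^ 2 / (n - B.card) := by gcongr
        _ = _ := by ring
    calc (Λ + 2 * d * κ - V x) * g x ^ 2
        ≤ (Λ + 2 * d * κ - V x) * (n / (n - B.card) * h x ^ 2) :=
          mul_le_mul_of_nonneg_left h2 (by linarith [hΛ x hx])
      _ = _ := by ring
  have hK : Kh - Kg ≤ B.card * (4 * d) / √n := by
    have hterm : ∀ x ∈ B, ∑ e : Fin d × Bool, (h x * h (x + unitVec e) - g x * g (x + unitVec e))
        ≤ 4 * d / √n := by
      intro x _
      have h2 : ∀ e ∈ (Finset.univ : Finset (Fin d × Bool)),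
          h x * h (x + unitVec e) - g x * g (x + unitVec e) ≤ 2 / √n := by
        intro e _
        have a1 := hgge x
        have a2 := hgge (x + unitVec e)
        have a3 := hle1' x
        have a4 := hgle1 (x + unitVec e)
        have a5 := hgn (x + unitVec e)
        have a6 := h0 x
        have hr0 : 0 < 1 / √(n : ℝ) := by positivity
        have hr2 : 2 / √(n : ℝ) = 1 / √n + 1 / √n := by ring
        rw [hr2]
        have b1 : h x * (h (x + unitVec e) - g (x + unitVec e)) ≤ 1 / √n := by
          calc h x * (h (x + unitVec e) - g (x + unitVec e)) ≤ h x * (1 / √n) := by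
                gcongr; linarith
            _ ≤ 1 * (1 / √n) := by gcongr
            _ = _ := one_mul _
        have b2 : (h x - g x) * g (x + unitVec e) ≤ 1 / √n := by
          calc (h x - g x) * g (x + unitVec e) ≤ 1 / √n * g (x + unitVec e) := by
                gcongr; linarith
            _ ≤ 1 / √n * 1 := by gcongr
            _ = _ := mul_one _
        nlinarith
      refine (Finset.sum_le_sum h2).trans (le_of_eq ?_)
      simp only [Finset.sum_const, nsmul_eq_mul, Finset.card_univ, Fintype.card_prod,
        Fintype.card_fin, Fintype.card_bool]
      push_cast
      ring
    have h3 : Kh - Kg = ∑ x ∈ B, ∑ e : Fin d × Bool,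
        (h x * h (x + unitVec e) - g x * g (x + unitVec e)) := by
      rw [← hBsum]
      · rw [← Finset.sum_sub_distrib]
        exact Finset.sum_congr rfl fun x _ => by rw [← Finset.sum_sub_distrib]
      · intro x hx
        simp [hx, hg0 x hx]
    rw [h3]
    refine (Finset.sum_le_sum hterm).trans (le_of_eq ?_)
    rw [Finset.sum_const, nsmul_eq_mul]
    ring
  refine ⟨k, fun x => ?_, fun x hx => hk0 x (hQ x hx), fun x hx => hk0 x (hB x hx), ?_, ?_⟩
  · have : (k x : ℝ) ≤ n := (hkle x).trans (by nlinarith [hle1 x])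
    exact_mod_cast this
  · have : (0 : ℝ) < ((∑ x ∈ B, k x : ℕ) : ℝ) := by push_cast; exact hs0
    exact_mod_cast this
  · have hratio : 0 ≤ (n : ℝ) / (n - B.card) - 1 := by
      rw [sub_nonneg, one_le_div hnB]
      linarith [(Nat.cast_nonneg B.card : (0 : ℝ) ≤ B.card)]
    have h4 : Pg - Ph ≤ ((n : ℝ) / (n - B.card) - 1) * (ε + 2 * d * κ) := by
      have := mul_le_mul_of_nonneg_left hPh hratio
      linarith
    have h5 := mul_le_mul_of_nonneg_left hK hκ
    have h6 : κ * (B.card * (4 * d) / √n) = κ * (B.card * (4 * d)) / √n := by ring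
    rw [h6] at h5
    have h7 : Λ - ε - (((n : ℝ) / (n - B.card) - 1) * (ε + 2 * d * κ) +
        κ * (B.card * (4 * d)) / √n) ≤ dirForm κ V Q g := by
      rw [hfg]
      nlinarith
    exact h7

end Localization

end PAM

namespace PAM

open scoped ENNReal

/-! ### A finite net of test functions -/

section Net

variable {d : ℕ} {κ : ℝ}

theorem dirForm_cube_shift (V : Lattice d → ℝ) (z : Lattice d) (R : ℕ) (f : Lattice d → ℝ) :
    dirForm κ (fun y => V (y + z)) (cube 0 R) (fun y => f (y + z)) = dirForm κ V (cube z R) f := by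
  have hmem : ∀ y : Lattice d, y + z ∈ cube z R ↔ y ∈ cube 0 R := fun y => by
    simpa using add_mem_cube_iff (x := 0) (y := y) (z := z) (n := R)
  rw [dirForm, dirForm]
  refine Finset.sum_nbij' (fun y => y + z) (fun y => y - z) (fun y hy => (hmem y).2 hy)
    (fun y hy => by rwa [← hmem, sub_add_cancel]) (fun y _ => add_sub_cancel_right y z)
    (fun y _ => sub_add_cancel y z) fun y _ => ?_
  congr 2
  refine Finset.sum_congr rfl fun e _ => ?_
  have h1 : y + unitVec e + z = y + z + unitVec e := add_right_comm _ _ _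
  have h2 := hmem (y + unitVec e)
  rw [h1] at h2
  simp only [h1, h2]

/-- Up to an arbitrarily small error in the exponent, the Dirichlet solution in any cube is
controlled by the quadratic form on finitely many functions of compact support and their shifts. -/
theorem exists_net (d : ℕ) (hκ : 0 ≤ κ) {ε : ℝ} (hε : 0 < ε) :
    ∃ (R : ℕ) (W : Finset (Lattice d → ℝ)),
      (∀ g ∈ W, ∑ x ∈ cube 0 R, g x ^ 2 = 1) ∧
      ∀ (ϱ : ℕ) (V : Lattice d → ℝ), ∃ z ∈ cube (0 : Lattice d) (ϱ + R), ∃ g ∈ W,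
        ∀ t, 0 ≤ t → ∀ x, dirSol κ V (cube 0 ϱ) t x ^ 2 ≤ (2 * ϱ + 1) ^ d *
          Real.exp (2 * t * (ε + dirForm κ (fun y => V (y + z)) (cube 0 R) g)) := by
  classical
  -- Half of the error budget goes to localization, the other half to discretization.
  obtain ⟨R, hR⟩ : ∃ R : ℕ, 2 * d * κ / (2 * R + 1) ≤ ε / 2 := by
    obtain ⟨R, hR⟩ := exists_nat_ge (2 * d * κ / (ε / 2))
    refine ⟨R, ?_⟩
    rw [div_le_iff₀ (by positivity)] at hR ⊢
    have : (R : ℝ) * (ε / 2) ≤ ε / 2 * (2 * R + 1) := by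
      have : 0 ≤ (R : ℝ) * ε := by positivity
      nlinarith
    linarith
  set C : ℕ := (2 * R + 1) ^ d with hC
  set ε₁ : ℝ := 2 * d * κ / (2 * R + 1) with hε₁
  obtain ⟨n, hnC, hn⟩ : ∃ n : ℕ, C < n ∧
      ((n : ℝ) / (n - C) - 1) * (ε₁ + 2 * d * κ) + κ * (C * (4 * d)) / √n < ε / 2 := by
    have h1 : Tendsto (fun n : ℕ => (n : ℝ) / (n - C)) atTop (𝓝 1) := by
      simpa [sub_eq_add_neg] using tendsto_natCast_div_add_atTop (-(C : ℝ))
    have h2 : Tendsto (fun n : ℕ => κ * (C * (4 * d)) / √(n : ℝ)) atTop (𝓝 0) :=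
      Tendsto.const_div_atTop (Real.tendsto_sqrt_atTop.comp tendsto_natCast_atTop_atTop) _
    have h3 := ((h1.sub_const 1).mul_const (ε₁ + 2 * d * κ)).add h2
    rw [sub_self, zero_mul, zero_add] at h3
    obtain ⟨n, hn⟩ := ((h3.eventually_lt_const (half_pos hε)).and
      (eventually_gt_atTop C)).exists
    exact ⟨n, hn.2, hn.1⟩
  -- There are finitely many rounded profiles on a fixed cube, and the family depends neither on the
  -- large radius `ϱ` nor on the potential.
  set G : (cube (0 : Lattice d) R → Fin (n + 1)) → Lattice d → ℝ := fun k x =>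
    if h : x ∈ cube 0 R then √((k ⟨x, h⟩ : ℕ) / ∑ y, ((k y : ℕ) : ℝ)) else 0 with hG
  refine ⟨R, (Finset.univ.filter fun k => 0 < ∑ y, (k y : ℕ)).image G, ?_, ?_⟩
  · intro g hg
    obtain ⟨k, hk, rfl⟩ := Finset.mem_image.1 hg
    have hk0 : (0 : ℝ) < ∑ y, ((k y : ℕ) : ℝ) := by exact_mod_cast (Finset.mem_filter.1 hk).2
    rw [← Finset.sum_coe_sort]
    have : ∀ x : cube (0 : Lattice d) R, G k x ^ 2 = (k x : ℕ) / ∑ y, ((k y : ℕ) : ℝ) := by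
      intro x
      simp only [hG, x.2, dif_pos]
      exact Real.sq_sqrt (by positivity)
    simp_rw [this]
    rw [← Finset.sum_div, div_self hk0.ne']
  · intro ϱ V
    set Q := cube (0 : Lattice d) ϱ with hQ
    obtain ⟨f, hf0, hfQ, hf1, hmax, hexp⟩ := exists_top_dirForm hκ V (cube_nonempty (0 : Lattice d) ϱ)
    obtain ⟨z, hz, hp, hloc⟩ := exists_localized hκ hf0 hfQ hf1 R (Z := cube 0 (ϱ + R))
      (V := V) fun x hx => cube_subset_cube hx le_rfl
    set fz : Lattice d → ℝ := fun x => if x ∈ cube z R then f x else 0 with hfz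
    set p := ∑ x ∈ Q, fz x ^ 2 with hpdef
    have hp' : 0 < p := hp
    set h : Lattice d → ℝ := fun x => 1 / √p * fz x with hh
    have hsq : (1 / √p) ^ 2 = 1 / p := by rw [div_pow, one_pow, Real.sq_sqrt hp'.le]
    have hfz0 : ∀ x, 0 ≤ fz x := fun x => by
      simp only [hfz]; split_ifs
      · exact hf0 x
      · exact le_rfl
    have hform : dirForm κ V Q f - ε₁ ≤ dirForm κ V Q h := by
      rw [hh, dirForm_smul, hsq, one_div_mul_eq_div, le_div_iff₀ hp']
      exact hloc
    obtain ⟨k, hkn, hkQ, hkB, hks, hk⟩ := exists_discretized (Q := Q) (B := cube z R) (V := V)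
      (h := h) (n := n) hκ
      (fun x => mul_nonneg (by positivity) (hfz0 x))
      (fun x hx => by simp [hh, hfz, hfQ x hx]) (fun x hx => by simp [hh, hfz, hx])
      (by simp_rw [hh, mul_pow, ← Finset.mul_sum, hsq]; rw [← hpdef]; field_simp)
      (Λ := dirForm κ V Q f) hmax hform (by rw [card_cube]; exact hnC)
    rw [card_cube, ← hC] at hk
    have hmem : ∀ y : Lattice d, y + z ∈ cube z R ↔ y ∈ cube 0 R := fun y => by
      simpa using add_mem_cube_iff (x := 0) (y := y) (z := z) (n := R)
    have hreidx : ∀ F : Lattice d → ℝ, ∑ y : cube (0 : Lattice d) R, F (y + z)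
        = ∑ y ∈ cube z R, F y := by
      intro F
      rw [Finset.sum_coe_sort (cube (0 : Lattice d) R) fun y => F (y + z)]
      exact Finset.sum_nbij' (fun y => y + z) (fun y => y - z) (fun y hy => (hmem y).2 hy)
        (fun y hy => by rwa [← hmem, sub_add_cancel]) (fun y _ => add_sub_cancel_right y z)
        (fun y _ => sub_add_cancel y z) fun y _ => rfl
    set k' : cube (0 : Lattice d) R → Fin (n + 1) := fun x =>
      ⟨k (x + z), Nat.lt_succ_of_le (hkn _)⟩ with hk'
    have hsum : ∑ y, ((k' y : ℕ) : ℝ) = ∑ y ∈ cube z R, (k y : ℝ) :=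
      hreidx fun y => (k y : ℝ)
    refine ⟨z, hz, G k', Finset.mem_image.2 ⟨k', Finset.mem_filter.2 ⟨Finset.mem_univ _, ?_⟩, rfl⟩,
      fun t ht x => ?_⟩
    · have : (0 : ℝ) < ∑ y, ((k' y : ℕ) : ℝ) := by
        rw [hsum]; exact_mod_cast hks
      exact_mod_cast this
    · have hGk : G k' = fun y => √(k (y + z) / ∑ y ∈ cube z R, (k y : ℝ)) := by
        funext y
        simp only [hG]
        split_ifs with hy
        · rw [hsum]
        · rw [hkB _ fun h' => hy ((hmem y).1 h')]
          simp
      rw [hGk, dirForm_cube_shift V z R fun y => √(k y / ∑ y ∈ cube z R, (k y : ℝ))]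
      -- The cube around `z` may stick out of `Q`; the rounded function vanishes outside both sets,
      -- so the two forms agree.
      rw [dirForm_eq_of_support_inter (Q' := cube z R)
        (f := fun x => √(k x / ∑ y ∈ cube z R, (k y : ℝ))) (fun x hx => by simp [hkQ x hx])
        fun x hx => by simp [hkB x hx]] at hk
      refine (hexp t ht x).trans ?_
      rw [card_cube]
      push_cast
      gcongr
      linarith

end Net

/-! ### Consequences of Assumption H -/

section Regularity

/-- The sum of the H(t w(x)) minus H(t) behaves like ρ t times the sum of the w log w. For finite ρ
this limit is linear in t, so it cancels between time 2t and twice time t, up to δt. For infinite ρ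
it is below every linear function, which gives the second alternative, unless all weights are 0 or
1; then the first alternative is an identity up to δt. -/
theorem AssumptionH.sum_le {H : ℝ → ℝ} (hH : AssumptionH H) (h0 : H 0 = 0) {ι : Type*}
    {B : Finset ι} {w : ι → ℝ} (hw0 : ∀ x ∈ B, 0 ≤ w x) (hw1 : ∑ x ∈ B, w x = 1) {δ : ℝ}
    (hδ : 0 < δ) (M : ℝ) :
    ∀ᶠ t in atTop,
      ∑ x ∈ B, H (2 * t * w x) ≤ H (2 * t) - 2 * H t + 2 * ∑ x ∈ B, H (t * w x) + δ * t ∨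
      ∑ x ∈ B, H (2 * t * w x) ≤ H (2 * t) - M * t := by
  obtain ⟨ρ, hρ⟩ := hH
  have hwle : ∀ x ∈ B, w x ≤ 1 := fun x hx => by
    rw [← hw1]; exact Finset.single_le_sum hw0 hx
  have hsum : ∀ t, ∑ x ∈ B, (1 / t * (H (w x * t) - w x * H t))
      = 1 / t * (∑ x ∈ B, H (t * w x) - H t) := by
    intro t
    rw [← Finset.mul_sum, Finset.sum_sub_distrib, ← Finset.sum_mul, hw1, one_mul]
    simp_rw [mul_comm t]
  have h2 : Tendsto (fun t : ℝ => 2 * t) atTop atTop :=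
    tendsto_id.const_mul_atTop two_pos
  induction ρ using ENNReal.recTopCoe with
  | coe r =>
    have hlim : ∀ x ∈ B, Tendsto (fun t : ℝ => 1 / t * (H (w x * t) - w x * H t)) atTop
        (𝓝 (r * (w x * Real.log (w x)))) := by
      intro x hx
      rcases (hw0 x hx).eq_or_lt with h | h
      · simp [← h, h0]
      rcases (hwle x hx).eq_or_lt with h' | h'
      · simp [h']
      have := hρ (w x) ⟨h, h'⟩
      rw [← EReal.tendsto_coe]
      convert this using 2
      rw [EReal.coe_mul]
      rfl
    have hL := tendsto_finsetSum B hlim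
    simp_rw [hsum] at hL
    have hdiff := (hL.comp h2).sub hL
    rw [sub_self] at hdiff
    filter_upwards [hdiff.eventually_lt_const (half_pos hδ), eventually_gt_atTop 0] with t ht ht0
    left
    simp only [Function.comp] at ht
    rw [one_div_mul_eq_div, one_div_mul_eq_div, div_sub_div _ _ (by positivity) ht0.ne',
      div_lt_iff₀ (by positivity)] at ht
    have : 0 < t * (2 * ((∑ x ∈ B, H (t * w x) - H t)) + δ * t
        - (∑ x ∈ B, H (2 * t * w x) - H (2 * t))) := by
      nlinarith
    have := pos_of_mul_pos_right this ht0.le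
    linarith
  | top =>
    by_cases hdeg : ∀ x ∈ B, w x = 0 ∨ w x = 1
    · filter_upwards [eventually_gt_atTop 0] with t ht0
      left
      have key : ∀ s, ∑ x ∈ B, H (s * w x) = H s := by
        intro s
        have : ∀ x ∈ B, H (s * w x) = w x * H s := fun x hx => by
          rcases hdeg x hx with h | h <;> simp [h, h0]
        rw [Finset.sum_congr rfl this, ← Finset.sum_mul, hw1, one_mul]
      rw [key, key]
      have : 0 < δ * t := by positivity
      linarith
    · push Not at hdeg
      obtain ⟨x₀, hx₀, hx0, hx1⟩ := hdeg
      have hbot : ∀ x ∈ B, 0 < w x → w x < 1 →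
          Tendsto (fun t : ℝ => 1 / t * (H (w x * t) - w x * H t)) atTop atBot := by
        intro x hx h h'
        have := hρ (w x) ⟨h, h'⟩
        rw [← EReal.tendsto_coe_nhds_bot_iff]
        convert this using 2
        rw [EReal.coe_ennreal_top, EReal.top_mul_coe_of_neg]
        exact mul_neg_of_pos_of_neg h (Real.log_neg h h')
      have hle : ∀ x ∈ B, ∀ᶠ t : ℝ in atTop, 1 / t * (H (w x * t) - w x * H t) ≤ 0 := by
        intro x hx
        rcases (hw0 x hx).eq_or_lt with h | h
        · simp [← h, h0]
        rcases (hwle x hx).eq_or_lt with h' | h'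
        · simp [h']
        exact (hbot x hx h h').eventually_le_atBot 0
      have hx₀' := (hbot x₀ hx₀ (lt_of_le_of_ne (hw0 x₀ hx₀) (Ne.symm hx0))
        (lt_of_le_of_ne (hwle x₀ hx₀) hx1)).eventually_le_atBot (-(M / 2))
      have hall := (Filter.eventually_all_finset B).2 hle
      filter_upwards [h2.eventually hall, h2.eventually hx₀', eventually_gt_atTop 0] with t h3 h4 h5
      right
      have h6 := hsum (2 * t)
      have h7 : ∑ x ∈ B, (1 / (2 * t) * (H (w x * (2 * t)) - w x * H (2 * t))) ≤ -(M / 2) := by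
        classical
        rw [← Finset.add_sum_erase B _ hx₀]
        have : ∑ x ∈ B.erase x₀, (1 / (2 * t) * (H (w x * (2 * t)) - w x * H (2 * t))) ≤ 0 :=
          Finset.sum_nonpos fun x hx => h3 x (Finset.mem_of_mem_erase hx)
        linarith
      rw [h6, one_div_mul_eq_div, div_le_iff₀ (by positivity)] at h7
      linarith

end Regularity

end PAM

namespace PAM

open scoped ENNReal

/-! ### Annealed asymptotics and the second moment -/

section Moments

variable {d : ℕ} {κ : ℝ} {μ : Measure ℝ} [IsProbabilityMeasure μ]

theorem lintegral_exp_mul (hexp : ∀ t : ℝ, 0 ≤ t → Integrable (fun y => Real.exp (t * y)) μ)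
    {t : ℝ} (ht : 0 ≤ t) :
    ∫⁻ y, ENNReal.ofReal (Real.exp (t * y)) ∂μ = ENNReal.ofReal (Real.exp (cgf id μ t)) := by
  rw [exp_cgf (X := id) (hexp t ht)]
  exact (ofReal_integral_eq_lintegral_ofReal (hexp t ht) (Eventually.of_forall fun _ =>
    (Real.exp_pos _).le)).symm

/-- The expectation of the solution at the origin. -/
noncomputable def meanFK (d : ℕ) [NeZero d] (κ : ℝ) (μ : Measure ℝ) [IsProbabilityMeasure μ]
    (t : ℝ) : ℝ :=
  ∫ V, solution κ V t 0 ∂(fieldMeasure d μ)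

theorem lintegral_fk_eq_origin [NeZero d] (n : ℕ∞) (κ : ℝ) (F : ℝ≥0∞ → ℝ≥0∞) (hF : Measurable F)
    (t : ℝ) (x : Lattice d) :
    ∫⁻ V, F (fk n κ V t x) ∂(fieldMeasure d μ) = ∫⁻ V, F (fk n κ V t 0) ∂(fieldMeasure d μ) := by
  have := (measurePreserving_shift μ x).lintegral_comp (hF.comp (measurable_fk n κ t 0))
  simp only [Function.comp, ← fk_shift n κ _ t x] at this
  exact this

theorem lintegral_fk_top_ne_top [NeZero d] (hκ : 0 < κ)
    (hexp : ∀ t : ℝ, 0 ≤ t → Integrable (fun y => Real.exp (t * y)) μ) {t : ℝ} (ht : 0 ≤ t)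
    (x : Lattice d) : ∫⁻ V, fk ⊤ κ V t x ∂(fieldMeasure d μ) ≠ ∞ := by
  refine ((lintegral_fk_top_comp_le μ hκ measurable_id x ht).trans_lt ?_).ne
  exact (lintegral_exp_mul hexp ht).trans_lt ENNReal.ofReal_lt_top

theorem lintegral_fk_top [NeZero d] (hκ : 0 < κ)
    (hexp : ∀ t : ℝ, 0 ≤ t → Integrable (fun y => Real.exp (t * y)) μ) {t : ℝ} (ht : 0 ≤ t)
    (x : Lattice d) :
    ∫⁻ V, fk ⊤ κ V t x ∂(fieldMeasure d μ) = ENNReal.ofReal (meanFK d κ μ t) := by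
  rw [lintegral_fk_eq_origin ⊤ κ (fun a => a) measurable_id]
  have hfin := lintegral_fk_top_ne_top hκ hexp ht (0 : Lattice d)
  simp_rw [meanFK, solution_eq_toReal_fk]
  rw [integral_toReal (measurable_fk ⊤ κ t 0).aemeasurable
    (ae_lt_top (measurable_fk ⊤ κ t 0) hfin), ENNReal.ofReal_toReal hfin]

theorem meanFK_nonneg [NeZero d] (κ : ℝ) (μ : Measure ℝ) [IsProbabilityMeasure μ] (t : ℝ) :
    0 ≤ meanFK d κ μ t :=
  integral_nonneg fun V => solution_nonneg κ V t 0

theorem meanFK_le [NeZero d] (hκ : 0 < κ)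
    (hexp : ∀ t : ℝ, 0 ≤ t → Integrable (fun y => Real.exp (t * y)) μ) {t : ℝ} (ht : 0 ≤ t) :
    meanFK d κ μ t ≤ Real.exp (cgf id μ t) := by
  rw [← ENNReal.ofReal_le_ofReal_iff (Real.exp_pos _).le, ← lintegral_fk_top hκ hexp ht 0,
    ← lintegral_exp_mul hexp ht]
  exact lintegral_fk_top_comp_le μ hκ measurable_id 0 ht

theorem lintegral_dirSol_le [NeZero d] (hκ : 0 < κ)
    (hexp : ∀ t : ℝ, 0 ≤ t → Integrable (fun y => Real.exp (t * y)) μ) {t : ℝ} (ht : 0 ≤ t)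
    (Q : Finset (Lattice d)) (x : Lattice d) :
    ∫⁻ V, ENNReal.ofReal (dirSol κ V Q t x) ∂(fieldMeasure d μ)
      ≤ ENNReal.ofReal (meanFK d κ μ t) := by
  rw [← lintegral_fk_top hκ hexp ht x]
  refine lintegral_mono_ae ?_
  filter_upwards [ae_finiteFK hκ μ hexp] with V hV
  refine (ENNReal.ofReal_le_ofReal (dirSol_le_solution hκ hV ht x)).trans ?_
  rw [solution_eq_toReal_fk]
  exact ENNReal.ofReal_toReal_le

/-- The strategy of staying at the origin up to time `t`, expressed by the Dirichlet problem on a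
single site. -/
theorem exp_cgf_sub_le_meanFK [NeZero d] (hκ : 0 < κ)
    (hexp : ∀ t : ℝ, 0 ≤ t → Integrable (fun y => Real.exp (t * y)) μ) {t : ℝ} (ht : 0 ≤ t) :
    Real.exp (cgf id μ t - 2 * d * κ * t) ≤ meanFK d κ μ t := by
  rw [← ENNReal.ofReal_le_ofReal_iff (meanFK_nonneg κ μ t)]
  refine le_trans ?_ (lintegral_dirSol_le hκ hexp ht {0} 0)
  calc ENNReal.ofReal (Real.exp (cgf id μ t - 2 * d * κ * t))
      = ENNReal.ofReal (Real.exp (-(2 * d * κ * t))) * ∫⁻ y, ENNReal.ofReal (Real.exp (t * y)) ∂μ := by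
        rw [lintegral_exp_mul hexp ht, ← ENNReal.ofReal_mul (Real.exp_pos _).le, ← Real.exp_add]
        ring_nf
    _ = ∫⁻ y, ENNReal.ofReal (Real.exp ((y - 2 * d * κ) * t)) ∂μ := by
        rw [← lintegral_const_mul _ (by fun_prop)]
        refine lintegral_congr fun y => ?_
        rw [← ENNReal.ofReal_mul (Real.exp_pos _).le, ← Real.exp_add]
        ring_nf
    _ = ∫⁻ V, ENNReal.ofReal (Real.exp ((V 0 - 2 * d * κ) * t)) ∂(fieldMeasure d μ) :=
        ((measurePreserving_eval_field μ (0 : Lattice d)).lintegral_comp (by fun_prop)).symm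
    _ ≤ _ := lintegral_mono fun V => ENNReal.ofReal_le_ofReal
        (exp_le_dirSol hκ.le (Finset.mem_singleton_self 0) ht)

theorem meanFK_pos [NeZero d] (hκ : 0 < κ)
    (hexp : ∀ t : ℝ, 0 ≤ t → Integrable (fun y => Real.exp (t * y)) μ) {t : ℝ} (ht : 0 ≤ t) :
    0 < meanFK d κ μ t :=
  (Real.exp_pos _).trans_le (exp_cgf_sub_le_meanFK hκ hexp ht)

theorem dirForm_eq_add (V : Lattice d → ℝ) (B : Finset (Lattice d)) (g : Lattice d → ℝ) :
    dirForm κ V B g = ∑ x ∈ B, g x ^ 2 * V x + dirForm κ 0 B g := by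
  rw [dirForm, dirForm, ← Finset.sum_add_distrib]
  refine Finset.sum_congr rfl fun x _ => ?_
  simp only [Pi.zero_apply]
  ring

/-- The form is affine in the potential with weights `g x ^ 2`, so independence factorizes the
expectation. -/
theorem lintegral_exp_dirForm
    (hexp : ∀ t : ℝ, 0 ≤ t → Integrable (fun y => Real.exp (t * y)) μ) {τ : ℝ} (hτ : 0 ≤ τ)
    (B : Finset (Lattice d)) (g : Lattice d → ℝ) :
    ∫⁻ V, ENNReal.ofReal (Real.exp (τ * dirForm κ V B g)) ∂(fieldMeasure d μ)
      = ENNReal.ofReal (Real.exp (∑ x ∈ B, cgf id μ (τ * g x ^ 2) + τ * dirForm κ 0 B g)) := by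
  set X : Lattice d → (Lattice d → ℝ) → ℝ := fun x V => g x ^ 2 * V x with hX
  have hind : iIndepFun X (fieldMeasure d μ) :=
    iIndepFun_infinitePi (P := fun _ : Lattice d => μ) (X := fun x y => g x ^ 2 * y)
      fun x => by fun_prop
  have hXm : ∀ x, Measurable (X x) := fun x => by fun_prop
  have hcomp : ∀ x, (fun V => Real.exp (τ * X x V))
      = (fun y => Real.exp (τ * g x ^ 2 * y)) ∘ fun V : Lattice d → ℝ => V x := by
    intro x; funext V; simp [hX, mul_assoc]
  have hXi : ∀ x, Integrable (fun V => Real.exp (τ * X x V)) (fieldMeasure d μ) := by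
    intro x
    rw [hcomp]
    exact (measurePreserving_eval_field μ x).integrable_comp_of_integrable
      (hexp _ (by positivity))
  have hmgf : ∀ x, mgf (X x) (fieldMeasure d μ) τ = Real.exp (cgf id μ (τ * g x ^ 2)) := by
    intro x
    rw [exp_cgf (X := id) (hexp _ (by positivity)), mgf, mgf]
    change ∫ V, (fun V => Real.exp (τ * X x V)) V ∂_ = _
    rw [hcomp]
    have := (measurePreserving_eval_field μ x).map_eq
    nth_rewrite 2 [← this]
    rw [integral_map (measurable_pi_apply x).aemeasurable (by fun_prop)]
    rfl
  have hint := hind.integrable_exp_mul_sum hXm (s := B) (t := τ) fun x _ => hXi x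
  have hsum := hind.mgf_sum hXm (t := τ) B
  rw [Finset.prod_congr rfl fun x _ => hmgf x, ← Real.exp_sum, mgf] at hsum
  calc ∫⁻ V, ENNReal.ofReal (Real.exp (τ * dirForm κ V B g)) ∂(fieldMeasure d μ)
      = ∫⁻ V, ENNReal.ofReal (Real.exp (τ * (∑ x ∈ B, X x) V)) *
          ENNReal.ofReal (Real.exp (τ * dirForm κ 0 B g)) ∂(fieldMeasure d μ) := by
        refine lintegral_congr fun V => ?_
        rw [← ENNReal.ofReal_mul (Real.exp_pos _).le, ← Real.exp_add, dirForm_eq_add, mul_add,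
          Finset.sum_apply]
    _ = _ := by
        rw [lintegral_mul_const' _ _ ENNReal.ofReal_ne_top,
          ← ofReal_integral_eq_lintegral_ofReal hint (Eventually.of_forall fun _ =>
            (Real.exp_pos _).le), hsum, ← ENNReal.ofReal_mul (Real.exp_pos _).le, ← Real.exp_add]

/-- The lower bound for the mean that matches the exponential moment of the form: `exp_dirForm_le`
is averaged over the potential, and the weights `g x ^ 2` sum to 1. -/
theorem exp_sum_cgf_le_meanFK [NeZero d] (hκ : 0 < κ)
    (hexp : ∀ t : ℝ, 0 ≤ t → Integrable (fun y => Real.exp (t * y)) μ) {t : ℝ} (ht : 0 ≤ t)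
    {B : Finset (Lattice d)} {g : Lattice d → ℝ} (hg : ∑ x ∈ B, g x ^ 2 = 1) :
    Real.exp (∑ x ∈ B, cgf id μ (t * g x ^ 2) + t * dirForm κ 0 B g) ≤ meanFK d κ μ t := by
  rw [← ENNReal.ofReal_le_ofReal_iff (meanFK_nonneg κ μ t), ← lintegral_exp_dirForm hexp ht]
  calc ∫⁻ V, ENNReal.ofReal (Real.exp (t * dirForm κ V B g)) ∂(fieldMeasure d μ)
      ≤ ∫⁻ V, ∑ x ∈ B, ENNReal.ofReal (g x ^ 2) * ENNReal.ofReal (dirSol κ V B t x)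
          ∂(fieldMeasure d μ) := by
        refine lintegral_mono fun V => ?_
        refine (ENNReal.ofReal_le_ofReal (exp_dirForm_le hκ.le ht hg)).trans ?_
        rw [ENNReal.ofReal_sum_of_nonneg fun x _ =>
          mul_nonneg (sq_nonneg _) (dirSol_nonneg hκ.le ht x)]
        exact Finset.sum_le_sum fun x _ => (ENNReal.ofReal_mul (sq_nonneg _)).le
    _ = ∑ x ∈ B, ENNReal.ofReal (g x ^ 2) * ∫⁻ V, ENNReal.ofReal (dirSol κ V B t x)
          ∂(fieldMeasure d μ) := by
        rw [lintegral_finsetSum' _ fun x _ => ?_]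
        · refine Finset.sum_congr rfl fun x _ => ?_
          rw [lintegral_const_mul' _ _ ENNReal.ofReal_ne_top]
        · exact ((continuous_dirSol_potential t x).measurable.ennreal_ofReal.const_mul
            _).aemeasurable
    _ ≤ ∑ x ∈ B, ENNReal.ofReal (g x ^ 2) * ENNReal.ofReal (meanFK d κ μ t) := by
        gcongr with x hx
        exact lintegral_dirSol_le hκ hexp ht B x
    _ = _ := by
        rw [← Finset.sum_mul, ← ENNReal.ofReal_sum_of_nonneg fun x _ => sq_nonneg (g x), hg]
        simp

/-- The second moment of the Feynman-Kac functional over paths with few jumps. -/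
theorem exists_lintegral_fk_sq_le [NeZero d] (hκ : 0 < κ)
    (hexp : ∀ t : ℝ, 0 ≤ t → Integrable (fun y => Real.exp (t * y)) μ)
    (hH : AssumptionH (cgf id μ)) {δ : ℝ} (hδ : 0 < δ) :
    ∃ (R : ℕ) (C : ℝ), 0 ≤ C ∧ ∀ᶠ t in atTop, ∀ ϱ : ℕ,
      ∫⁻ V, fk ϱ κ V t 0 ^ 2 ∂(fieldMeasure d μ) ≤ ENNReal.ofReal
        ((2 * ϱ + 1) ^ d * (2 * (ϱ + R) + 1) ^ d * C *
          (Real.exp (δ * t + cgf id μ (2 * t) - 2 * cgf id μ t) * meanFK d κ μ t ^ 2)) := by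
  obtain ⟨R, W, hW, hnet⟩ := exists_net d hκ.le (ε := δ / 4) (by positivity)
  refine ⟨R, W.card, Nat.cast_nonneg _, ?_⟩
  set H := cgf id μ with hHdef
  have hH0 : H 0 = 0 := cgf_zero
  have hmom : ∀ g ∈ W, ∀ᶠ t in atTop,
      ∫⁻ V, ENNReal.ofReal (Real.exp (2 * t * dirForm κ V (cube 0 R) g)) ∂(fieldMeasure d μ)
        ≤ ENNReal.ofReal
          (Real.exp (δ / 2 * t + H (2 * t) - 2 * H t) * meanFK d κ μ t ^ 2) := by
    intro g hg
    set c := dirForm κ 0 (cube 0 R) g with hc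
    -- The constant 2c + 4dκ makes the second alternative compensate the kinetic term 2tc and the
    -- loss 4dκt from squaring the crude lower bound for the mean.
    filter_upwards [hH.sum_le hH0 (B := cube 0 R) (w := fun x => g x ^ 2)
      (fun x _ => sq_nonneg _) (hW g hg) (half_pos hδ) (2 * c + 4 * d * κ), eventually_ge_atTop 0]
      with t ht ht0
    rw [lintegral_exp_dirForm hexp (by positivity)]
    refine ENNReal.ofReal_le_ofReal ?_
    rcases ht with ht | ht
    · have h1 := exp_sum_cgf_le_meanFK (d := d) hκ hexp ht0 (hW g hg)
      calc Real.exp (∑ x ∈ cube 0 R, H (2 * t * g x ^ 2) + 2 * t * c)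
          ≤ Real.exp (δ / 2 * t + H (2 * t) - 2 * H t) *
            Real.exp (∑ x ∈ cube 0 R, H (t * g x ^ 2) + t * c) ^ 2 := by
            rw [← Real.exp_nat_mul, ← Real.exp_add, Real.exp_le_exp]
            push_cast
            linarith
        _ ≤ _ := by gcongr
    · have h1 := exp_cgf_sub_le_meanFK (d := d) hκ hexp ht0
      calc Real.exp (∑ x ∈ cube 0 R, H (2 * t * g x ^ 2) + 2 * t * c)
          ≤ Real.exp (δ / 2 * t + H (2 * t) - 2 * H t) *
            Real.exp (H t - 2 * d * κ * t) ^ 2 := by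
            rw [← Real.exp_nat_mul, ← Real.exp_add, Real.exp_le_exp]
            push_cast
            have : 0 ≤ δ / 2 * t := by positivity
            linarith
        _ ≤ _ := by gcongr
  filter_upwards [(Filter.eventually_all_finset W).2 hmom, eventually_ge_atTop 0] with t ht ht0 ϱ
  set A : ℝ := Real.exp (δ / 2 * t + H (2 * t) - 2 * H t) * meanFK d κ μ t ^ 2 with hA
  have hA0 : 0 ≤ A := by positivity
  set D : ℝ := (2 * ϱ + 1) ^ d * Real.exp (δ / 2 * t) with hD
  -- The shift and the test function depend on the potential; summing over all candidates costs only
  -- the factor `W.card` times the volume of a cube.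
  have hpt : ∀ V : Lattice d → ℝ, fk ϱ κ V t 0 ^ 2 ≤
      ∑ z ∈ cube (0 : Lattice d) (ϱ + R), ∑ g ∈ W, ENNReal.ofReal D *
        ENNReal.ofReal (Real.exp (2 * t * dirForm κ (fun y => V (y + z)) (cube 0 R) g)) := by
    intro V
    obtain ⟨z, hz, g, hg, h⟩ := hnet ϱ V
    have h1 := fk_le_dirSol (Q := cube 0 ϱ) (V := V) hκ ϱ (x := 0)
      (fun y hy => mem_cube.2 hy) ht0
    calc fk ϱ κ V t 0 ^ 2 ≤ ENNReal.ofReal (dirSol κ V (cube 0 ϱ) t 0) ^ 2 := by gcongr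
      _ = ENNReal.ofReal (dirSol κ V (cube 0 ϱ) t 0 ^ 2) :=
        (ENNReal.ofReal_pow (dirSol_nonneg hκ.le ht0 _) 2).symm
      _ ≤ ENNReal.ofReal D *
        ENNReal.ofReal (Real.exp (2 * t * dirForm κ (fun y => V (y + z)) (cube 0 R) g)) := by
        rw [← ENNReal.ofReal_mul (by positivity)]
        refine ENNReal.ofReal_le_ofReal ((h t ht0 0).trans (le_of_eq ?_))
        rw [hD, mul_assoc (_ ^ d), ← Real.exp_add]
        congr 2
        ring
      _ ≤ ∑ g ∈ W, ENNReal.ofReal D *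
        ENNReal.ofReal (Real.exp (2 * t * dirForm κ (fun y => V (y + z)) (cube 0 R) g)) :=
        Finset.single_le_sum (f := fun g => ENNReal.ofReal D *
          ENNReal.ofReal (Real.exp (2 * t * dirForm κ (fun y => V (y + z)) (cube 0 R) g)))
          (fun _ _ => zero_le) hg
      _ ≤ _ := Finset.single_le_sum (f := fun z => ∑ g ∈ W, ENNReal.ofReal D *
          ENNReal.ofReal (Real.exp (2 * t * dirForm κ (fun y => V (y + z)) (cube 0 R) g)))
          (fun _ _ => zero_le) hz
  have hmeas : ∀ g, Measurable fun V : Lattice d → ℝ =>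
      ENNReal.ofReal (Real.exp (2 * t * dirForm κ V (cube 0 R) g)) := by
    intro g
    simp only [dirForm]
    fun_prop
  have hmeas' : ∀ g z, Measurable fun V : Lattice d → ℝ => ENNReal.ofReal D *
      ENNReal.ofReal (Real.exp (2 * t * dirForm κ (fun y => V (y + z)) (cube 0 R) g)) :=
    fun g z => ((hmeas g).comp (measurePreserving_shift μ z).measurable).const_mul _
  refine (lintegral_mono hpt).trans ?_
  rw [lintegral_finsetSum _ fun z _ => ?_]
  swap
  · exact Finset.measurable_sum _ fun g _ => hmeas' g z
  have hz : ∀ z ∈ cube (0 : Lattice d) (ϱ + R), ∫⁻ V, ∑ g ∈ W, ENNReal.ofReal D *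
        ENNReal.ofReal (Real.exp (2 * t * dirForm κ (fun y => V (y + z)) (cube 0 R) g))
        ∂(fieldMeasure d μ) ≤ ENNReal.ofReal (W.card * (D * A)) := by
    intro z _
    rw [lintegral_finsetSum _ fun g _ => hmeas' g z]
    calc _ ≤ ∑ g ∈ W, ENNReal.ofReal (D * A) := by
          refine Finset.sum_le_sum fun g hg => ?_
          rw [lintegral_const_mul' _ _ ENNReal.ofReal_ne_top,
            (measurePreserving_shift μ z).lintegral_comp (hmeas g),
            ENNReal.ofReal_mul (p := D) (q := A) (by positivity)]
          exact mul_le_mul' le_rfl (ht g hg)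
      _ = _ := by
          rw [Finset.sum_const, nsmul_eq_mul, ENNReal.ofReal_mul (Nat.cast_nonneg _),
            ENNReal.ofReal_natCast]
  refine (Finset.sum_le_sum hz).trans (le_of_eq ?_)
  rw [Finset.sum_const, nsmul_eq_mul, card_cube, ← ENNReal.ofReal_natCast,
    ← ENNReal.ofReal_mul (Nat.cast_nonneg _)]
  congr 1
  have : Real.exp (δ * t + H (2 * t) - 2 * H t)
      = Real.exp (δ / 2 * t) * Real.exp (δ / 2 * t + H (2 * t) - 2 * H t) := by
    rw [← Real.exp_add]
    ring_nf
  rw [this, hA, hD]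
  push_cast
  ring

end Moments

end PAM

namespace PAM

open scoped ENNReal

/-! ### A weak law of large numbers under sparse dependence -/

section WeakLaw

variable {Ω : Type*} [MeasurableSpace Ω] {P : Measure Ω} [IsProbabilityMeasure P]

/-- Only neighbouring pairs have a covariance. It is at most `S` by ab ≤ (a² + b²)/2, the product of
the nonnegative means being discarded. -/
theorem variance_sum_le_of_sparse {ι : Type*} {Q : Finset ι} {Z : ι → Ω → ℝ}
    (hZ : ∀ x ∈ Q, MemLp (Z x) 2 P) (hZ0 : ∀ x ω, 0 ≤ Z x ω) {S : ℝ} (hS0 : 0 ≤ S)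
    (hS : ∀ x ∈ Q, ∫ ω, Z x ω ^ 2 ∂P ≤ S) (nbr : ι → Finset ι) {D : ℕ}
    (hD : ∀ x ∈ Q, (nbr x).card ≤ D)
    (hind : ∀ x ∈ Q, ∀ y ∈ Q, y ∉ nbr x → IndepFun (Z x) (Z y) P) :
    variance (fun ω => ∑ x ∈ Q, Z x ω) P ≤ Q.card * (D * S) := by
  classical
  rw [variance_fun_sum' hZ]
  have hcov : ∀ x ∈ Q, ∀ y ∈ Q, covariance (Z x) (Z y) P ≤ S := by
    intro x hx y hy
    rw [covariance_eq_sub (hZ x hx) (hZ y hy)]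
    have h1 : 0 ≤ ∫ ω, Z x ω ∂P := integral_nonneg (hZ0 x)
    have h2 : 0 ≤ ∫ ω, Z y ω ∂P := integral_nonneg (hZ0 y)
    have h3 : ∫ ω, (Z x * Z y) ω ∂P ≤ ∫ ω, (Z x ω ^ 2 / 2 + Z y ω ^ 2 / 2) ∂P := by
      refine integral_mono ((hZ x hx).integrable_mul (hZ y hy))
        (((hZ x hx).integrable_sq.div_const 2).add ((hZ y hy).integrable_sq.div_const 2))
        fun ω => ?_
      simp only [Pi.mul_apply]
      nlinarith [sq_nonneg (Z x ω - Z y ω)]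
    rw [integral_add ((hZ x hx).integrable_sq.div_const 2) ((hZ y hy).integrable_sq.div_const 2),
      integral_div, integral_div] at h3
    have h4 := hS x hx
    have h5 := hS y hy
    have h6 := mul_nonneg h1 h2
    linarith
  calc ∑ x ∈ Q, ∑ y ∈ Q, covariance (Z x) (Z y) P
      ≤ ∑ x ∈ Q, ∑ y ∈ Q, (if y ∈ nbr x then S else 0) := by
        refine Finset.sum_le_sum fun x hx => Finset.sum_le_sum fun y hy => ?_
        split_ifs with h
        · exact hcov x hx y hy
        · exact ((hind x hx y hy h).covariance_eq_zero (hZ x hx) (hZ y hy)).le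
    _ ≤ ∑ x ∈ Q, (D * S : ℝ) := by
        refine Finset.sum_le_sum fun x hx => ?_
        rw [← Finset.sum_filter, Finset.sum_const, nsmul_eq_mul]
        refine mul_le_mul_of_nonneg_right ?_ hS0
        have : (Q.filter fun y => y ∈ nbr x).card ≤ (nbr x).card :=
          Finset.card_le_card fun y hy => (Finset.mem_filter.1 hy).2
        exact_mod_cast this.trans (hD x hx)
    _ = _ := by rw [Finset.sum_const, nsmul_eq_mul]

/-- A weak law of large numbers with a rate, for variables with sparse dependence and a finite
moment of order `p ∈ (1, 2]`. -/
theorem measure_abs_sum_sub_le_of_sparse {ι : Type*} {Q : Finset ι} (hQ : Q.Nonempty)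
    {Y : ι → Ω → ℝ} (hYm : ∀ x, Measurable (Y x)) (hY0 : ∀ x ω, 0 ≤ Y x ω) {p : ℝ} (hp1 : 1 < p)
    (hp2 : p ≤ 2) (hYi : ∀ x ∈ Q, Integrable (Y x) P)
    (hYp : ∀ x ∈ Q, Integrable (fun ω => Y x ω ^ p) P) {m M : ℝ} (hm : 0 < m)
    (hmean : ∀ x ∈ Q, ∫ ω, Y x ω ∂P = m) (hM : ∀ x ∈ Q, ∫ ω, Y x ω ^ p ∂P ≤ M)
    (nbr : ι → Finset ι) {D : ℕ} (hD1 : 1 ≤ D) (hD : ∀ x ∈ Q, (nbr x).card ≤ D)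
    (hind : ∀ x ∈ Q, ∀ y ∈ Q, y ∉ nbr x → IndepFun (Y x) (Y y) P) {ε : ℝ} (hε0 : 0 < ε)
    (hε1 : ε ≤ 1) :
    P {ω | ε * (Q.card * m) < |∑ x ∈ Q, Y x ω - Q.card * m|}
      ≤ ENNReal.ofReal (7 / ε ^ 2 * D * ((Q.card : ℝ) ^ (1 - p) * M / m ^ p)) := by
  set N : ℝ := (Q.card : ℝ) with hN
  have hN0 : 0 < N := by rw [hN]; exact_mod_cast hQ.card_pos
  have hM0 : 0 ≤ M := by
    obtain ⟨x, hx⟩ := hQ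
    exact (integral_nonneg fun ω => Real.rpow_nonneg (hY0 x ω) p).trans (hM x hx)
  set L : ℝ := N * m with hL
  have hL0 : 0 < L := by positivity
  -- This is N M / L^p, Markov's bound for the event that one variable exceeds the expected total
  -- `L`, where truncation takes place.
  set q : ℝ := N ^ (1 - p) * M / m ^ p with hq
  have hq0 : 0 ≤ q := by positivity
  have hD1' : (1 : ℝ) ≤ D := by exact_mod_cast hD1
  have hε2 : ε ^ 2 ≤ ε := by nlinarith
  -- The 4 comes from Chebyshev's inequality at level ε/2; the remaining 3 absorbs the probability
  -- `q` that truncation matters.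
  have hC : 1 + 4 / ε ^ 2 * D ≤ 7 / ε ^ 2 * D := by
    have : 1 ≤ 3 / ε ^ 2 * D := by
      have : 1 ≤ 3 / ε ^ 2 := by rw [le_div_iff₀ (by positivity)]; nlinarith
      nlinarith
    have e : 7 / ε ^ 2 * (D : ℝ) = 3 / ε ^ 2 * D + 4 / ε ^ 2 * D := by ring
    linarith
  -- In this case the asserted bound exceeds 1.
  by_cases hqε : ε / 2 < q
  · refine prob_le_one.trans ?_
    rw [← ENNReal.ofReal_one]
    refine ENNReal.ofReal_le_ofReal ?_
    have h1 : 1 ≤ 7 / ε ^ 2 * (ε / 2) := by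
      rw [div_mul_eq_mul_div, le_div_iff₀ (by positivity)]
      nlinarith
    calc (1 : ℝ) ≤ 7 / ε ^ 2 * (ε / 2) := h1
      _ ≤ 7 / ε ^ 2 * D * q := by
        have : 7 / ε ^ 2 ≤ 7 / ε ^ 2 * D := le_mul_of_one_le_right (by positivity) hD1'
        gcongr
  push Not at hqε
  have hLp : L ^ p = N * m ^ p / N ^ (1 - p) := by
    rw [hL, Real.mul_rpow hN0.le hm.le, Real.rpow_sub hN0, Real.rpow_one]
    field_simp
  have hML : M / L ^ p = q / N := by
    rw [hLp, hq]
    field_simp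
  set Z : ι → Ω → ℝ := fun x ω => if Y x ω ≤ L then Y x ω else 0 with hZ
  have hZm : ∀ x, Measurable (Z x) := fun x =>
    Measurable.ite (measurableSet_le (hYm x) measurable_const) (hYm x) measurable_const
  have hZ0 : ∀ x ω, 0 ≤ Z x ω := fun x ω => by
    simp only [hZ]; split_ifs; exacts [hY0 x ω, le_rfl]
  have hZL : ∀ x ω, Z x ω ≤ L := fun x ω => by
    simp only [hZ]; split_ifs with h; exacts [h, hL0.le]
  have hZ2 : ∀ x, MemLp (Z x) 2 P := fun x =>
    MemLp.of_bound (hZm x).aestronglyMeasurable L (Eventually.of_forall fun ω => by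
      rw [Real.norm_eq_abs, abs_of_nonneg (hZ0 x ω)]; exact hZL x ω)
  have hLpow : L ^ (2 - p) = L ^ 2 / L ^ p := by
    rw [Real.rpow_sub hL0, Real.rpow_two]
  have hZsq : ∀ x ω, Z x ω ^ 2 ≤ L ^ (2 - p) * Y x ω ^ p := by
    intro x ω
    simp only [hZ]
    split_ifs with h
    · rcases (hY0 x ω).eq_or_lt with h0 | h0
      · rw [← h0]
        simp only [ne_eq, OfNat.ofNat_ne_zero, not_false_eq_true, zero_pow]
        positivity
      · calc Y x ω ^ 2 = Y x ω ^ (2 - p) * Y x ω ^ p := by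
              rw [← Real.rpow_add h0, ← Real.rpow_two]
              congr 1; ring
          _ ≤ _ := by
              gcongr
    · have := hY0 x ω
      simp only [ne_eq, OfNat.ofNat_ne_zero, not_false_eq_true, zero_pow]
      positivity
  set S : ℝ := L ^ (2 - p) * M with hS
  have hSle : ∀ x ∈ Q, ∫ ω, Z x ω ^ 2 ∂P ≤ S := by
    intro x hx
    calc ∫ ω, Z x ω ^ 2 ∂P ≤ ∫ ω, L ^ (2 - p) * Y x ω ^ p ∂P :=
          integral_mono (hZ2 x).integrable_sq ((hYp x hx).const_mul _) (hZsq x)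
      _ = L ^ (2 - p) * ∫ ω, Y x ω ^ p ∂P := integral_const_mul _ _
      _ ≤ S := mul_le_mul_of_nonneg_left (hM x hx) (by positivity)
  have hvar : variance (fun ω => ∑ x ∈ Q, Z x ω) P ≤ N * (D * S) :=
    variance_sum_le_of_sparse (fun x _ => hZ2 x) hZ0 (by positivity) hSle nbr hD fun x hx y hy h =>
      (hind x hx y hy h).comp (φ := fun a => if a ≤ L then a else 0)
        (ψ := fun a => if a ≤ L then a else 0)
        (Measurable.ite measurableSet_Iic measurable_id measurable_const)
        (Measurable.ite measurableSet_Iic measurable_id measurable_const)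
  -- Truncation lowers each mean by at most m q, which is at most half of the allowed deviation
  -- since q ≤ ε/2.
  have hgap : ∀ x ∈ Q, m - ∫ ω, Z x ω ∂P ≤ m * q := by
    intro x hx
    have hZi := (hZ2 x).integrable one_le_two
    rw [← hmean x hx, ← integral_sub (hYi x hx) hZi, hmean x hx]
    calc ∫ ω, (Y x ω - Z x ω) ∂P ≤ ∫ ω, L / L ^ p * Y x ω ^ p ∂P := by
          refine integral_mono ((hYi x hx).sub hZi) ((hYp x hx).const_mul _) fun ω => ?_
          simp only [hZ]
          split_ifs with h
          · rw [sub_self]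
            have := hY0 x ω
            positivity
          · push Not at h
            rw [sub_zero, div_mul_eq_mul_div, le_div_iff₀ (by positivity)]
            have hY : 0 < Y x ω := hL0.trans h
            calc Y x ω * L ^ p = Y x ω * (L ^ (p - 1) * L) := by
                  rw [← Real.rpow_add_one hL0.ne']; ring_nf
              _ ≤ Y x ω * (Y x ω ^ (p - 1) * L) := by
                  have : L ^ (p - 1) ≤ Y x ω ^ (p - 1) :=
                    Real.rpow_le_rpow hL0.le h.le (by linarith)
                  gcongr
              _ = L * Y x ω ^ p := by
                  have : Y x ω ^ p = Y x ω ^ (p - 1) * Y x ω := by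
                    rw [← Real.rpow_add_one hY.ne']; ring_nf
                  rw [this]; ring
      _ = L / L ^ p * ∫ ω, Y x ω ^ p ∂P := integral_const_mul _ _
      _ ≤ L / L ^ p * M := by gcongr; exact hM x hx
      _ = L * (M / L ^ p) := by ring
      _ = m * q := by rw [hML, hL]; field_simp
  have hgap0 : ∀ x ∈ Q, ∫ ω, Z x ω ∂P ≤ m := by
    intro x hx
    rw [← hmean x hx]
    refine integral_mono ((hZ2 x).integrable one_le_two) (hYi x hx) fun ω => ?_
    simp only [hZ]; split_ifs; exacts [le_rfl, hY0 x ω]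
  set W : Ω → ℝ := fun ω => ∑ x ∈ Q, Z x ω with hW
  have hW2 : MemLp W 2 P := memLp_finsetSum _ fun x _ => hZ2 x
  have hWmean : ∫ ω, W ω ∂P = ∑ x ∈ Q, ∫ ω, Z x ω ∂P :=
    integral_finsetSum _ fun x _ => (hZ2 x).integrable one_le_two
  have hWle : ∫ ω, W ω ∂P ≤ N * m := by
    rw [hWmean]
    calc _ ≤ ∑ x ∈ Q, m := Finset.sum_le_sum hgap0
      _ = _ := by rw [Finset.sum_const, nsmul_eq_mul]
  have hWge : N * m - N * (m * q) ≤ ∫ ω, W ω ∂P := by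
    rw [hWmean]
    calc N * m - N * (m * q) = ∑ x ∈ Q, (m - m * q) := by
          rw [Finset.sum_const, nsmul_eq_mul]; ring
      _ ≤ _ := Finset.sum_le_sum fun x hx => by linarith [hgap x hx]
  have hsub : {ω | ε * (N * m) < |∑ x ∈ Q, Y x ω - N * m|}
      ⊆ {ω | ε / 2 * (N * m) ≤ |W ω - ∫ ω, W ω ∂P|} ∪ ⋃ x ∈ Q, {ω | L < Y x ω} := by
    intro ω hω
    by_contra hcon
    simp only [Set.mem_union, Set.mem_iUnion, not_or, not_exists, Set.mem_ofPred_eq, not_lt,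
      not_le] at hcon hω
    obtain ⟨hc1, hc2⟩ := hcon
    have hWY : W ω = ∑ x ∈ Q, Y x ω := by
      refine Finset.sum_congr rfl fun x hx => ?_
      simp only [hZ, hc2 x hx, if_true]
    rw [← hWY] at hω
    rw [abs_lt] at hc1
    have h1 : N * (m * q) ≤ ε / 2 * (N * m) := by
      have := mul_le_mul_of_nonneg_left hqε (by positivity : 0 ≤ N * m)
      nlinarith
    have : |W ω - N * m| ≤ ε * (N * m) := by
      rw [abs_le]
      constructor <;> linarith
    linarith
  have hcheb := meas_ge_le_variance_div_sq hW2 (c := ε / 2 * (N * m)) (by positivity)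
  have hmark : ∀ x ∈ Q, P {ω | L < Y x ω} ≤ ENNReal.ofReal (q / N) := by
    intro x hx
    have h1 := meas_ge_le_lintegral_div (μ := P) (f := fun ω => ENNReal.ofReal (Y x ω ^ p))
      ((hYm x).pow_const p).ennreal_ofReal.aemeasurable (ε := ENNReal.ofReal (L ^ p))
      (by simp only [ne_eq, ENNReal.ofReal_eq_zero, not_le]; positivity) ENNReal.ofReal_ne_top
    refine (measure_mono fun ω hω => ?_).trans (h1.trans ?_)
    · exact ENNReal.ofReal_le_ofReal (Real.rpow_le_rpow hL0.le (le_of_lt hω) (by linarith))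
    · rw [← ofReal_integral_eq_lintegral_ofReal (hYp x hx) (Eventually.of_forall fun ω =>
        Real.rpow_nonneg (hY0 x ω) p), ← ENNReal.ofReal_div_of_pos (by positivity), ← hML]
      refine ENNReal.ofReal_le_ofReal ?_
      gcongr
      exact hM x hx
  refine (measure_mono hsub).trans ((measure_union_le _ _).trans ?_)
  refine (add_le_add hcheb ((measure_biUnion_finset_le _ _).trans (Finset.sum_le_sum hmark))).trans
    ?_
  rw [Finset.sum_const, nsmul_eq_mul, ← ENNReal.ofReal_natCast,
    ← ENNReal.ofReal_mul (Nat.cast_nonneg _), ← ENNReal.ofReal_add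
      (div_nonneg (variance_nonneg _ _) (by positivity)) (by positivity)]
  refine ENNReal.ofReal_le_ofReal ?_
  have h1 : variance W P / (ε / 2 * (N * m)) ^ 2 ≤ 4 / ε ^ 2 * D * q := by
    rw [div_le_iff₀ (by positivity)]
    refine hvar.trans (le_of_eq ?_)
    have : S = L ^ 2 * (q / N) := by rw [hS, hLpow, ← hML]; ring
    rw [this, hL]
    field_simp
    ring
  have h2 : N * (q / N) = q := by field_simp
  rw [← hN, h2]
  calc variance W P / (ε / 2 * (N * m)) ^ 2 + q ≤ 4 / ε ^ 2 * D * q + q := by linarith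
    _ = (1 + 4 / ε ^ 2 * D) * q := by ring
    _ ≤ 7 / ε ^ 2 * D * q := by gcongr

end WeakLaw

end PAM

namespace PAM

open scoped ENNReal

/-! ### Concentration of the spatial sum at a fixed time -/

section Concentration

variable {d : ℕ} {κ : ℝ} {μ : Measure ℝ} [IsProbabilityMeasure μ]

theorem indepFun_fk [NeZero d] (hκ : 0 < κ) (n : ℕ) {t : ℝ} (ht : 0 ≤ t) {x y : Lattice d}
    (hxy : y ∉ cube x (2 * n)) :
    IndepFun (fun V => (fk n κ V t x).toReal) (fun V => (fk n κ V t y).toReal)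
      (fieldMeasure d μ) := by
  classical
  have hdisj : Disjoint (cube x n) (cube y n) := by
    rw [Finset.disjoint_left]
    intro z hz hz'
    exact hxy (cube_subset_cube hz (by omega) (mem_cube_comm.1 hz'))
  have hind := (iIndepFun_infinitePi (P := fun _ : Lattice d => μ) (X := fun _ a => a)
    fun _ => measurable_id).indepFun_finset (cube x n) (cube y n) hdisj
      fun i => measurable_pi_apply i
  -- Extension by zero of a configuration on the cube around `z`. By locality the truncated
  -- functional does not see the values outside, so it factors through the cube.
  set E : (z : Lattice d) → (cube z n → ℝ) → Lattice d → ℝ := fun z v w =>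
    if h : w ∈ cube z n then v ⟨w, h⟩ else 0 with hE
  have hEm : ∀ z, Measurable (E z) := by
    intro z
    refine measurable_pi_lambda _ fun w => ?_
    by_cases h : w ∈ cube z n
    · simp only [hE, h, dif_pos]
      exact measurable_pi_apply _
    · simp only [hE, h, dif_neg, not_false_eq_true]
      exact measurable_const
  have heq : ∀ z, (fun V => (fk n κ V t z).toReal)
      = (fun v => (fk n κ (E z v) t z).toReal) ∘ fun (V : Lattice d → ℝ) (i : cube z n) => V i := by
    intro z
    funext V
    simp only [Function.comp]
    congr 1
    refine fk_congr n hκ ht z fun w hw => ?_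
    simp only [hE, mem_cube.2 hw, dif_pos]
  rw [heq x, heq y]
  exact hind.comp (((measurable_fk n κ t x).comp (hEm x)).ennreal_toReal)
    (((measurable_fk n κ t y).comp (hEm y)).ennreal_toReal)

theorem fk_le_fk_top [NeZero d] (n : ℕ) (κ : ℝ) (V : Lattice d → ℝ) (t : ℝ) (x : Lattice d) :
    fk n κ V t x ≤ fk ⊤ κ V t x := by
  rw [fk_top_eq_add n]
  exact le_self_add

theorem ae_fk_ne_top [NeZero d] (hκ : 0 < κ)
    (hexp : ∀ t : ℝ, 0 ≤ t → Integrable (fun y => Real.exp (t * y)) μ) (n : ℕ) {t : ℝ}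
    (ht : 0 ≤ t) (x : Lattice d) : ∀ᵐ V ∂(fieldMeasure d μ), fk n κ V t x ≠ ∞ := by
  filter_upwards [ae_lt_top (measurable_fk ⊤ κ t x) (lintegral_fk_top_ne_top hκ hexp ht x)]
    with V hV
  exact ((fk_le_fk_top n κ V t x).trans_lt hV).ne

theorem integral_fk_toReal [NeZero d] (hκ : 0 < κ)
    (hexp : ∀ t : ℝ, 0 ≤ t → Integrable (fun y => Real.exp (t * y)) μ) (n : ℕ) {t : ℝ}
    (ht : 0 ≤ t) (x : Lattice d) :
    ∫ V, (fk n κ V t x).toReal ∂(fieldMeasure d μ)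
      = (∫⁻ V, fk n κ V t 0 ∂(fieldMeasure d μ)).toReal := by
  rw [integral_toReal (measurable_fk n κ t x).aemeasurable
    ((ae_fk_ne_top hκ hexp n ht x).mono fun V h => h.lt_top),
    lintegral_fk_eq_origin n κ (fun a => a) measurable_id]

/-- Concentration of the spatial sum of the Feynman-Kac functional over paths with few jumps. -/
theorem measure_abs_sum_fk_sub_le [NeZero d] (hκ : 0 < κ)
    (hexp : ∀ t : ℝ, 0 ≤ t → Integrable (fun y => Real.exp (t * y)) μ) (n : ℕ) {t : ℝ}
    (ht : 0 ≤ t) {p : ℝ} (hp1 : 1 < p) (hp2 : p ≤ 2) {m M : ℝ} (hm0 : 0 < m)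
    (hm : (∫⁻ V, fk n κ V t 0 ∂(fieldMeasure d μ)) = ENNReal.ofReal m) (hM0 : 0 ≤ M)
    (hM : (∫⁻ V, fk n κ V t 0 ^ p ∂(fieldMeasure d μ)) ≤ ENNReal.ofReal M) {ε : ℝ} (hε0 : 0 < ε)
    (hε1 : ε ≤ 1) (r : ℕ) :
    fieldMeasure d μ {V | ε * ((2 * r + 1) ^ d * m)
        < |∑ x ∈ cube 0 r, (fk n κ V t x).toReal - (2 * r + 1) ^ d * m|}
      ≤ ENNReal.ofReal (7 / ε ^ 2 * (4 * n + 1) ^ d *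
        (((2 * r + 1) ^ d : ℝ) ^ (1 - p) * M / m ^ p)) := by
  have hcard : ((cube (0 : Lattice d) r).card : ℝ) = (2 * r + 1) ^ d := by
    rw [card_cube]; push_cast; rfl
  have hYm : ∀ x, Measurable fun V : Lattice d → ℝ => (fk n κ V t x).toReal := fun x =>
    (measurable_fk n κ t x).ennreal_toReal
  have hlin : ∀ x, ∫⁻ V, fk n κ V t x ∂(fieldMeasure d μ) = ENNReal.ofReal m := fun x => by
    rw [← hm]; exact lintegral_fk_eq_origin n κ (fun a => a) measurable_id t x
  have hlinp : ∀ x, ∫⁻ V, ENNReal.ofReal ((fk n κ V t x).toReal ^ p) ∂(fieldMeasure d μ)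
      ≤ ENNReal.ofReal M := by
    intro x
    refine le_trans (lintegral_mono fun V => ?_) ((lintegral_fk_eq_origin n κ (fun a => a ^ p)
      (measurable_id.pow_const p) t x).le.trans hM)
    rw [← ENNReal.ofReal_rpow_of_nonneg ENNReal.toReal_nonneg (by linarith)]
    gcongr
    exact ENNReal.ofReal_toReal_le
  have hpint : ∀ x, Integrable (fun V : Lattice d → ℝ => (fk n κ V t x).toReal ^ p)
      (fieldMeasure d μ) := by
    intro x
    refine ⟨((hYm x).pow_const p).aestronglyMeasurable, ?_⟩
    rw [hasFiniteIntegral_iff_ofReal (Eventually.of_forall fun V =>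
      Real.rpow_nonneg ENNReal.toReal_nonneg p)]
    exact (hlinp x).trans_lt ENNReal.ofReal_lt_top
  have h := measure_abs_sum_sub_le_of_sparse (P := fieldMeasure d μ)
    (cube_nonempty (0 : Lattice d) r) (Y := fun x V => (fk n κ V t x).toReal) hYm
    (fun _ _ => ENNReal.toReal_nonneg) hp1 hp2
    (fun x _ => integrable_toReal_of_lintegral_ne_top (measurable_fk n κ t x).aemeasurable
      (by rw [hlin x]; exact ENNReal.ofReal_ne_top))
    (fun x _ => hpint x) hm0
    (fun x _ => by rw [integral_fk_toReal hκ hexp n ht x, hm, ENNReal.toReal_ofReal hm0.le])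
    (M := M) (fun x _ => by
      rw [← ENNReal.ofReal_le_ofReal_iff hM0, ofReal_integral_eq_lintegral_ofReal (hpint x)
        (Eventually.of_forall fun V => Real.rpow_nonneg ENNReal.toReal_nonneg p)]
      exact hlinp x)
    (fun x => cube x (2 * n)) (D := (4 * n + 1) ^ d) (Nat.one_le_pow _ _ (by omega))
    (fun x _ => by rw [card_cube]; exact le_of_eq (by ring_nf))
    (fun x _ y _ hxy => indepFun_fk hκ n ht hxy) hε0 hε1
  rw [hcard] at h
  push_cast at h
  exact h

/-- A number of jumps that is exceeded with negligible contribution. -/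
noncomputable def cutoff (d : ℕ) (κ t : ℝ) : ℕ := ⌈(6 * d * κ + 2) * t⌉₊ + 1

theorem le_cutoff (d : ℕ) (κ t : ℝ) : (6 * d * κ + 2) * t ≤ cutoff d κ t := by
  rw [cutoff]
  push_cast
  linarith [Nat.le_ceil ((6 * d * κ + 2) * t)]

theorem cutoff_le (d : ℕ) {κ t : ℝ} (hκ : 0 ≤ κ) (ht : 0 ≤ t) :
    (cutoff d κ t : ℝ) ≤ (6 * d * κ + 2) * t + 2 := by
  rw [cutoff]
  push_cast
  linarith [(Nat.ceil_lt_add_one (by positivity : 0 ≤ (6 * d * κ + 2) * t))]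

theorem lintegral_fkRest_cutoff_le [NeZero d] (hκ : 0 < κ)
    (hexp : ∀ t : ℝ, 0 ≤ t → Integrable (fun y => Real.exp (t * y)) μ) {t : ℝ} (ht : 0 ≤ t)
    (x : Lattice d) :
    ∫⁻ V, fkRest (cutoff d κ t) κ V t x ∂(fieldMeasure d μ)
      ≤ ENNReal.ofReal (Real.exp (-(2 * t)) * meanFK d κ μ t) := by
  refine (lintegral_fkRest_le μ hκ x ht (n := cutoff d κ t) (by simp [cutoff])).trans ?_
  rw [lintegral_exp_mul hexp ht, ← ENNReal.ofReal_mul (Real.exp_pos _).le, ← Real.exp_add]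
  refine ENNReal.ofReal_le_ofReal ?_
  refine le_trans ?_ (mul_le_mul_of_nonneg_left (exp_cgf_sub_le_meanFK hκ hexp ht)
    (Real.exp_pos _).le)
  rw [← Real.exp_add, Real.exp_le_exp]
  -- Since e ≤ 3, the slope 6dκ + 2 of the cutoff leaves the exponent at most -2dκt - 2t. The part
  -- -2dκt is used up by the lower bound for the mean, and e^{-2t} remains.
  have h1 := le_cutoff d κ t
  have h2 : Real.exp 1 * (2 * d * κ * t) ≤ 3 * (2 * d * κ * t) :=
    mul_le_mul_of_nonneg_right (Real.exp_one_lt_d9.le.trans (by norm_num)) (by positivity)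
  nlinarith

theorem exists_truncated_mean [NeZero d] (hκ : 0 < κ)
    (hexp : ∀ t : ℝ, 0 ≤ t → Integrable (fun y => Real.exp (t * y)) μ) {t : ℝ} (ht : 0 ≤ t) :
    ∃ m : ℝ, ∫⁻ V, fk (cutoff d κ t) κ V t 0 ∂(fieldMeasure d μ) = ENNReal.ofReal m ∧
      m ≤ meanFK d κ μ t ∧ (1 - Real.exp (-(2 * t))) * meanFK d κ μ t ≤ m := by
  have hle : ∫⁻ V, fk (cutoff d κ t) κ V t 0 ∂(fieldMeasure d μ)
      ≤ ENNReal.ofReal (meanFK d κ μ t) := by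
    rw [← lintegral_fk_top hκ hexp ht 0]
    exact lintegral_mono fun V => fk_le_fk_top _ κ V t 0
  have hfin := (hle.trans_lt ENNReal.ofReal_lt_top).ne
  refine ⟨(∫⁻ V, fk (cutoff d κ t) κ V t 0 ∂(fieldMeasure d μ)).toReal,
    (ENNReal.ofReal_toReal hfin).symm, ?_, ?_⟩
  · exact ENNReal.toReal_le_of_le_ofReal (meanFK_nonneg κ μ t) hle
  · have h1 := lintegral_fk_top hκ hexp ht (0 : Lattice d)
    simp_rw [fk_top_eq_add (cutoff d κ t)] at h1
    rw [lintegral_add_left (measurable_fk _ κ t 0), ← ENNReal.ofReal_toReal hfin] at h1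
    have h2 := h1.symm.le.trans (add_le_add_right (lintegral_fkRest_cutoff_le hκ hexp ht 0) _)
    have h3 : 0 ≤ Real.exp (-(2 * t)) * meanFK d κ μ t :=
      mul_nonneg (Real.exp_pos _).le (meanFK_nonneg κ μ t)
    rw [← ENNReal.ofReal_add ENNReal.toReal_nonneg h3, ENNReal.ofReal_le_ofReal_iff
      (add_nonneg ENNReal.toReal_nonneg h3)] at h2
    linarith

theorem measure_sum_fkRest_le [NeZero d] (hκ : 0 < κ)
    (hexp : ∀ t : ℝ, 0 ≤ t → Integrable (fun y => Real.exp (t * y)) μ) {t : ℝ} (ht : 0 ≤ t)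
    {ε : ℝ} (hε : 0 < ε) (r : ℕ) :
    fieldMeasure d μ {V | ENNReal.ofReal (ε * ((2 * r + 1) ^ d * meanFK d κ μ t))
        ≤ ∑ x ∈ cube 0 r, fkRest (cutoff d κ t) κ V t x}
      ≤ ENNReal.ofReal (Real.exp (-(2 * t)) / ε) := by
  have hφ := meanFK_pos (d := d) hκ hexp ht
  have hm : ∀ x, AEMeasurable (fun V : Lattice d → ℝ => fkRest (cutoff d κ t) κ V t x)
      (fieldMeasure d μ) := by
    intro x
    have h1 : Measurable fun V : Lattice d → ℝ =>
        fk ⊤ κ V t x - fk (cutoff d κ t) κ V t x :=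
      (measurable_fk _ κ t x).sub (measurable_fk _ κ t x)
    refine h1.aemeasurable.congr ?_
    filter_upwards [ae_fk_ne_top hκ hexp (cutoff d κ t) ht x] with V hV
    rw [fk_top_eq_add (cutoff d κ t), ENNReal.add_sub_cancel_left hV]
  refine (meas_ge_le_lintegral_div (Finset.aemeasurable_fun_sum _ fun x _ => hm x)
    (by simp only [ne_eq, ENNReal.ofReal_eq_zero, not_le]; positivity)
    ENNReal.ofReal_ne_top).trans ?_
  rw [lintegral_finsetSum' _ fun x _ => hm x]
  refine (ENNReal.div_le_div_right (Finset.sum_le_sum fun x _ =>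
    lintegral_fkRest_cutoff_le hκ hexp ht x) _).trans ?_
  rw [Finset.sum_const, nsmul_eq_mul, card_cube, ← ENNReal.ofReal_natCast,
    ← ENNReal.ofReal_mul (Nat.cast_nonneg _), ← ENNReal.ofReal_div_of_pos (by positivity)]
  refine ENNReal.ofReal_le_ofReal (le_of_eq ?_)
  push_cast
  field_simp

/-- Concentration around the untruncated mean. -/
theorem measure_abs_sum_fk_cutoff_sub_le [NeZero d] (hκ : 0 < κ)
    (hexp : ∀ t : ℝ, 0 ≤ t → Integrable (fun y => Real.exp (t * y)) μ) {t : ℝ}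
    (ht : 0 ≤ t) {p : ℝ} (hp1 : 1 < p) (hp2 : p ≤ 2) {M : ℝ} (hM0 : 0 ≤ M)
    (hM : (∫⁻ V, fk (cutoff d κ t) κ V t 0 ^ p ∂(fieldMeasure d μ)) ≤ ENNReal.ofReal M) {ε : ℝ}
    (hε0 : 0 < ε) (hε1 : ε ≤ 1) (htε : Real.exp (-(2 * t)) ≤ ε / 2) (r : ℕ) :
    fieldMeasure d μ {V | ε * ((2 * r + 1) ^ d * meanFK d κ μ t)
        < |∑ x ∈ cube 0 r, (fk (cutoff d κ t) κ V t x).toReal - (2 * r + 1) ^ d * meanFK d κ μ t|}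
      ≤ ENNReal.ofReal (112 / ε ^ 2 * (4 * cutoff d κ t + 1) ^ d *
        (((2 * r + 1) ^ d : ℝ) ^ (1 - p) * M / meanFK d κ μ t ^ p)) := by
  set φ := meanFK d κ μ t
  have hφ : 0 < φ := meanFK_pos (d := d) hκ hexp ht
  obtain ⟨m, hm, hmφ, hφm⟩ := exists_truncated_mean (d := d) hκ hexp ht
  have hm2 : φ / 2 ≤ m := by nlinarith
  have hm0 : 0 < m := by linarith
  have hN : (0 : ℝ) < (2 * r + 1) ^ d := by positivity
  refine (measure_mono fun V hV => ?_).trans ((measure_abs_sum_fk_sub_le hκ hexp (cutoff d κ t) ht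
    hp1 hp2 hm0 hm hM0 hM (half_pos hε0) (by linarith) r).trans (ENNReal.ofReal_le_ofReal ?_))
  · simp only [Set.mem_ofPred_eq] at hV ⊢
    set S := ∑ x ∈ cube 0 r, (fk (cutoff d κ t) κ V t x).toReal
    set N : ℝ := (2 * r + 1) ^ d
    have h1 : |S - N * φ| ≤ |S - N * m| + N * (φ - m) := by
      have := abs_sub_le S (N * m) (N * φ)
      rw [abs_sub_comm (N * m), abs_of_nonneg (by nlinarith : 0 ≤ N * φ - N * m)] at this
      linarith
    have h2 : N * (φ - m) ≤ N * (ε / 2 * φ) :=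
      mul_le_mul_of_nonneg_left (by nlinarith) hN.le
    have h3 : N * (ε / 2 * m) ≤ N * (ε / 2 * φ) :=
      mul_le_mul_of_nonneg_left (by nlinarith) hN.le
    nlinarith
  · have h1 : φ ^ p / 4 ≤ m ^ p := by
      calc φ ^ p / 4 ≤ φ ^ p / 2 ^ p := by
            gcongr
            calc (2 : ℝ) ^ p ≤ 2 ^ (2 : ℝ) := Real.rpow_le_rpow_of_exponent_le one_le_two hp2
              _ = 4 := by norm_num
        _ = (φ / 2) ^ p := (Real.div_rpow hφ.le zero_le_two p).symm
        _ ≤ m ^ p := Real.rpow_le_rpow (by positivity) hm2 (by linarith)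
    have h2 : ((2 * r + 1) ^ d : ℝ) ^ (1 - p) * M / m ^ p
        ≤ 4 * (((2 * r + 1) ^ d : ℝ) ^ (1 - p) * M / φ ^ p) := by
      calc _ ≤ ((2 * r + 1) ^ d : ℝ) ^ (1 - p) * M / (φ ^ p / 4) := by gcongr
        _ = _ := by field_simp
    -- 112 = 7 · 4 · 4: one factor 4 from halving ε, one from replacing `m` by φ/2, since 2^p ≤ 4.
    calc _ ≤ 7 / (ε / 2) ^ 2 * (4 * (cutoff d κ t : ℝ) + 1) ^ d *
          (4 * (((2 * r + 1) ^ d : ℝ) ^ (1 - p) * M / φ ^ p)) := by gcongr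
      _ = _ := by field_simp; ring

theorem eventually_mul_pow_le_exp (C A B : ℝ) (hC : 0 ≤ C) (hA : 0 ≤ A) (hB : 0 ≤ B) (k : ℕ)
    {δ : ℝ} (hδ : 0 < δ) :
    ∀ᶠ t : ℝ in atTop, C * (A * t + B) ^ k ≤ Real.exp (δ * t) := by
  have h := (isLittleO_pow_exp_pos_mul_atTop k hδ).const_mul_left (C * (A + B) ^ k)
  filter_upwards [h.def one_pos, eventually_ge_atTop 1] with t h1 h2
  rw [one_mul, Real.norm_eq_abs, Real.norm_eq_abs, abs_of_nonneg (by positivity),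
    abs_of_nonneg (Real.exp_pos _).le] at h1
  refine le_trans ?_ h1
  rw [mul_assoc, ← mul_pow]
  gcongr
  nlinarith

theorem rpow_natPow_eq_exp (r d : ℕ) (p : ℝ) :
    ((2 * r + 1) ^ d : ℝ) ^ p = Real.exp (p * (d * Real.log (2 * r + 1))) := by
  rw [Real.rpow_def_of_pos (by positivity), Real.log_pow, mul_comm]

theorem eventually_exp_neg_le {ε : ℝ} (hε : 0 < ε) :
    ∀ᶠ t : ℝ in atTop, Real.exp (-(2 * t)) ≤ ε := by
  have h : Tendsto (fun t : ℝ => Real.exp (-(2 * t))) atTop (𝓝 0) :=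
    Real.tendsto_exp_neg_atTop_nhds_zero.comp (tendsto_id.const_mul_atTop two_pos)
  exact h.eventually_le_const hε

/-- The weak law with p = 2; the polynomial factors are absorbed by half of `δ`. As `δ` is
arbitrary, any exponential surplus of the volume over exp(H(2t) - 2H(t)) gives exponential decay. -/
theorem eventually_measure_le_secondMoment [NeZero d] (hκ : 0 < κ)
    (hexp : ∀ t : ℝ, 0 ≤ t → Integrable (fun y => Real.exp (t * y)) μ)
    (hH : AssumptionH (cgf id μ)) {ε δ : ℝ} (hε0 : 0 < ε) (hε1 : ε ≤ 1) (hδ : 0 < δ) :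
    ∀ᶠ t in atTop, ∀ r : ℕ,
      fieldMeasure d μ {V | ε * ((2 * r + 1) ^ d * meanFK d κ μ t)
        < |∑ x ∈ cube 0 r, (fk (cutoff d κ t) κ V t x).toReal - (2 * r + 1) ^ d * meanFK d κ μ t|}
      ≤ ENNReal.ofReal (Real.exp (δ * t + (cgf id μ (2 * t) - 2 * cgf id μ t)
          - d * Real.log (2 * r + 1))) := by
  obtain ⟨R, C, hC, hsq⟩ := exists_lintegral_fk_sq_le (d := d) hκ hexp hH (half_pos hδ)
  filter_upwards [hsq, eventually_exp_neg_le (half_pos hε0), eventually_ge_atTop 0,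
    eventually_mul_pow_le_exp (112 / ε ^ 2 * C) (4 * (6 * d * κ + 2)) (9 + 4 * R) (by positivity)
      (by positivity) (by positivity) (3 * d) (half_pos hδ)] with t h1 h2 h3 h4 r
  set φ := meanFK d κ μ t
  have hφ : 0 < φ := meanFK_pos (d := d) hκ hexp h3
  set n := cutoff d κ t with hn
  set x := cgf id μ (2 * t) - 2 * cgf id μ t with hx
  set M : ℝ := (2 * n + 1) ^ d * (2 * (n + R) + 1) ^ d * C *
    (Real.exp (δ / 2 * t + cgf id μ (2 * t) - 2 * cgf id μ t) * φ ^ 2) with hM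
  refine (measure_abs_sum_fk_cutoff_sub_le hκ hexp h3 one_lt_two le_rfl (M := M) (by positivity)
    (by simpa only [ENNReal.rpow_two] using h1 n) hε0 hε1 h2 r).trans (ENNReal.ofReal_le_ofReal ?_)
  have hexpx : Real.exp (δ / 2 * t + cgf id μ (2 * t) - 2 * cgf id μ t)
      = Real.exp (δ / 2 * t + x) := by rw [hx]; ring_nf
  have hnle := cutoff_le d hκ.le h3
  have hpoly : 112 / ε ^ 2 * C * ((4 * n + 1) ^ d * (2 * n + 1) ^ d * (2 * (n + R) + 1) ^ d)
      ≤ Real.exp (δ / 2 * t) := by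
    refine le_trans ?_ h4
    gcongr
    rw [pow_mul', pow_succ, pow_two]
    have e1 : 4 * (n : ℝ) + 1 ≤ 4 * (6 * d * κ + 2) * t + (9 + 4 * R) := by
      have : (0 : ℝ) ≤ R := Nat.cast_nonneg R
      linarith
    have e2 : 2 * (n : ℝ) + 1 ≤ 4 * (6 * d * κ + 2) * t + (9 + 4 * R) := by
      have : (0 : ℝ) ≤ n := Nat.cast_nonneg n
      linarith
    have e3 : 2 * ((n : ℝ) + R) + 1 ≤ 4 * (6 * d * κ + 2) * t + (9 + 4 * R) := by
      have : (0 : ℝ) ≤ n := Nat.cast_nonneg n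
      have : (0 : ℝ) ≤ R := Nat.cast_nonneg R
      linarith
    gcongr
  rw [rpow_natPow_eq_exp, hM, hexpx, Real.rpow_two]
  calc 112 / ε ^ 2 * (4 * (n : ℝ) + 1) ^ d * (Real.exp ((1 - 2) * (d * Real.log (2 * r + 1))) *
        ((2 * n + 1) ^ d * (2 * (n + R) + 1) ^ d * C * (Real.exp (δ / 2 * t + x) * φ ^ 2)) / φ ^ 2)
      = 112 / ε ^ 2 * C * ((4 * n + 1) ^ d * (2 * n + 1) ^ d * (2 * (n + R) + 1) ^ d) *
        (Real.exp ((1 - 2) * (d * Real.log (2 * r + 1))) * Real.exp (δ / 2 * t + x)) := by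
        field_simp
    _ ≤ Real.exp (δ / 2 * t) *
        (Real.exp ((1 - 2) * (d * Real.log (2 * r + 1))) * Real.exp (δ / 2 * t + x)) := by
        gcongr
    _ = _ := by
        rw [← Real.exp_add, ← Real.exp_add]
        ring_nf

/-- The weak law with p = 3/2, using only Jensen's inequality and the crude lower bound for the
mean, whence the loss 3dκt = (3/2)(2dκ)t. For volumes above the critical size the exponent gains
half of H(2t) + H(t) - 2H(3t/2), so the bound is strong where `H` is markedly convex. -/
theorem eventually_measure_le_fractionalMoment [NeZero d] (hκ : 0 < κ)
    (hexp : ∀ t : ℝ, 0 ≤ t → Integrable (fun y => Real.exp (t * y)) μ) {ε : ℝ} (hε0 : 0 < ε)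
    (hε1 : ε ≤ 1) :
    ∀ᶠ t in atTop, ∀ r : ℕ,
      fieldMeasure d μ {V | ε * ((2 * r + 1) ^ d * meanFK d κ μ t)
        < |∑ x ∈ cube 0 r, (fk (cutoff d κ t) κ V t x).toReal - (2 * r + 1) ^ d * meanFK d κ μ t|}
      ≤ ENNReal.ofReal (Real.exp ((3 * d * κ + 1) * t + (cgf id μ (3 / 2 * t) - 3 / 2 * cgf id μ t)
          - 1 / 2 * (d * Real.log (2 * r + 1)))) := by
  filter_upwards [eventually_exp_neg_le (half_pos hε0), eventually_ge_atTop 0,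
    eventually_mul_pow_le_exp (112 / ε ^ 2) (4 * (6 * d * κ + 2)) 9 (by positivity)
      (by positivity) (by positivity) d one_pos] with t h2 h3 h4 r
  set φ := meanFK d κ μ t
  have hφ : 0 < φ := meanFK_pos (d := d) hκ hexp h3
  set n := cutoff d κ t with hn
  have hmom : ∫⁻ V, fk n κ V t 0 ^ (3 / 2 : ℝ) ∂(fieldMeasure d μ)
      ≤ ENNReal.ofReal (Real.exp (cgf id μ (3 / 2 * t))) := by
    rw [← lintegral_exp_mul hexp (by positivity)]
    refine le_trans (lintegral_mono fun V => ?_)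
      (lintegral_fk_top_rpow_le μ hκ (0 : Lattice d) h3 (by norm_num))
    exact ENNReal.rpow_le_rpow (fk_le_fk_top n κ V t 0) (by norm_num)
  refine (measure_abs_sum_fk_cutoff_sub_le hκ hexp h3 (by norm_num) (by norm_num)
    (Real.exp_pos _).le hmom hε0 hε1 h2 r).trans (ENNReal.ofReal_le_ofReal ?_)
  have hpoly : 112 / ε ^ 2 * (4 * (n : ℝ) + 1) ^ d ≤ Real.exp (1 * t) := by
    refine le_trans ?_ h4
    have hnle := cutoff_le d hκ.le h3
    have e1 : 4 * (n : ℝ) + 1 ≤ 4 * (6 * d * κ + 2) * t + 9 := by linarith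
    gcongr
  have hφp : Real.exp (3 / 2 * (cgf id μ t - 2 * d * κ * t)) ≤ φ ^ (3 / 2 : ℝ) := by
    rw [mul_comm, Real.exp_mul]
    exact Real.rpow_le_rpow (Real.exp_pos _).le (exp_cgf_sub_le_meanFK hκ hexp h3) (by norm_num)
  rw [rpow_natPow_eq_exp]
  calc _ ≤ Real.exp (1 * t) * (Real.exp ((1 - 3 / 2) * (d * Real.log (2 * r + 1))) *
        Real.exp (cgf id μ (3 / 2 * t)) / Real.exp (3 / 2 * (cgf id μ t - 2 * d * κ * t))) := by
        gcongr
    _ = _ := by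
        rw [← Real.exp_add, ← Real.exp_sub, ← Real.exp_add]
        ring_nf

end Concentration

end PAM

namespace PAM

open scoped ENNReal

/-! ### Convex functions: doubling and control from a grid -/

section ConvexFunctions

theorem convexOn_sub_mul_le {S : Set ℝ} {f : ℝ → ℝ} (hf : ConvexOn ℝ S f) {x y z : ℝ} (hx : x ∈ S)
    (hz : z ∈ S) (hxy : x ≤ y) (hyz : y ≤ z) :
    (z - x) * f y ≤ (z - y) * f x + (y - x) * f z := by
  rcases (hxy.trans hyz).eq_or_lt with h | h
  · have h1 : y = x := le_antisymm (by linarith) hxy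
    have h2 : z = x := h.symm
    simp [h1, h2]
  · have h0 : 0 < z - x := by linarith
    have := hf.2 hx hz (div_nonneg (sub_nonneg.2 hyz) h0.le) (div_nonneg (sub_nonneg.2 hxy) h0.le)
      (by rw [← add_div, div_eq_one_iff_eq h0.ne']; ring)
    have e : ((z - y) / (z - x)) • x + ((y - x) / (z - x)) • z = y := by
      simp only [smul_eq_mul]
      field_simp
      ring
    rw [e, smul_eq_mul, smul_eq_mul, div_mul_eq_mul_div, div_mul_eq_mul_div, ← add_div,
      le_div_iff₀ h0] at this
    linarith

/-- Increments of a convex function grow to the right. -/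
theorem ConvexOn.sub_div_sub_le {S : Set ℝ} {f : ℝ → ℝ} (hf : ConvexOn ℝ S f) {a b x y : ℝ}
    (ha : a ∈ S) (hb : b ∈ S) (hx : x ∈ S) (hy : y ∈ S) (hab : a < b) (hxy : x < y) (hax : a ≤ x)
    (hby : b ≤ y) : (f b - f a) / (b - a) ≤ (f y - f x) / (y - x) := by
  have h1 := hf.secant_mono ha hb hy hab.ne' (hax.trans_lt hxy).ne' hby
  have h2 := hf.secant_mono hy ha hx (hax.trans_lt hxy).ne hxy.ne hax
  have e1 : (f y - f a) / (y - a) = (f a - f y) / (a - y) := by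
    rw [← neg_div_neg_eq]; congr 1 <;> ring
  have e2 : (f y - f x) / (y - x) = (f x - f y) / (x - y) := by
    rw [← neg_div_neg_eq]; congr 1 <;> ring
  rw [e2]
  exact h1.trans (e1.le.trans h2)

/-- The excess over a convex function of a steep line through a point of its graph. -/
theorem ConvexOn.exists_excess {F : ℝ → ℝ} (hF : ConvexOn ℝ (Set.Ici 0) F) {τ : ℝ} (hτ : 0 < τ) :
    ∃ K, MonotoneOn (fun t => F τ + K * (t - τ) - F t) (Set.Icc τ (3 / 2 * τ)) ∧
      F τ + K * (3 / 2 * τ - τ) - F (3 / 2 * τ) = F (2 * τ) + F τ - 2 * F (3 / 2 * τ) ∧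
      ∀ t ∈ Set.Icc (3 / 2 * τ) (2 * τ), F t ≤ F τ + K * (t - τ) := by
  -- The secant slope over [3τ/2, 2τ] is at least every slope further left, so the line rises faster
  -- than `F` up to 3τ/2.
  set K := (F (2 * τ) - F (3 / 2 * τ)) / (2 * τ - 3 / 2 * τ) with hK
  have hmono : MonotoneOn (fun t => F τ + K * (t - τ) - F t) (Set.Icc τ (3 / 2 * τ)) := by
    intro a ha b hb hab
    rcases hab.eq_or_lt with rfl | hab
    · exact le_rfl
    have h1 := ConvexOn.sub_div_sub_le hF (a := a) (b := b) (x := 3 / 2 * τ) (y := 2 * τ)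
      (Set.mem_Ici.2 (hτ.le.trans ha.1)) (Set.mem_Ici.2 (hτ.le.trans hb.1))
      (Set.mem_Ici.2 (by linarith)) (Set.mem_Ici.2 (by linarith)) hab (by linarith) ha.2
      (by linarith [hb.2])
    rw [← hK, div_le_iff₀ (by linarith)] at h1
    simp only
    linarith
  have hend : F τ + K * (3 / 2 * τ - τ) - F (3 / 2 * τ)
      = F (2 * τ) + F τ - 2 * F (3 / 2 * τ) := by
    have e : K * (3 / 2 * τ - τ) = F (2 * τ) - F (3 / 2 * τ) := by
      rw [hK]
      have : 2 * τ - 3 / 2 * τ = 3 / 2 * τ - τ := by ring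
      rw [this, div_mul_cancel₀]
      linarith
    rw [e]; ring
  refine ⟨K, hmono, hend, fun t ht => ?_⟩
  have h0 : F (3 / 2 * τ) ≤ F τ + K * (3 / 2 * τ - τ) := by
    have := hmono (Set.left_mem_Icc.2 (by linarith)) (Set.right_mem_Icc.2 (by linarith))
      (by linarith : τ ≤ 3 / 2 * τ)
    simp only [sub_self, mul_zero, add_zero] at this
    linarith
  rcases ht.1.eq_or_lt with h | h
  · rw [← h]; exact h0
  · have h1 := hF.secant_mono (a := 3 / 2 * τ) (x := t) (y := 2 * τ) (Set.mem_Ici.2 (by linarith))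
      (Set.mem_Ici.2 (by linarith)) (Set.mem_Ici.2 (by linarith)) h.ne' (by linarith) ht.2
    rw [← hK, div_le_iff₀ (by linarith)] at h1
    linarith

/-- Bounds the growth of the critical log-volume within a window. Compared with the line of
`ConvexOn.exists_excess`, the deficit of `F` at σ is at most G₁. Since 3σ/2 lies in [3τ/2, 2τ] by σ
≤ 4τ/3, there `F` is below the line. The hypothesis at σ then bounds F(2σ); G₁ enters three times
through F(σ) and once through the slope. -/
theorem ConvexOn.doubling_le {F : ℝ → ℝ} (hF : ConvexOn ℝ (Set.Ici 0) F) {τ σ G₁ G₂ : ℝ}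
    (hτ : 0 < τ) (hτσ : τ ≤ σ) (hσ : σ ≤ 4 / 3 * τ)
    (h1 : F (2 * τ) + F τ - 2 * F (3 / 2 * τ) ≤ G₁)
    (h2 : F (2 * σ) + F σ - 2 * F (3 / 2 * σ) ≤ G₂) :
    F (2 * σ) - 2 * F σ ≤ F (2 * τ) - 2 * F τ + 4 * G₁ + G₂ := by
  obtain ⟨K, hmono, hend, hpos⟩ := ConvexOn.exists_excess hF hτ
  have h3 := hmono (a := σ) (b := 3 / 2 * τ) ⟨hτσ, by linarith⟩ ⟨by linarith, le_rfl⟩ (by linarith)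
  have h4 := hpos (3 / 2 * σ) ⟨by linarith, by linarith⟩
  simp only at h3
  nlinarith

theorem ConvexOn.doubling_mono {F : ℝ → ℝ} (hF : ConvexOn ℝ (Set.Ici 0) F) {τ σ : ℝ}
    (hτ : 0 ≤ τ) (hτσ : τ ≤ σ) : F (2 * τ) - 2 * F τ ≤ F (2 * σ) - 2 * F σ := by
  rcases hτσ.eq_or_lt with rfl | h
  · exact le_rfl
  have h1 := ConvexOn.sub_div_sub_le hF (a := τ) (b := σ) (x := 2 * τ) (y := 2 * σ)
    (Set.mem_Ici.2 hτ) (Set.mem_Ici.2 (by linarith)) (Set.mem_Ici.2 (by linarith))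
    (Set.mem_Ici.2 (by linarith)) h (by linarith) (by linarith) (by linarith)
  rw [div_le_div_iff₀ (by linarith) (by linarith)] at h1
  have h2 : 0 < σ - τ := by linarith
  have h3 : 0 ≤ (σ - τ) * ((F (2 * σ) - F (2 * τ)) - 2 * (F σ - F τ)) := by nlinarith
  have := nonneg_of_mul_nonneg_right h3 h2
  linarith

/-- Lower bound for a convex function at a point left of a grid node, extrapolated from the right
end, where the function is already known to be at most -m' + ε ≤ -m + ε; weights of the same order
suffice. -/
theorem le_of_extrapolation {α β y m m' ε u v : ℝ} (hα : 0 < α) (hβ : 0 ≤ β) (hβα : β ≤ α)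
    (hε : 0 ≤ ε) (hm : m ≤ m') (hu : -m - ε ≤ u) (hv : v ≤ -m' + ε)
    (h : (α + β) * u ≤ α * y + β * v) : -m - 3 * ε ≤ y := by
  have k1 : (α + β) * (-m - ε) ≤ (α + β) * u := mul_le_mul_of_nonneg_left hu (by linarith)
  have k2 : β * v ≤ β * (-m + ε) := mul_le_mul_of_nonneg_left (by linarith) hβ
  have k3 : β * ε ≤ α * ε := mul_le_mul_of_nonneg_right hβα hε
  have k4 : 0 ≤ α * (y + m + 3 * ε) := by linarith
  have := nonneg_of_mul_nonneg_right k4 hα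
  linarith

/-- The mirror case, extrapolating from the left end. There the function is only known to be at most
ε, so the relative weight β/α has to be at most ε/(B + 1). -/
theorem le_of_extrapolation_of_mul_le {α β y m B ε u v : ℝ} (hα : 0 < α) (hβ : 0 ≤ β)
    (hε1 : ε ≤ 1) (hB : 0 ≤ B) (hm : m ≤ B) (hk : (B + 1) * β ≤ ε * α)
    (hu : -m - ε ≤ u) (hv : v ≤ ε) (h : (α + β) * u ≤ α * y + β * v) : -m - 4 * ε ≤ y := by
  have k1 : (α + β) * (-m - ε) ≤ (α + β) * u := mul_le_mul_of_nonneg_left hu (by linarith)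
  have k2 : β * v ≤ β * ε := mul_le_mul_of_nonneg_left hv hβ
  have k3 : β * m ≤ β * B := mul_le_mul_of_nonneg_left hm hβ
  have k5 : β * ε ≤ β * 1 := mul_le_mul_of_nonneg_left hε1 hβ
  have k6 : 0 ≤ B * β := mul_nonneg hB hβ
  have k4 : 0 ≤ α * (y + m + 4 * ε) := by linarith
  have := nonneg_of_mul_nonneg_right k4 hα
  linarith

/-- A convex function that is close to a decreasing function of bounded variation on a suitable
grid, whose size depends on the variation only, is close to it everywhere. -/
theorem exists_grid {τ σ B ε : ℝ} (hτσ : τ ≤ σ) {M : ℝ → ℝ} (hmono : MonotoneOn M (Set.Icc τ σ))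
    (hcont : ContinuousOn M (Set.Icc τ σ)) (h0 : M τ = 0) (hB : M σ ≤ B) (hε0 : 0 < ε)
    (hε1 : ε ≤ 1) {n : ℕ} (hn : (5 * B + 4) / ε ≤ n) :
    ∃ s : ℕ → ℝ, (∀ i, s i ∈ Set.Icc τ σ) ∧ ∀ f : ℝ → ℝ, ConvexOn ℝ (Set.Icc τ σ) f →
      (∀ i ≤ n, |f (s i) + M (s i)| ≤ ε) → ∀ t ∈ Set.Icc τ σ, |f t + M t| ≤ 4 * ε := by
  have hτm : τ ∈ Set.Icc τ σ := Set.left_mem_Icc.2 hτσ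
  have hσm : σ ∈ Set.Icc τ σ := Set.right_mem_Icc.2 hτσ
  rcases hτσ.eq_or_lt with rfl | hlt
  · refine ⟨fun _ => τ, fun _ => hτm, fun f _ hf t ht => ?_⟩
    rw [Set.Icc_self, Set.mem_singleton_iff] at ht
    rw [ht]
    linarith [hf 0 (Nat.zero_le _)]
  have hMσ : 0 ≤ M σ := by rw [← h0]; exact hmono hτm hσm hτσ
  have hB0 : 0 ≤ B := hMσ.trans hB
  -- A step of at most ε in `Φ` then bounds the increment of `M` by ε and, at once, the step length
  -- by ε(σ - τ)/(4(B+1)). The total rise of `Φ` is at most 5B + 4, so the number of steps does not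
  -- depend on the shape of `M`.
  set c := 4 * (B + 1) / (σ - τ) with hc
  have hστ : 0 < σ - τ := by linarith
  have hc0 : 0 < c := by positivity
  set Φ : ℝ → ℝ := fun t => c * (t - τ) + M t with hΦ
  have hΦmono : StrictMonoOn Φ (Set.Icc τ σ) := by
    intro a ha b hb hab
    have h1 := hmono ha hb hab.le
    have h2 : c * (a - τ) < c * (b - τ) := by gcongr
    simp only [hΦ]
    linarith
  have hΦc : ContinuousOn Φ (Set.Icc τ σ) := by
    refine ContinuousOn.add (by fun_prop) hcont
  set T := Φ σ with hT
  have hTval : T = 4 * (B + 1) + M σ := by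
    simp only [hT, hΦ, hc]
    field_simp
  have hT0 : 0 < T := by rw [hTval]; positivity
  have hΦτ : Φ τ = 0 := by simp [hΦ, h0]
  have hn0 : (0 : ℝ) < n := lt_of_lt_of_le (by positivity) hn
  have hTn : T / n ≤ ε := by
    rw [div_le_iff₀ hn0]
    rw [div_le_iff₀ hε0] at hn
    linarith
  have hlev : ∀ i : ℕ, ∃ s ∈ Set.Icc τ σ, Φ s = min (i * (T / n)) T := by
    intro i
    have := intermediate_value_Icc hτσ hΦc
    exact this ⟨by rw [hΦτ]; positivity, min_le_right _ _⟩
  choose s hs hΦs using hlev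
  refine ⟨s, hs, fun f hf hclose t ht => ?_⟩
  have hsn : s n = σ := by
    refine hΦmono.injOn (hs n) hσm ?_
    rw [hΦs, mul_div_cancel₀ _ hn0.ne', min_self]
  have hs0 : s 0 = τ := by
    refine hΦmono.injOn (hs 0) hτm ?_
    rw [hΦs, hΦτ]
    simp [hT0.le]
  rcases ht.2.eq_or_lt with htσ | htσ
  · have := hclose n le_rfl
    rw [hsn] at this
    rw [htσ]
    linarith
  have hΦt0 : 0 ≤ Φ t := by rw [← hΦτ]; exact hΦmono.monotoneOn hτm ht ht.1
  have hΦtT : Φ t < T := hΦmono ht hσm htσ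
  set i := ⌊Φ t / (T / n)⌋₊ with hi
  have hTn0 : 0 < T / n := by positivity
  have hi1 : i * (T / n) ≤ Φ t := by
    rw [← le_div_iff₀ hTn0]; exact Nat.floor_le (by positivity)
  have hi2 : Φ t < (i + 1) * (T / n) := by
    rw [← div_lt_iff₀ hTn0]; exact Nat.lt_floor_add_one _
  have hin : i < n := by
    have : (i : ℝ) * (T / n) < n * (T / n) := by
      rw [mul_div_cancel₀ _ hn0.ne']
      linarith
    exact_mod_cast lt_of_mul_lt_mul_right this hTn0.le
  have hin' : ((i : ℝ) + 1) * (T / n) ≤ T := by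
    have : (i : ℝ) + 1 ≤ n := by exact_mod_cast hin
    calc ((i : ℝ) + 1) * (T / n) ≤ n * (T / n) := by gcongr
      _ = T := mul_div_cancel₀ _ hn0.ne'
  have hΦa : Φ (s i) = i * (T / n) := by
    rw [hΦs, min_eq_left]
    nlinarith
  have hΦb : Φ (s (i + 1)) = (i + 1) * (T / n) := by
    rw [hΦs, min_eq_left] <;> push_cast
    · rfl
    · exact hin'
  set a := s i with ha
  set b := s (i + 1) with hb
  have hat : a ≤ t := by
    rw [← hΦmono.le_iff_le (hs i) ht, hΦa]; exact hi1
  have htb : t ≤ b := by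
    rw [← hΦmono.le_iff_le ht (hs (i + 1)), hΦb]; exact hi2.le
  have hMab := hmono (hs i) (hs (i + 1)) (hat.trans htb)
  have hdiff : Φ b - Φ a ≤ ε := by rw [hΦa, hΦb]; linarith
  simp only [hΦ] at hdiff
  have hcab : 0 ≤ c * (b - a) := mul_nonneg hc0.le (by linarith)
  have hMd : M b - M a ≤ ε := by linarith
  have hcd : c * (b - a) ≤ ε := by linarith
  have hd : 4 * (B + 1) * (b - a) ≤ ε * (σ - τ) := by
    rw [hc, div_mul_eq_mul_div, div_le_iff₀ hστ] at hcd
    exact hcd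
  have hba : 0 ≤ b - a := by linarith
  have hd4 : 4 * (b - a) ≤ σ - τ := by
    have : 0 ≤ B * (b - a) := by positivity
    nlinarith
  have hMat := hmono (hs i) ht hat
  have hMtb := hmono ht (hs (i + 1)) htb
  have hfa := abs_le.1 (hclose i hin.le)
  have hfb := abs_le.1 (hclose (i + 1) hin)
  have hfτ := abs_le.1 (hclose 0 (Nat.zero_le _))
  have hfσ := abs_le.1 (hclose n le_rfl)
  rw [hs0, h0] at hfτ
  rw [hsn] at hfσ
  rw [abs_le]
  constructor
  -- Extrapolation starts from the endpoint in the opposite half, so that the far distance dominates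
  -- the step length.
  · rcases le_total t ((τ + σ) / 2) with hmid | hmid
    · have hcv := convexOn_sub_mul_le hf ht hσm htb (hs (i + 1)).2
      have hMb := hmono (hs (i + 1)) hσm (hs (i + 1)).2
      have := le_of_extrapolation (α := σ - b) (β := b - t) (by linarith) (by linarith)
        (by linarith) hε0.le hMb (by linarith : -M b - ε ≤ f b) (by linarith : f σ ≤ -M σ + ε)
        (by linarith)
      linarith
    · have hcv := convexOn_sub_mul_le hf hτm ht (hs i).1 hat
      have hMa0 : M a ≤ B := (hmono (hs i) hσm (hs i).2).trans hB
      have k0 : (B + 1) * (t - a) ≤ ε * (a - τ) := by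
        have k1 : (B + 1) * (t - a) ≤ (B + 1) * (b - a) :=
          mul_le_mul_of_nonneg_left (by linarith) (by linarith)
        have k2 : ε * (σ - τ) ≤ ε * (4 * (a - τ)) :=
          mul_le_mul_of_nonneg_left (by linarith) hε0.le
        linarith
      have := le_of_extrapolation_of_mul_le (α := a - τ) (β := t - a) (by linarith) (by linarith)
        hε1 hB0 hMa0 k0 (by linarith : -M a - ε ≤ f a) (by linarith : f τ ≤ ε)
        (by linarith)
      linarith
  -- The upper bound needs only the two neighbouring nodes.
  · have hcv := hf.le_max_of_mem_Icc (hs i) (hs (i + 1)) ⟨hat, htb⟩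
    rcases max_cases (f a) (f b) with ⟨hm, -⟩ | ⟨hm, -⟩ <;> rw [hm] at hcv <;> linarith

end ConvexFunctions

end PAM

namespace PAM

open scoped ENNReal

/-! ### Log-convexity of the mean in time -/

section LogConvexity

variable {d : ℕ} {κ : ℝ} {μ : Measure ℝ} [IsProbabilityMeasure μ]

theorem ofReal_exp_rpow_mul_rpow (x y a b : ℝ) :
    ENNReal.ofReal (Real.exp x) ^ a * ENNReal.ofReal (Real.exp y) ^ b
      = ENNReal.ofReal (Real.exp (a * x + b * y)) := by
  rw [ENNReal.ofReal_rpow_of_pos (Real.exp_pos _), ENNReal.ofReal_rpow_of_pos (Real.exp_pos _),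
    ← ENNReal.ofReal_mul (by positivity), ← Real.exp_mul, ← Real.exp_mul, ← Real.exp_add,
    mul_comm x, mul_comm y]

theorem convexOn_cgf (hexp : ∀ t : ℝ, 0 ≤ t → Integrable (fun y => Real.exp (t * y)) μ) :
    ConvexOn ℝ (Set.Ici 0) (cgf id μ) := by
  refine ⟨convex_Ici 0, fun s hs t ht a b ha hb hab => ?_⟩
  simp only [smul_eq_mul, Set.mem_Ici] at *
  have h0 : 0 ≤ a * s + b * t := by positivity
  have h := ENNReal.lintegral_mul_norm_pow_le (μ := μ)
    (f := fun y => ENNReal.ofReal (Real.exp (s * y)))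
    (g := fun y => ENNReal.ofReal (Real.exp (t * y))) (by fun_prop) (by fun_prop) ha hb hab
  rw [lintegral_exp_mul hexp hs, lintegral_exp_mul hexp ht, ofReal_exp_rpow_mul_rpow] at h
  simp_rw [ofReal_exp_rpow_mul_rpow] at h
  have e : ∀ y : ℝ, a * (s * y) + b * (t * y) = (a * s + b * t) * y := fun y => by ring
  simp_rw [e] at h
  rwa [lintegral_exp_mul hexp h0, ENNReal.ofReal_le_ofReal_iff (Real.exp_pos _).le,
    Real.exp_le_exp] at h

theorem dirMass_nonneg (hκ : 0 ≤ κ) (V : Lattice d → ℝ) (Q : Finset (Lattice d)) {t : ℝ}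
    (ht : 0 ≤ t) : 0 ≤ dirMass κ V Q t :=
  Finset.sum_nonneg fun x _ => dirSol_nonneg hκ ht x

theorem lintegral_dirMass_le [NeZero d] (hκ : 0 < κ)
    (hexp : ∀ t : ℝ, 0 ≤ t → Integrable (fun y => Real.exp (t * y)) μ) {t : ℝ} (ht : 0 ≤ t)
    (Q : Finset (Lattice d)) :
    ∫⁻ V, ENNReal.ofReal (dirMass κ V Q t) ∂(fieldMeasure d μ)
      ≤ ENNReal.ofReal (Q.card * meanFK d κ μ t) := by
  have h1 : ∀ V : Lattice d → ℝ, ENNReal.ofReal (dirMass κ V Q t)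
      = ∑ x ∈ Q, ENNReal.ofReal (dirSol κ V Q t x) := fun V =>
    ENNReal.ofReal_sum_of_nonneg fun x _ => dirSol_nonneg hκ.le ht x
  simp_rw [h1]
  rw [lintegral_finsetSum _ fun x _ => (continuous_dirSol_potential t x).measurable.ennreal_ofReal]
  refine (Finset.sum_le_sum fun x _ => lintegral_dirSol_le hκ hexp ht Q x).trans (le_of_eq ?_)
  rw [Finset.sum_const, nsmul_eq_mul, ENNReal.ofReal_mul (Nat.cast_nonneg _),
    ENNReal.ofReal_natCast]

/-- Paths with few jumps started in a cube stay in a larger cube. -/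
theorem sum_fk_le_dirMass [NeZero d] (hκ : 0 < κ) (V : Lattice d → ℝ) (n l : ℕ) {t : ℝ}
    (ht : 0 ≤ t) :
    ∑ x ∈ cube 0 l, fk n κ V t x ≤ ENNReal.ofReal (dirMass κ V (cube 0 (l + n)) t) := by
  rw [dirMass, ENNReal.ofReal_sum_of_nonneg fun x _ => dirSol_nonneg hκ.le ht x]
  calc ∑ x ∈ cube 0 l, fk n κ V t x
      ≤ ∑ x ∈ cube 0 l, ENNReal.ofReal (dirSol κ V (cube 0 (l + n)) t x) :=
        Finset.sum_le_sum fun x hx => fk_le_dirSol hκ n (fun y hy =>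
          cube_subset_cube hx le_rfl (mem_cube.2 hy)) ht
    _ ≤ _ := Finset.sum_le_sum_of_subset (cube_mono 0 (Nat.le_add_right l n))

/-- The solution at one site need not be log-convex in time, but the total Dirichlet mass is, and
Hölder's inequality carries this to expectations. By stationarity the mean is a spatial average;
few-jump paths from the cube of radius `l` stay in the one of radius `l + n`, and the ratio of the
volumes tends to 1 as `l` grows. -/
theorem lintegral_fk_le_geom [NeZero d] (hκ : 0 < κ)
    (hexp : ∀ t : ℝ, 0 ≤ t → Integrable (fun y => Real.exp (t * y)) μ) {s t a b : ℝ} (hs : 0 ≤ s)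
    (ht : 0 ≤ t) (ha : 0 ≤ a) (hb : 0 ≤ b) (hab : a + b = 1) (n : ℕ) :
    ∫⁻ V, fk n κ V (a * s + b * t) 0 ∂(fieldMeasure d μ)
      ≤ ENNReal.ofReal (meanFK d κ μ s ^ a * meanFK d κ μ t ^ b) := by
  set A := meanFK d κ μ s ^ a * meanFK d κ μ t ^ b with hA
  have hφs := meanFK_pos (d := d) hκ hexp hs
  have hφt := meanFK_pos (d := d) hκ hexp ht
  have hT : 0 ≤ a * s + b * t := by positivity
  have key : ∀ l : ℕ, ((2 * l + 1 : ℕ) ^ d : ℝ≥0∞) * ∫⁻ V, fk n κ V (a * s + b * t) 0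
      ∂(fieldMeasure d μ) ≤ ENNReal.ofReal ((2 * (l + n) + 1) ^ d * A) := by
    intro l
    set Q := cube (0 : Lattice d) (l + n)
    have hcard : (Q.card : ℝ) = (2 * (l + n) + 1) ^ d := by rw [card_cube]; push_cast; rfl
    calc ((2 * l + 1 : ℕ) ^ d : ℝ≥0∞) * ∫⁻ V, fk n κ V (a * s + b * t) 0 ∂(fieldMeasure d μ)
        = ∫⁻ V, ∑ x ∈ cube 0 l, fk n κ V (a * s + b * t) x ∂(fieldMeasure d μ) := by
          rw [lintegral_finsetSum _ fun x _ => measurable_fk n κ _ x,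
            Finset.sum_congr rfl fun x _ =>
              lintegral_fk_eq_origin n κ (fun a => a) measurable_id _ x,
            Finset.sum_const, nsmul_eq_mul, card_cube]
          push_cast
          rfl
      _ ≤ ∫⁻ V, ENNReal.ofReal (dirMass κ V Q s) ^ a * ENNReal.ofReal (dirMass κ V Q t) ^ b
            ∂(fieldMeasure d μ) := by
          refine lintegral_mono fun V => (sum_fk_le_dirMass hκ V n l hT).trans ?_
          have hp := fun u => dirMass_pos κ V (cube_nonempty (0 : Lattice d) (l + n)) u
          have hcv := (convexOn_log_dirMass κ V (cube_nonempty (0 : Lattice d) (l + n))).2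
            (Set.mem_univ s) (Set.mem_univ t) ha hb hab
          simp only [smul_eq_mul] at hcv
          rw [← Real.exp_log (hp s), ← Real.exp_log (hp t), ofReal_exp_rpow_mul_rpow]
          refine ENNReal.ofReal_le_ofReal ?_
          rw [← Real.log_le_iff_le_exp (hp _)]
          exact hcv
      _ ≤ (∫⁻ V, ENNReal.ofReal (dirMass κ V Q s) ∂(fieldMeasure d μ)) ^ a *
            (∫⁻ V, ENNReal.ofReal (dirMass κ V Q t) ∂(fieldMeasure d μ)) ^ b :=
          ENNReal.lintegral_mul_norm_pow_le (measurable_dirMass s).ennreal_ofReal.aemeasurable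
            (measurable_dirMass t).ennreal_ofReal.aemeasurable ha hb hab
      _ ≤ ENNReal.ofReal (Q.card * meanFK d κ μ s) ^ a *
            ENNReal.ofReal (Q.card * meanFK d κ μ t) ^ b := by
          gcongr
          · exact lintegral_dirMass_le hκ hexp hs Q
          · exact lintegral_dirMass_le hκ hexp ht Q
      _ = _ := by
          rw [hcard, ENNReal.ofReal_rpow_of_pos (by positivity),
            ENNReal.ofReal_rpow_of_pos (by positivity), ← ENNReal.ofReal_mul (by positivity),
            Real.mul_rpow (by positivity) hφs.le, Real.mul_rpow (by positivity) hφt.le, hA]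
          congr 1
          have : ((2 * ((l : ℝ) + n) + 1) ^ d) ^ a * ((2 * ((l : ℝ) + n) + 1) ^ d) ^ b
              = (2 * (l + n) + 1) ^ d := by
            rw [← Real.rpow_add (by positivity), hab, Real.rpow_one]
          rw [mul_mul_mul_comm, this]
  have hfin : ∫⁻ V, fk n κ V (a * s + b * t) 0 ∂(fieldMeasure d μ) ≠ ∞ :=
    ((lintegral_mono fun V => fk_le_fk_top n κ V _ 0).trans_lt
      (lintegral_fk_top_ne_top hκ hexp hT 0).lt_top).ne
  set I := ∫⁻ V, fk n κ V (a * s + b * t) 0 ∂(fieldMeasure d μ)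
  rw [← ENNReal.ofReal_toReal hfin]
  refine ENNReal.ofReal_le_ofReal ?_
  have hreal : ∀ l : ℕ, (((2 * l + 1 : ℕ) : ℝ) / ((2 * l + 1 : ℕ) + 2 * n)) ^ d * I.toReal ≤ A := by
    intro l
    have h := ENNReal.toReal_mono ENNReal.ofReal_ne_top (key l)
    rw [ENNReal.toReal_mul, ENNReal.toReal_pow, ENNReal.toReal_natCast,
      ENNReal.toReal_ofReal (by positivity)] at h
    rw [div_pow, div_mul_eq_mul_div, div_le_iff₀ (by positivity)]
    refine h.trans (le_of_eq ?_)
    push_cast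
    ring
  have hlim : Tendsto (fun l : ℕ => (((2 * l + 1 : ℕ) : ℝ) / ((2 * l + 1 : ℕ) + 2 * n)) ^ d *
      I.toReal) atTop (𝓝 (1 ^ d * I.toReal)) := by
    have h1 : Tendsto (fun l : ℕ => 2 * l + 1) atTop atTop :=
      tendsto_atTop_mono (fun l => by simp only [id]; omega) tendsto_id
    exact (((tendsto_natCast_div_add_atTop (2 * n : ℝ)).comp h1).pow d).mul_const _
  rw [one_pow, one_mul] at hlim
  exact le_of_tendsto' hlim hreal

/-- The restriction on the number of jumps in `lintegral_fk_le_geom` is removed by letting it grow;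
the remainder is exponentially small in `n` at fixed times. -/
theorem convexOn_log_meanFK [NeZero d] (hκ : 0 < κ)
    (hexp : ∀ t : ℝ, 0 ≤ t → Integrable (fun y => Real.exp (t * y)) μ) :
    ConvexOn ℝ (Set.Ici 0) fun t => Real.log (meanFK d κ μ t) := by
  refine ⟨convex_Ici 0, fun s hs t ht a b ha hb hab => ?_⟩
  simp only [smul_eq_mul, Set.mem_Ici] at *
  have hT : 0 ≤ a * s + b * t := by positivity
  have hφs := meanFK_pos (d := d) hκ hexp hs
  have hφt := meanFK_pos (d := d) hκ hexp ht
  have hφT := meanFK_pos (d := d) hκ hexp hT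
  set A := meanFK d κ μ s ^ a * meanFK d κ μ t ^ b with hA
  have hA0 : 0 < A := by positivity
  suffices h : meanFK d κ μ (a * s + b * t) ≤ A by
    have := Real.log_le_log hφT h
    rwa [hA, Real.log_mul (by positivity) (by positivity), Real.log_rpow hφs,
      Real.log_rpow hφt] at this
  set c := cgf id μ (a * s + b * t) + (Real.exp 1 - 1) * (2 * d * κ) * (a * s + b * t) with hc
  have hle : ∀ n : ℕ, meanFK d κ μ (a * s + b * t) ≤ A + Real.exp (c - ((n + 1 : ℕ) : ℝ)) := by
    intro n
    rw [← ENNReal.ofReal_le_ofReal_iff (by positivity), ← lintegral_fk_top hκ hexp hT 0,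
      ENNReal.ofReal_add hA0.le (Real.exp_pos _).le]
    simp_rw [fk_top_eq_add (n + 1)]
    rw [lintegral_add_left (measurable_fk _ κ _ 0)]
    refine add_le_add (lintegral_fk_le_geom hκ hexp hs ht ha hb hab (n + 1)) ?_
    refine (lintegral_fkRest_le μ hκ 0 hT (Nat.succ_ne_zero n)).trans (le_of_eq ?_)
    rw [lintegral_exp_mul hexp hT, ← ENNReal.ofReal_mul (Real.exp_pos _).le, ← Real.exp_add, hc]
    congr 2
    ring
  have hlim : Tendsto (fun n : ℕ => A + Real.exp (c - ((n + 1 : ℕ) : ℝ))) atTop (𝓝 (A + 0)) := by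
    refine tendsto_const_nhds.add (Real.tendsto_exp_atBot.comp ?_)
    refine tendsto_atBot_add_const_left _ c (tendsto_neg_atTop_atBot.comp ?_)
    exact tendsto_natCast_atTop_atTop.comp (tendsto_add_atTop_nat 1)
  rw [add_zero] at hlim
  exact ge_of_tendsto' hlim hle

theorem continuousOn_log_meanFK [NeZero d] (hκ : 0 < κ)
    (hexp : ∀ t : ℝ, 0 ≤ t → Integrable (fun y => Real.exp (t * y)) μ) :
    ContinuousOn (fun t => Real.log (meanFK d κ μ t)) (Set.Ioi 0) :=
  ((convexOn_log_meanFK (d := d) hκ hexp).subset Set.Ioi_subset_Ici_self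
    (convex_Ioi 0)).continuousOn isOpen_Ioi

end LogConvexity

end PAM

namespace PAM

open scoped ENNReal

/-! ### The Dirichlet mass of a large cube -/

section Mass

variable {d : ℕ} {κ : ℝ} {μ : Measure ℝ} [IsProbabilityMeasure μ]

theorem FiniteFK.solution_eq_add [NeZero d] (hκ : 0 < κ) {V : Lattice d → ℝ} (h : FiniteFK κ V)
    (n : ℕ) {t : ℝ} (ht : 0 ≤ t) (x : Lattice d) :
    solution κ V t x = (fk n κ V t x).toReal + (fkRest n κ V t x).toReal := by
  have hlt := h.lt_top hκ ht x
  rw [fk_top_eq_add n] at hlt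
  rw [solution_eq_toReal_fk, fk_top_eq_add n,
    ENNReal.toReal_add (ENNReal.add_lt_top.1 hlt).1.ne (ENNReal.add_lt_top.1 hlt).2.ne]

theorem FiniteFK.sum_solution_le [NeZero d] (hκ : 0 < κ) {V : Lattice d → ℝ} (h : FiniteFK κ V)
    (n : ℕ) {t : ℝ} (ht : 0 ≤ t) (Q : Finset (Lattice d)) {y : ℝ} (hy : 0 ≤ y)
    (hrest : ∑ x ∈ Q, fkRest n κ V t x ≤ ENNReal.ofReal y) :
    ∑ x ∈ Q, solution κ V t x ≤ ∑ x ∈ Q, (fk n κ V t x).toReal + y := by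
  rw [Finset.sum_congr rfl fun x _ => h.solution_eq_add hκ n ht x, Finset.sum_add_distrib]
  refine add_le_add_right ?_ _
  rw [← ENNReal.toReal_sum fun x _ => ?_]
  · exact ENNReal.toReal_le_of_le_ofReal hy hrest
  · have hlt := h.lt_top hκ ht x
    rw [fk_top_eq_add n] at hlt
    exact (ENNReal.add_lt_top.1 hlt).2.ne

theorem FiniteFK.dirMass_le [NeZero d] (hκ : 0 < κ) {V : Lattice d → ℝ} (h : FiniteFK κ V)
    {t : ℝ} (ht : 0 ≤ t) (Q : Finset (Lattice d)) :
    dirMass κ V Q t ≤ ∑ x ∈ Q, solution κ V t x :=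
  Finset.sum_le_sum fun x _ => dirSol_le_solution hκ h ht x

theorem FiniteFK.sum_fk_toReal_le_dirMass [NeZero d] (hκ : 0 < κ) {V : Lattice d → ℝ}
    (h : FiniteFK κ V) (n l : ℕ) {t : ℝ} (ht : 0 ≤ t) :
    ∑ x ∈ cube 0 l, (fk n κ V t x).toReal ≤ dirMass κ V (cube 0 (l + n)) t := by
  rw [← ENNReal.toReal_sum fun x _ =>
    ((fk_le_fk_top n κ V t x).trans_lt (h.lt_top hκ ht x)).ne]
  exact ENNReal.toReal_le_of_le_ofReal (dirMass_nonneg hκ.le V _ ht)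
    (sum_fk_le_dirMass hκ V n l ht)

theorem abs_log_sub_log_le {S A η : ℝ} (hA : 0 < A) (hη0 : 0 ≤ η) (hη : η ≤ 1 / 4)
    (h1 : (1 - 2 * η) * A ≤ S) (h2 : S ≤ (1 + 2 * η) * A) :
    |Real.log S - Real.log A| ≤ 4 * η := by
  have hp : 0 < 1 - 2 * η := by linarith
  have hS : 0 < S := lt_of_lt_of_le (by positivity) h1
  rw [← Real.log_div hS.ne' hA.ne', abs_le]
  constructor
  · have h3 : 1 - 2 * η ≤ S / A := by rwa [le_div_iff₀ hA]
    have h4 := Real.log_le_log hp h3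
    have h5 := Real.one_sub_inv_le_log_of_pos hp
    have h6 : (1 - 2 * η)⁻¹ ≤ 1 + 4 * η := by
      rw [inv_le_iff_one_le_mul₀ hp]
      nlinarith
    linarith
  · have h3 : S / A ≤ 1 + 2 * η := by rwa [div_le_iff₀ hA]
    have h4 := Real.log_le_sub_one_of_pos (div_pos hS hA)
    linarith

theorem cgf_doubling_nonneg (hexp : ∀ t : ℝ, 0 ≤ t → Integrable (fun y => Real.exp (t * y)) μ)
    {t : ℝ} (ht : 0 ≤ t) : 0 ≤ cgf id μ (2 * t) - 2 * cgf id μ t := by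
  have := ConvexOn.doubling_mono (convexOn_cgf hexp) le_rfl ht
  simpa using this

/-- Bernoulli's inequality: removing a boundary layer of thickness `n` costs a proportion at most
2dn/(2c+1) of the volume. -/
theorem one_sub_le_pow_div {c n d : ℕ} {η : ℝ} (hnc : n ≤ c) (h : 2 * d * n ≤ η * (2 * c + 1)) :
    (1 - η) * (2 * c + 1) ^ d ≤ (2 * ((c - n : ℕ) : ℝ) + 1) ^ d := by
  have hc : (0 : ℝ) < 2 * c + 1 := by positivity
  have hnc' : (n : ℝ) ≤ c := by exact_mod_cast hnc
  have e : 2 * ((c - n : ℕ) : ℝ) + 1 = (1 + -(2 * n / (2 * c + 1))) * (2 * c + 1) := by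
    rw [Nat.cast_sub hnc]
    field_simp
    ring
  have h1 : (2 * n : ℝ) / (2 * c + 1) ≤ 1 := by
    rw [div_le_one hc]
    linarith
  have h2 := one_add_mul_le_pow (a := -(2 * n / (2 * c + 1) : ℝ)) (by linarith) d
  rw [e, mul_pow]
  refine mul_le_mul_of_nonneg_right (le_trans ?_ h2) (by positivity)
  have h3 : (d : ℝ) * (2 * n / (2 * c + 1)) ≤ η := by
    rw [mul_div_assoc', div_le_iff₀ hc]
    linarith
  linarith

/-- At a fixed time, the mass in a large cube is close to its expected order. -/
theorem eventually_measure_log_dirMass_le [NeZero d] (hκ : 0 < κ)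
    (hexp : ∀ t : ℝ, 0 ≤ t → Integrable (fun y => Real.exp (t * y)) μ)
    (hH : AssumptionH (cgf id μ)) {a ε : ℝ} (ha : 0 < a) (hε0 : 0 < ε) (hε1 : ε ≤ 1) :
    ∀ᶠ s in atTop, ∀ c : ℕ,
      cgf id μ (2 * s) - 2 * cgf id μ s + a * s ≤ d * Real.log (2 * c + 1) →
      fieldMeasure d μ {V | ε < |Real.log (dirMass κ V (cube 0 c) s)
          - Real.log ((2 * c + 1) ^ d * meanFK d κ μ s)|}
        ≤ ENNReal.ofReal (Real.exp (-(min (a / 4) 1 * s))) := by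
  set η := ε / 4 with hη
  have hη0 : 0 < η := by positivity
  have hη1 : η ≤ 1 / 4 := by linarith
  have hd : (0 : ℝ) < d := by exact_mod_cast Nat.pos_of_ne_zero (NeZero.ne d)
  set b := min (a / 4) 1 with hb
  have hb0 : 0 < b := by positivity
  filter_upwards [eventually_measure_le_secondMoment (d := d) hκ hexp hH hη0 (by linarith)
      (half_pos ha), eventually_ge_atTop 0,
    eventually_mul_pow_le_exp (2 * d / η + 2) (6 * d * κ + 2) 2 (by positivity) (by positivity)
      (by positivity) 1 (div_pos ha hd),
    eventually_mul_pow_le_exp (1 + Real.exp 1 + 1 / η) 0 1 (by positivity) le_rfl zero_le_one 0 hb0]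
    with s hsec hs0 hpoly hconst c hc
  set φ := meanFK d κ μ s
  have hφ : 0 < φ := meanFK_pos (d := d) hκ hexp hs0
  set n := cutoff d κ s with hn
  set x := cgf id μ (2 * s) - 2 * cgf id μ s with hx
  have hx0 : 0 ≤ x := cgf_doubling_nonneg hexp hs0
  have hnle : (n : ℝ) ≤ (6 * d * κ + 2) * s + 2 := cutoff_le d hκ.le hs0
  -- The volume condition makes `c` exponentially large in `s` while the cutoff is linear, so the
  -- boundary layer is negligible.
  have hcbig : (2 * d / η + 2) * n ≤ 2 * c + 1 := by
    have h1 : a / d * s ≤ Real.log (2 * c + 1) := by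
      rw [div_mul_eq_mul_div, div_le_iff₀ hd]
      linarith
    rw [Real.le_log_iff_exp_le (by positivity)] at h1
    refine le_trans ?_ (hpoly.trans h1)
    rw [pow_one]
    gcongr
  have hnc : n ≤ c := by
    have h1 : (2 : ℝ) * n ≤ 2 * c + 1 := by
      refine le_trans ?_ hcbig
      gcongr
      have : 0 ≤ 2 * (d : ℝ) / η := by positivity
      linarith
    have h2 : 2 * n ≤ 2 * c + 1 := by exact_mod_cast h1
    omega
  have hdn : 2 * d * (n : ℝ) ≤ η * (2 * c + 1) := by
    have h1 := mul_le_mul_of_nonneg_left hcbig hη0.le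
    have h2 : η * ((2 * d / η + 2) * n) = 2 * d * n + η * (2 * n) := by
      field_simp
    have h3 : 0 ≤ η * (2 * n) := by positivity
    linarith
  have hN' := one_sub_le_pow_div hnc hdn
  set N : ℝ := (2 * c + 1) ^ d with hN
  have hN0 : 0 < N := by positivity
  set N' : ℝ := (2 * ((c - n : ℕ) : ℝ) + 1) ^ d with hN'def
  have hlogN' : d * Real.log (2 * c + 1) - 1 ≤ d * Real.log (2 * ((c - n : ℕ) : ℝ) + 1) := by
    rw [← Real.log_pow, ← Real.log_pow, ← hN, ← hN'def]
    have h1 : N / 2 ≤ N' := by nlinarith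
    have h2 := Real.log_le_log (by positivity) h1
    rw [Real.log_div hN0.ne' two_ne_zero] at h2
    have h3 := Real.log_two_lt_d9
    linarith
  -- The Dirichlet mass lies between the few-jump mass started in the cube of radius `c - n` and the
  -- full mass in the cube of radius `c`. The latter is the few-jump mass plus the remainder, so
  -- three bad events suffice.
  set A₁ := {V : Lattice d → ℝ | η * (N * φ) < |∑ x ∈ cube 0 c, (fk n κ V s x).toReal - N * φ|}
  set A₂ := {V : Lattice d → ℝ |
    η * (N' * φ) < |∑ x ∈ cube 0 (c - n), (fk n κ V s x).toReal - N' * φ|}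
  set A₃ := {V : Lattice d → ℝ |
    ENNReal.ofReal (η * (N * φ)) ≤ ∑ x ∈ cube 0 c, fkRest n κ V s x}
  have hsub : ({V | ε < |Real.log (dirMass κ V (cube 0 c) s) - Real.log (N * φ)|} :
      Set (Lattice d → ℝ)) ≤ᵐ[fieldMeasure d μ] (A₁ ∪ A₂ ∪ A₃ : Set (Lattice d → ℝ)) := by
    filter_upwards [ae_finiteFK hκ μ hexp] with V hV hbad
    by_contra hcon
    have hcon' : V ∉ A₁ ∪ A₂ ∪ A₃ := hcon
    simp only [Set.mem_union, not_or] at hcon'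
    obtain ⟨⟨h1, h2⟩, h3⟩ := hcon'
    have h1' := abs_le.1 (not_lt.1 (show
      ¬ η * (N * φ) < |∑ x ∈ cube 0 c, (fk n κ V s x).toReal - N * φ| from h1))
    have h2' := abs_le.1 (not_lt.1 (show
      ¬ η * (N' * φ) < |∑ x ∈ cube 0 (c - n), (fk n κ V s x).toReal - N' * φ| from h2))
    have h3' := (not_le.1 (show
      ¬ ENNReal.ofReal (η * (N * φ)) ≤ ∑ x ∈ cube 0 c, fkRest n κ V s x from h3)).le
    have hup := (hV.dirMass_le hκ hs0 (cube 0 c)).trans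
      (hV.sum_solution_le hκ n hs0 (cube 0 c) (by positivity) h3')
    have hlow := hV.sum_fk_toReal_le_dirMass hκ n (c - n) hs0
    rw [Nat.sub_add_cancel hnc] at hlow
    have h4 := abs_log_sub_log_le (S := dirMass κ V (cube 0 c) s) (A := N * φ) (by positivity)
      hη0.le hη1 ?_ (by linarith)
    · have h5 : ε < |Real.log (dirMass κ V (cube 0 c) s) - Real.log (N * φ)| := hbad
      linarith
    · have h6 : (1 - η) * ((1 - η) * N) * φ ≤ (1 - η) * N' * φ := by
        gcongr
        linarith
      have h7 : 0 ≤ η ^ 2 * (N * φ) := by positivity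
      nlinarith
  have hm1 : fieldMeasure d μ A₁ ≤ ENNReal.ofReal (Real.exp (-(2 * b * s))) := by
    refine (hsec c).trans (ENNReal.ofReal_le_ofReal (Real.exp_le_exp.2 ?_))
    have : b * s ≤ a / 4 * s := mul_le_mul_of_nonneg_right (min_le_left _ _) hs0
    linarith
  have hm2 : fieldMeasure d μ A₂ ≤ ENNReal.ofReal (Real.exp 1 * Real.exp (-(2 * b * s))) := by
    refine (hsec (c - n)).trans (ENNReal.ofReal_le_ofReal ?_)
    rw [← Real.exp_add, Real.exp_le_exp]
    have : b * s ≤ a / 4 * s := mul_le_mul_of_nonneg_right (min_le_left _ _) hs0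
    linarith
  have hm3 : fieldMeasure d μ A₃ ≤ ENNReal.ofReal (1 / η * Real.exp (-(2 * b * s))) := by
    refine (measure_sum_fkRest_le hκ hexp hs0 hη0 c).trans (ENNReal.ofReal_le_ofReal ?_)
    rw [one_div_mul_eq_div]
    have : b * s ≤ 1 * s := mul_le_mul_of_nonneg_right (min_le_right _ _) hs0
    exact div_le_div_of_nonneg_right (Real.exp_le_exp.2 (by linarith)) hη0.le
  refine (measure_mono_ae hsub).trans ((measure_union_le _ _).trans
    ((add_le_add ((measure_union_le _ _).trans (add_le_add hm1 hm2)) hm3).trans ?_))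
  rw [← ENNReal.ofReal_add (by positivity) (by positivity),
    ← ENNReal.ofReal_add (by positivity) (by positivity)]
  refine ENNReal.ofReal_le_ofReal ?_
  rw [pow_zero, mul_one] at hconst
  calc Real.exp (-(2 * b * s)) + Real.exp 1 * Real.exp (-(2 * b * s))
        + 1 / η * Real.exp (-(2 * b * s))
      = (1 + Real.exp 1 + 1 / η) * Real.exp (-(2 * b * s)) := by ring
    _ ≤ Real.exp (b * s) * Real.exp (-(2 * b * s)) := by gcongr
    _ = _ := by rw [← Real.exp_add]; ring_nf

/-- In a time window on which the cumulant generating function is almost linear, the mass in a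
large cube is close to its expected order throughout. -/
theorem eventually_measure_exists_log_dirMass_le [NeZero d] (hκ : 0 < κ)
    (hexp : ∀ t : ℝ, 0 ≤ t → Integrable (fun y => Real.exp (t * y)) μ)
    (hH : AssumptionH (cgf id μ)) {a ε C : ℝ} (ha : 0 < a) (hε0 : 0 < ε) (hε1 : ε ≤ 1)
    (hC : 0 ≤ C) :
    ∀ᶠ τ in atTop, ∀ σ ∈ Set.Icc τ (τ + 1), ∀ c : ℕ,
      cgf id μ (2 * τ) + cgf id μ τ - 2 * cgf id μ (3 / 2 * τ) ≤ C * τ →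
      cgf id μ (2 * σ) - 2 * cgf id μ σ + a * σ ≤ d * Real.log (2 * c + 1) →
      fieldMeasure d μ {V | ∃ t ∈ Set.Icc τ σ, 4 * ε < |Real.log (dirMass κ V (cube 0 c) t)
          - Real.log ((2 * c + 1) ^ d * meanFK d κ μ t)|}
        ≤ ENNReal.ofReal (Real.exp (-(min (a / 4) 1 / 2 * τ))) := by
  obtain ⟨s₀, hs₀⟩ := eventually_atTop.1
    (eventually_measure_log_dirMass_le (d := d) hκ hexp hH ha hε0 hε1)
  set b := min (a / 4) 1 with hb
  have hb0 : 0 < b := by positivity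
  filter_upwards [eventually_ge_atTop s₀, eventually_ge_atTop 2,
    eventually_mul_pow_le_exp 1 (5 * (C + 6 * d * κ) / ε) (4 / ε + 2) zero_le_one (by positivity)
      (by positivity) 1 (half_pos hb0)] with τ hτs hτ2 hpoly σ hσ c hgap hvol
  have hτ0 : 0 < τ := by linarith
  set F : ℝ → ℝ := fun t => Real.log (meanFK d κ μ t) with hF
  have hFc : ConvexOn ℝ (Set.Ici 0) F := convexOn_log_meanFK hκ hexp
  have hpos : ∀ t, 0 ≤ t → 0 < meanFK d κ μ t := fun t ht => meanFK_pos (d := d) hκ hexp ht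
  have hFle : ∀ t, 0 ≤ t → F t ≤ cgf id μ t := fun t ht => by
    rw [hF, Real.log_le_iff_le_exp (hpos t ht)]
    exact meanFK_le hκ hexp ht
  have hFge : ∀ t, 0 ≤ t → cgf id μ t - 2 * d * κ * t ≤ F t := fun t ht => by
    rw [hF, Real.le_log_iff_exp_le (hpos t ht)]
    exact exp_cgf_sub_le_meanFK hκ hexp ht
  obtain ⟨K, hmono, hend, -⟩ := ConvexOn.exists_excess hFc hτ0
  -- Since `F` lies between H(t) - 2dκt and H(t), its gap exceeds that of `H` by at most 2 · 2dκ ·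
  -- (3/2)τ = 6dκτ.
  set B := (C + 6 * d * κ) * τ with hB
  have hsubset : Set.Icc τ σ ⊆ Set.Icc τ (3 / 2 * τ) :=
    Set.Icc_subset_Icc_right (by linarith [hσ.2])
  have hMσ : F τ + K * (σ - τ) - F σ ≤ B := by
    have h1 := hmono (hsubset (Set.right_mem_Icc.2 hσ.1)) (Set.right_mem_Icc.2 (by linarith))
      (by linarith [hσ.2] : σ ≤ 3 / 2 * τ)
    simp only at h1
    have h2 := hFle (2 * τ) (by linarith)
    have h3 := hFle τ (by linarith)
    have h4 := hFge (3 / 2 * τ) (by linarith)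
    nlinarith
  -- The grid has a size linear in τ, so the union bound over it is paid for by half of the
  -- exponential rate.
  set n := ⌈(5 * B + 4) / ε⌉₊ with hn
  obtain ⟨s, hs, hgrid⟩ := exists_grid hσ.1 (hmono.mono hsubset)
    (by
      refine ContinuousOn.sub (by fun_prop) ((continuousOn_log_meanFK hκ hexp).mono fun t ht => ?_)
      exact hτ0.trans_le ht.1)
    (by simp) hMσ hε0 hε1 (Nat.le_ceil _)
  have hcne := cube_nonempty (0 : Lattice d) c
  have hN0 : (0 : ℝ) < (2 * c + 1) ^ d := by positivity
  have hsub : {V : Lattice d → ℝ | ∃ t ∈ Set.Icc τ σ, 4 * ε < |Real.log (dirMass κ V (cube 0 c) t)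
      - Real.log ((2 * c + 1) ^ d * meanFK d κ μ t)|}
      ⊆ ⋃ i ∈ Finset.range (n + 1), {V | ε < |Real.log (dirMass κ V (cube 0 c) (s i))
        - Real.log ((2 * c + 1) ^ d * meanFK d κ μ (s i))|} := by
    intro V hV
    by_contra hcon
    simp only [Set.mem_iUnion, Finset.mem_range, Set.mem_ofPred_eq, not_exists, not_lt] at hcon
    obtain ⟨t, ht, hbad⟩ := hV
    have heq : ∀ u ∈ Set.Icc τ σ, Real.log (dirMass κ V (cube 0 c) u)
        - Real.log ((2 * c + 1) ^ d) - F τ - K * (u - τ) + (F τ + K * (u - τ) - F u)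
        = Real.log (dirMass κ V (cube 0 c) u) - Real.log ((2 * c + 1) ^ d * meanFK d κ μ u) := by
      intro u hu
      rw [Real.log_mul hN0.ne' (hpos u (hτ0.le.trans hu.1)).ne']
      ring
    -- Subtracting the line instead of `F` preserves convexity; the excess of the line over `F`
    -- takes the role of the monotone function in `exists_grid`.
    have hconv : ConvexOn ℝ (Set.Icc τ σ) fun u => Real.log (dirMass κ V (cube 0 c) u)
        - Real.log ((2 * c + 1) ^ d) - F τ - K * (u - τ) := by
      have h1 := (convexOn_log_dirMass κ V hcne).subset (Set.subset_univ (Set.Icc τ σ))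
        (convex_Icc τ σ)
      refine ⟨convex_Icc τ σ, fun u hu v hv p q hp hq hpq => ?_⟩
      have h2 := h1.2 hu hv hp hq hpq
      simp only [smul_eq_mul] at h2 ⊢
      have hq' : q = 1 - p := by linarith
      subst hq'
      nlinarith
    have := hgrid _ hconv (fun i hi => by
      rw [heq _ (hs i)]
      exact hcon i (Nat.lt_succ_of_le hi)) t ht
    rw [heq t ht] at this
    linarith
  refine (measure_mono hsub).trans ((measure_biUnion_finset_le _ _).trans ?_)
  have hterm : ∀ i ∈ Finset.range (n + 1),
      fieldMeasure d μ {V | ε < |Real.log (dirMass κ V (cube 0 c) (s i))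
        - Real.log ((2 * c + 1) ^ d * meanFK d κ μ (s i))|}
        ≤ ENNReal.ofReal (Real.exp (-(b * τ))) := by
    intro i _
    have hsi := hs i
    refine (hs₀ (s i) (hτs.trans hsi.1) c ?_).trans
      (ENNReal.ofReal_le_ofReal (Real.exp_le_exp.2 ?_))
    · have h1 := ConvexOn.doubling_mono (convexOn_cgf hexp) (hτ0.le.trans hsi.1) hsi.2
      have h2 : a * s i ≤ a * σ := mul_le_mul_of_nonneg_left hsi.2 ha.le
      linarith
    · have : b * τ ≤ b * s i := mul_le_mul_of_nonneg_left hsi.1 hb0.le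
      linarith
  refine (Finset.sum_le_sum hterm).trans ?_
  rw [Finset.sum_const, Finset.card_range, nsmul_eq_mul, ← ENNReal.ofReal_natCast,
    ← ENNReal.ofReal_mul (Nat.cast_nonneg _)]
  refine ENNReal.ofReal_le_ofReal ?_
  have hB0 : 0 ≤ B := by positivity
  have hnb : ((n + 1 : ℕ) : ℝ) ≤ Real.exp (b / 2 * τ) := by
    refine le_trans ?_ hpoly
    push_cast
    have h1 := (Nat.ceil_lt_add_one (by positivity : 0 ≤ (5 * B + 4) / ε)).le
    rw [← hn] at h1
    have h2 : (5 * B + 4) / ε = 5 * (C + 6 * d * κ) / ε * τ + 4 / ε := by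
      rw [hB]; ring
    rw [one_mul, pow_one]
    linarith
  calc ((n + 1 : ℕ) : ℝ) * Real.exp (-(b * τ)) ≤ Real.exp (b / 2 * τ) * Real.exp (-(b * τ)) := by
        gcongr
    _ = _ := by rw [← Real.exp_add]; ring_nf

end Mass

end PAM

namespace PAM

open scoped ENNReal

/-! ### Unit time windows -/

section Windows

variable {d : ℕ} {κ : ℝ} {μ : Measure ℝ} [IsProbabilityMeasure μ]

theorem cutoff_mono (d : ℕ) (hκ : 0 ≤ κ) {s t : ℝ} (hst : s ≤ t) : cutoff d κ s ≤ cutoff d κ t := by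
  unfold cutoff
  gcongr

/-- The mass of the solution in the cube of radius `m` at time `t` has its expected order, up to
paths with many jumps. -/
def MassClose [NeZero d] (κ : ℝ) (μ : Measure ℝ) [IsProbabilityMeasure μ] (ε : ℝ)
    (V : Lattice d → ℝ) (t : ℝ) (m : ℕ) : Prop :=
  Real.exp (-((4 + d) * ε)) * ((2 * m + 1) ^ d * meanFK d κ μ t)
      ≤ ∑ x ∈ cube 0 m, solution κ V t x ∧
    ∑ x ∈ cube 0 m, (fk (cutoff d κ t) κ V t x).toReal
      ≤ Real.exp ((4 + 2 * d) * ε) * ((2 * m + 1) ^ d * meanFK d κ μ t)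

/-- One inner and one outer cube serve every radius `m` in between: the inner Dirichlet mass bounds
the solution from below, and few-jump paths started in the cube of radius `m` stay in the outer one.
The side lengths agree up to factors e^ε and e^{2ε}, which become dε and 2dε in the exponents. -/
theorem FiniteFK.massClose [NeZero d] (hκ : 0 < κ)
    (hexp : ∀ t : ℝ, 0 ≤ t → Integrable (fun y => Real.exp (t * y)) μ) {V : Lattice d → ℝ}
    (hV : FiniteFK κ V) {ε t : ℝ} (ht : 0 ≤ t) {m lo hi : ℕ} (hlo : lo ≤ m)
    (hhi : m + cutoff d κ t ≤ hi) (hmlo : 2 * (m : ℝ) + 1 ≤ Real.exp ε * (2 * lo + 1))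
    (hhim : 2 * (hi : ℝ) + 1 ≤ Real.exp (2 * ε) * (2 * m + 1))
    (h1 : |Real.log (dirMass κ V (cube 0 lo) t)
      - Real.log ((2 * lo + 1) ^ d * meanFK d κ μ t)| ≤ 4 * ε)
    (h2 : |Real.log (dirMass κ V (cube 0 hi) t)
      - Real.log ((2 * hi + 1) ^ d * meanFK d κ μ t)| ≤ 4 * ε) :
    MassClose κ μ ε V t m := by
  have hφ := meanFK_pos (d := d) hκ hexp ht
  have hpos := fun l => dirMass_pos κ V (cube_nonempty (0 : Lattice d) l) t
  constructor
  · have h3 : Real.exp (-(4 * ε)) * ((2 * lo + 1) ^ d * meanFK d κ μ t)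
        ≤ dirMass κ V (cube 0 lo) t := by
      have hA : 0 < (2 * (lo : ℝ) + 1) ^ d * meanFK d κ μ t := by positivity
      rw [← Real.exp_log hA, ← Real.exp_add, ← Real.le_log_iff_exp_le (hpos lo)]
      linarith [(abs_le.1 h1).1]
    have h4 : ((2 * (m : ℝ) + 1)) ^ d ≤ Real.exp (d * ε) * (2 * lo + 1) ^ d := by
      rw [Real.exp_nat_mul, ← mul_pow]
      gcongr
    calc Real.exp (-((4 + d) * ε)) * ((2 * m + 1) ^ d * meanFK d κ μ t)
        ≤ Real.exp (-((4 + d) * ε)) *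
            (Real.exp (d * ε) * (2 * lo + 1) ^ d * meanFK d κ μ t) := by gcongr
      _ = Real.exp (-(4 * ε)) * ((2 * lo + 1) ^ d * meanFK d κ μ t) := by
          have : Real.exp (-(4 * ε)) = Real.exp (-((4 + d) * ε)) * Real.exp (d * ε) := by
            rw [← Real.exp_add]; ring_nf
          rw [this]; ring
      _ ≤ dirMass κ V (cube 0 lo) t := h3
      _ ≤ ∑ x ∈ cube 0 lo, solution κ V t x := hV.dirMass_le hκ ht _
      _ ≤ _ := Finset.sum_le_sum_of_subset_of_nonneg (cube_mono 0 hlo)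
          fun x _ _ => solution_nonneg κ V t x
  · have h3 : dirMass κ V (cube 0 hi) t
        ≤ Real.exp (4 * ε) * ((2 * hi + 1) ^ d * meanFK d κ μ t) := by
      have hA : 0 < (2 * (hi : ℝ) + 1) ^ d * meanFK d κ μ t := by positivity
      rw [← Real.exp_log hA, ← Real.exp_add, ← Real.log_le_iff_le_exp (hpos hi)]
      linarith [(abs_le.1 h2).2]
    have h4 : ((2 * (hi : ℝ) + 1)) ^ d ≤ Real.exp (d * (2 * ε)) * (2 * m + 1) ^ d := by
      rw [Real.exp_nat_mul, ← mul_pow]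
      gcongr
    set n := cutoff d κ t
    calc ∑ x ∈ cube 0 m, (fk n κ V t x).toReal
        ≤ ∑ x ∈ cube 0 (hi - n), (fk n κ V t x).toReal :=
          Finset.sum_le_sum_of_subset_of_nonneg (cube_mono 0 (by omega))
            fun x _ _ => ENNReal.toReal_nonneg
      _ ≤ dirMass κ V (cube 0 (hi - n + n)) t := hV.sum_fk_toReal_le_dirMass hκ n (hi - n) ht
      _ = dirMass κ V (cube 0 hi) t := by rw [Nat.sub_add_cancel (by omega)]
      _ ≤ Real.exp (4 * ε) * ((2 * hi + 1) ^ d * meanFK d κ μ t) := h3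
      _ ≤ Real.exp (4 * ε) *
          (Real.exp (d * (2 * ε)) * (2 * m + 1) ^ d * meanFK d κ μ t) := by gcongr
      _ = _ := by
          have : Real.exp ((4 + 2 * d) * ε) = Real.exp (4 * ε) * Real.exp (d * (2 * ε)) := by
            rw [← Real.exp_add]; ring_nf
          rw [this]; ring

theorem exp_mul_le_of_le_log [NeZero d]
    (hexp : ∀ t : ℝ, 0 ≤ t → Integrable (fun y => Real.exp (t * y)) μ) {a t : ℝ} (ht : 0 ≤ t)
    {m : ℕ} (h : cgf id μ (2 * t) - 2 * cgf id μ t + a * t ≤ d * Real.log (2 * m + 1)) :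
    Real.exp (a / d * t) ≤ 2 * m + 1 := by
  have hd : (0 : ℝ) < d := by exact_mod_cast Nat.pos_of_ne_zero (NeZero.ne d)
  rw [← Real.le_log_iff_exp_le (by positivity), div_mul_eq_mul_div, div_le_iff₀ hd]
  linarith [cgf_doubling_nonneg hexp ht]

/-- Simultaneous control of finitely many times in a unit window and cubes of comparable size. -/
theorem eventually_measure_not_massClose_le [NeZero d] (hκ : 0 < κ)
    (hexp : ∀ t : ℝ, 0 ≤ t → Integrable (fun y => Real.exp (t * y)) μ)
    (hH : AssumptionH (cgf id μ)) {a ε C : ℝ} (ha : 0 < a) (hε0 : 0 < ε) (hε1 : ε ≤ 1)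
    (hC : 0 ≤ C) :
    ∃ b : ℝ, 0 < b ∧ ∀ᶠ k : ℕ in atTop, ∀ (I : Finset ℕ) (t : ℕ → ℝ) (m : ℕ → ℕ),
      (∀ n ∈ I, t n ∈ Set.Icc (k : ℝ) (k + 1)) →
      (∀ n ∈ I, cgf id μ (2 * t n) + cgf id μ (t n) - 2 * cgf id μ (3 / 2 * t n) ≤ C * t n) →
      (∀ n ∈ I, cgf id μ (2 * t n) - 2 * cgf id μ (t n) + a * t n
        ≤ d * Real.log (2 * m n + 1)) →
      (∀ n ∈ I, ∀ n' ∈ I, 2 * (m n : ℝ) + 1 ≤ Real.exp ε * (2 * m n' + 1)) →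
      fieldMeasure d μ {V | ¬ ∀ n ∈ I, MassClose κ μ ε V (t n) (m n)}
        ≤ ENNReal.ofReal (2 * Real.exp (-(b * k))) := by
  have hd : (0 : ℝ) < d := by exact_mod_cast Nat.pos_of_ne_zero (NeZero.ne d)
  set b := min (a / 2 / 4) 1 / 2 with hb
  have hb0 : 0 < b := by positivity
  refine ⟨b, hb0, ?_⟩
  obtain ⟨k₀, hk₀⟩ := eventually_atTop.1
    (eventually_measure_exists_log_dirMass_le (d := d) hκ hexp hH (half_pos ha) hε0 hε1 hC)
  filter_upwards [tendsto_natCast_atTop_atTop.eventually (eventually_ge_atTop k₀),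
    tendsto_natCast_atTop_atTop.eventually (eventually_ge_atTop (2 * d * ε / a)),
    tendsto_natCast_atTop_atTop.eventually (eventually_mul_pow_le_exp (2 / ε) (6 * d * κ + 2)
      (6 * d * κ + 4) (by positivity) (by positivity) (by positivity) 1 (div_pos ha hd))]
    with k hkk₀ hkε hkpoly I t m htI hgap hvol hratio
  rcases I.eq_empty_or_nonempty with rfl | hne
  · simp
  obtain ⟨nτ, hnτ, hτ⟩ := I.exists_min_image t hne
  obtain ⟨nσ, hnσ, hσ⟩ := I.exists_max_image t hne
  obtain ⟨nlo, hnlo, hlo⟩ := I.exists_min_image m hne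
  obtain ⟨nhi, hnhi, hhi⟩ := I.exists_max_image m hne
  have hk0 : (0 : ℝ) ≤ k := Nat.cast_nonneg k
  have ht0 : ∀ n ∈ I, 0 ≤ t n := fun n hn => hk0.trans (htI n hn).1
  -- The cutoff at the end of the window serves all of its times; the outer cube is the largest one
  -- enlarged by it.
  set ϱ := cutoff d κ ((k : ℝ) + 1) with hϱ
  set hi := m nhi + ϱ with hhidef
  -- Replacing the cube of the latest index by the smallest one costs dε in log-volume, which half
  -- of the surplus `a` covers.
  have hvollo : cgf id μ (2 * t nσ) - 2 * cgf id μ (t nσ) + a / 2 * t nσ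
      ≤ d * Real.log (2 * m nlo + 1) := by
    have h1 := hvol nσ hnσ
    have h2 := Real.log_le_log (by positivity) (hratio nσ hnσ nlo hnlo)
    rw [Real.log_mul (Real.exp_ne_zero _) (by positivity), Real.log_exp] at h2
    have h3 := mul_le_mul_of_nonneg_left h2 hd.le
    have h4 : d * ε ≤ a / 2 * t nσ := by
      rw [div_le_iff₀ ha] at hkε
      have : a * k ≤ a * t nσ := mul_le_mul_of_nonneg_left (htI nσ hnσ).1 ha.le
      linarith
    linarith
  have hvolhi : cgf id μ (2 * t nσ) - 2 * cgf id μ (t nσ) + a / 2 * t nσ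
      ≤ d * Real.log (2 * hi + 1) := by
    refine hvollo.trans ?_
    have : (m nlo : ℝ) ≤ hi := by
      exact_mod_cast (hlo nhi hnhi).trans (Nat.le_add_right _ _)
    gcongr
  have hτσ : t nσ ∈ Set.Icc (t nτ) (t nτ + 1) :=
    ⟨hτ nσ hnσ, by linarith [(htI nσ hnσ).2, (htI nτ hnτ).1]⟩
  have hmeas : ∀ c : ℕ, cgf id μ (2 * t nσ) - 2 * cgf id μ (t nσ) + a / 2 * t nσ
      ≤ d * Real.log (2 * c + 1) →
      fieldMeasure d μ {V | ∃ s ∈ Set.Icc (t nτ) (t nσ),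
        4 * ε < |Real.log (dirMass κ V (cube 0 c) s)
          - Real.log ((2 * c + 1) ^ d * meanFK d κ μ s)|} ≤ ENNReal.ofReal (Real.exp (-(b * k))) := by
    intro c hc
    refine (hk₀ (t nτ) (hkk₀.trans (htI nτ hnτ).1) (t nσ) hτσ c (hgap nτ hnτ) hc).trans
      (ENNReal.ofReal_le_ofReal (Real.exp_le_exp.2 ?_))
    rw [← hb]
    have : b * k ≤ b * t nτ := mul_le_mul_of_nonneg_left (htI nτ hnτ).1 hb0.le
    linarith
  have hsub : ({V | ¬ ∀ n ∈ I, MassClose κ μ ε V (t n) (m n)} : Set (Lattice d → ℝ))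
      ≤ᵐ[fieldMeasure d μ] ({V | ∃ s ∈ Set.Icc (t nτ) (t nσ),
        4 * ε < |Real.log (dirMass κ V (cube 0 (m nlo)) s)
          - Real.log ((2 * m nlo + 1) ^ d * meanFK d κ μ s)|} ∪
        {V | ∃ s ∈ Set.Icc (t nτ) (t nσ), 4 * ε < |Real.log (dirMass κ V (cube 0 hi) s)
          - Real.log ((2 * hi + 1) ^ d * meanFK d κ μ s)|} : Set (Lattice d → ℝ)) := by
    filter_upwards [ae_finiteFK hκ μ hexp] with V hV hbad
    by_contra hcon
    have hcon' : V ∉ {V : Lattice d → ℝ | ∃ s ∈ Set.Icc (t nτ) (t nσ),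
        4 * ε < |Real.log (dirMass κ V (cube 0 (m nlo)) s)
          - Real.log ((2 * m nlo + 1) ^ d * meanFK d κ μ s)|} ∪
        {V | ∃ s ∈ Set.Icc (t nτ) (t nσ), 4 * ε < |Real.log (dirMass κ V (cube 0 hi) s)
          - Real.log ((2 * hi + 1) ^ d * meanFK d κ μ s)|} := hcon
    simp only [Set.mem_union, Set.mem_ofPred_eq, not_or, not_exists, not_and, not_lt] at hcon'
    obtain ⟨hc1, hc2⟩ := hcon'
    refine hbad fun n hn => ?_
    have htn : t n ∈ Set.Icc (t nτ) (t nσ) := ⟨hτ n hn, hσ n hn⟩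
    refine hV.massClose hκ hexp (ht0 n hn) (hlo n hn) (hi := hi) ?_ (hratio n hn nlo hnlo) ?_
      (hc1 _ htn) (hc2 _ htn)
    · exact Nat.add_le_add (hhi n hn) (cutoff_mono d hκ.le (htI n hn).2)
    · have h1 := hratio nhi hnhi n hn
      have h2 : 2 * (ϱ : ℝ) ≤ ε * (2 * m n + 1) := by
        have h3 := exp_mul_le_of_le_log hexp (ht0 n hn) (hvol n hn)
        have h4 : Real.exp (a / d * k) ≤ Real.exp (a / d * t n) :=
          Real.exp_le_exp.2 (mul_le_mul_of_nonneg_left (htI n hn).1 (by positivity))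
        have h5 := cutoff_le d hκ.le (by linarith : (0 : ℝ) ≤ k + 1)
        rw [← hϱ] at h5
        rw [pow_one] at hkpoly
        have h6 : 2 / ε * ϱ ≤ 2 * m n + 1 := by
          refine le_trans ?_ (hkpoly.trans (h4.trans h3))
          gcongr
          linarith
        rw [div_mul_eq_mul_div, div_le_iff₀ hε0] at h6
        linarith
      have h7 : Real.exp (2 * ε) = Real.exp ε * Real.exp ε := by rw [← Real.exp_add]; ring_nf
      have h8 : Real.exp ε + ε ≤ Real.exp (2 * ε) := by
        rw [h7]
        have := Real.add_one_le_exp ε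
        nlinarith
      have h9 : (Real.exp ε + ε) * (2 * m n + 1) ≤ Real.exp (2 * ε) * (2 * m n + 1) :=
        mul_le_mul_of_nonneg_right h8 (by positivity)
      rw [hhidef]
      push_cast
      linarith
  refine (measure_mono_ae hsub).trans ((measure_union_le _ _).trans
    ((add_le_add (hmeas _ hvollo) (hmeas _ hvolhi)).trans (le_of_eq ?_)))
  rw [← ENNReal.ofReal_add (Real.exp_pos _).le (Real.exp_pos _).le]
  ring_nf

/-- Borel-Cantelli with a bound that is only required eventually. -/
theorem ae_eventually_notMem_of_summable {α : Type*} [MeasurableSpace α] {ν : Measure α}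
    {s : ℕ → Set α} {f : ℕ → ℝ} (hf : Summable f)
    (h : ∀ᶠ n in atTop, ν (s n) ≤ ENNReal.ofReal (f n)) : ∀ᵐ x ∂ν, ∀ᶠ n in atTop, x ∉ s n := by
  obtain ⟨n₀, hn₀⟩ := eventually_atTop.1 h
  have h1 : ∑' n, ν (s (n + n₀)) ≠ ∞ := by
    have h2 := ((summable_nat_add_iff n₀).2 hf).tsum_ofReal_ne_top
    exact (ENNReal.tsum_le_tsum fun n => hn₀ (n + n₀) (Nat.le_add_left _ _)).trans_lt
      h2.lt_top |>.ne
  filter_upwards [ae_eventually_notMem h1] with x hx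
  obtain ⟨N, hN⟩ := eventually_atTop.1 hx
  refine eventually_atTop.2 ⟨N + n₀, fun n hn => ?_⟩
  have := hN (n - n₀) (by omega)
  rwa [Nat.sub_add_cancel (by omega)] at this

end Windows

end PAM

namespace PAM

open scoped ENNReal

/-! ### The almost sure statement in the canonical field -/

section StrongLaw

variable {d : ℕ} {κ : ℝ} {μ : Measure ℝ} [IsProbabilityMeasure μ]

theorem tendsto_atTop_of_summable_exp_neg {t : ℕ → ℝ} (h : Summable fun n => Real.exp (-t n)) :
    Tendsto t atTop atTop := by
  have h1 := Real.tendsto_exp_comp_nhds_zero.1 h.tendsto_atTop_zero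
  exact tendsto_neg_atBot_iff.1 h1

/-- Sizes of cubes at near-linear times in a unit window are comparable on the exponential scale. -/
theorem log_cube_le_add (hexp : ∀ t : ℝ, 0 ≤ t → Integrable (fun y => Real.exp (t * y)) μ)
    {C a s t k v w : ℝ} (hC : 0 ≤ C) (ha : 0 ≤ a) (hk : 3 ≤ k) (hs : s ∈ Set.Icc k (k + 1))
    (ht : t ∈ Set.Icc k (k + 1))
    (hgs : cgf id μ (2 * s) + cgf id μ s - 2 * cgf id μ (3 / 2 * s) ≤ C * s)
    (hgt : cgf id μ (2 * t) + cgf id μ t - 2 * cgf id μ (3 / 2 * t) ≤ C * t)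
    (hv : v ≤ cgf id μ (2 * s) - 2 * cgf id μ s + C * s)
    (hw : cgf id μ (2 * t) - 2 * cgf id μ t + a * t ≤ w) : v ≤ w + 6 * C * (k + 1) := by
  have h1 : cgf id μ (2 * s) - 2 * cgf id μ s
      ≤ cgf id μ (2 * t) - 2 * cgf id μ t + 5 * C * (k + 1) := by
    rcases le_total s t with hst | hst
    · have := ConvexOn.doubling_mono (convexOn_cgf hexp) (by linarith [hs.1]) hst
      have : 0 ≤ 5 * C * (k + 1) := by positivity
      linarith
    · have h2 := ConvexOn.doubling_le (convexOn_cgf hexp) (τ := t) (σ := s) (by linarith [ht.1])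
        hst (by linarith [ht.1, hs.2]) hgt hgs
      have h3 : C * s ≤ C * (k + 1) := mul_le_mul_of_nonneg_left hs.2 hC
      have h4 : C * t ≤ C * (k + 1) := mul_le_mul_of_nonneg_left ht.2 hC
      linarith
  have h3 : C * s ≤ C * (k + 1) := mul_le_mul_of_nonneg_left hs.2 hC
  have h4 : 0 ≤ a * t := mul_nonneg ha (by linarith [ht.1])
  linarith

/-- At near-linear times the mass has almost surely its expected order. -/
theorem ae_eventually_massClose [NeZero d] (hκ : 0 < κ)
    (hexp : ∀ t : ℝ, 0 ≤ t → Integrable (fun y => Real.exp (t * y)) μ)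
    (hH : AssumptionH (cgf id μ)) {a ε C : ℝ} (ha : 0 < a) (hε0 : 0 < ε) (hε1 : ε ≤ 1)
    (hC : 0 ≤ C) {t : ℕ → ℝ} (ht0 : ∀ n, 0 ≤ t n) (ht : Tendsto t atTop atTop) (m : ℕ → ℕ) :
    ∀ᵐ V ∂(fieldMeasure d μ), ∀ᶠ n in atTop,
      cgf id μ (2 * t n) + cgf id μ (t n) - 2 * cgf id μ (3 / 2 * t n) ≤ C * t n →
      cgf id μ (2 * t n) - 2 * cgf id μ (t n) + a * t n ≤ d * Real.log (2 * m n + 1) →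
      d * Real.log (2 * m n + 1) ≤ cgf id μ (2 * t n) - 2 * cgf id μ (t n) + C * t n →
      MassClose κ μ ε V (t n) (m n) := by
  classical
  have hd : (0 : ℝ) < d := by exact_mod_cast Nat.pos_of_ne_zero (NeZero.ne d)
  obtain ⟨b, hb0, hb⟩ := eventually_measure_not_massClose_le (d := d) hκ hexp hH ha hε0 hε1 hC
  set Near : ℕ → Prop := fun n =>
    cgf id μ (2 * t n) + cgf id μ (t n) - 2 * cgf id μ (3 / 2 * t n) ≤ C * t n ∧
    cgf id μ (2 * t n) - 2 * cgf id μ (t n) + a * t n ≤ d * Real.log (2 * m n + 1) ∧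
    d * Real.log (2 * m n + 1) ≤ cgf id μ (2 * t n) - 2 * cgf id μ (t n) + C * t n with hNear
  have hfloor : Tendsto (fun n => ⌊t n⌋₊) atTop atTop := tendsto_nat_floor_atTop.comp ht
  have hfin : ∀ k : ℕ, {n | Near n ∧ ⌊t n⌋₊ = k}.Finite := by
    intro k
    obtain ⟨n₀, hn₀⟩ := eventually_atTop.1 (hfloor.eventually_gt_atTop k)
    refine (Set.finite_Iio n₀).subset fun n hn => ?_
    by_contra hcon
    have := hn₀ n (not_lt.1 hcon)
    have h2 : ⌊t n⌋₊ = k := hn.2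
    omega
  set A : ℕ → Finset ℕ := fun k => (hfin k).toFinset with hA
  have hAmem : ∀ k n, n ∈ A k ↔ Near n ∧ ⌊t n⌋₊ = k := fun k n => by
    simp only [hA, Set.Finite.mem_toFinset, Set.mem_ofPred_eq]
  have hAt : ∀ k, ∀ n ∈ A k, t n ∈ Set.Icc (k : ℝ) (k + 1) := by
    intro k n hn
    have h1 := ((hAmem k n).1 hn).2
    rw [← h1]
    exact ⟨Nat.floor_le (ht0 n), (Nat.lt_floor_add_one _).le⟩
  -- Indices are binned by the logarithm of the side length, in steps of ε.
  set j : ℕ → ℕ := fun n => ⌊Real.log (2 * m n + 1) / ε⌋₊ with hj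
  have hlog0 : ∀ n, 0 ≤ Real.log (2 * m n + 1) := fun n =>
    Real.log_nonneg (by linarith [(Nat.cast_nonneg (m n) : (0 : ℝ) ≤ m n)])
  have hj1 : ∀ n, j n * ε ≤ Real.log (2 * m n + 1) := fun n => by
    rw [← le_div_iff₀ hε0]
    exact Nat.floor_le (div_nonneg (hlog0 n) hε0.le)
  have hj2 : ∀ n, Real.log (2 * m n + 1) ≤ (j n + 1) * ε := fun n => by
    rw [← div_le_iff₀ hε0]
    exact (Nat.lt_floor_add_one _).le
  -- By `log_cube_le_add` the log-volumes in one window spread over at most 6C(k+1), so the number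
  -- of bins is linear in `k`.
  set W : ℕ → ℕ := fun k => ⌈6 * C * (k + 1) / (d * ε)⌉₊ + 1 with hW
  have hcount : ∀ k : ℕ, 3 ≤ (k : ℝ) → ((A k).image j).card ≤ W k + 1 := by
    intro k hk
    rcases (A k).eq_empty_or_nonempty with he | hne
    · simp [he]
    obtain ⟨n₀, hn₀, hmin⟩ := (A k).exists_min_image j hne
    have hsub : (A k).image j ⊆ Finset.Icc (j n₀) (j n₀ + W k) := by
      intro i hi
      obtain ⟨n, hn, rfl⟩ := Finset.mem_image.1 hi
      refine Finset.mem_Icc.2 ⟨hmin n hn, ?_⟩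
      obtain ⟨⟨g1, g2, g3⟩, -⟩ := (hAmem k n).1 hn
      obtain ⟨⟨g1', g2', g3'⟩, -⟩ := (hAmem k n₀).1 hn₀
      have h1 := log_cube_le_add hexp hC ha.le hk (hAt k n hn) (hAt k n₀ hn₀) g1 g1' g3 g2'
      have h2 : (d : ℝ) * (j n * ε) ≤ d * ((j n₀ + 1) * ε) + 6 * C * (k + 1) := by
        have := mul_le_mul_of_nonneg_left (hj1 n) hd.le
        have := mul_le_mul_of_nonneg_left (hj2 n₀) hd.le
        linarith
      have h3 : (j n : ℝ) ≤ j n₀ + 1 + 6 * C * (k + 1) / (d * ε) := by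
        have hdε : 0 < d * ε := by positivity
        rw [← sub_le_iff_le_add', le_div_iff₀ hdε]
        linarith
      have h4 : (j n : ℝ) ≤ j n₀ + W k := by
        have := Nat.le_ceil (6 * C * ((k : ℝ) + 1) / (d * ε))
        simp only [hW]
        push_cast
        linarith
      exact_mod_cast h4
    refine (Finset.card_le_card hsub).trans ?_
    rw [Nat.card_Icc]
    omega
  have hbad : ∀ᶠ k : ℕ in atTop,
      fieldMeasure d μ {V | ¬ ∀ n ∈ A k, MassClose κ μ ε V (t n) (m n)}
        ≤ ENNReal.ofReal (Real.exp (k * (-(b / 2)))) := by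
    filter_upwards [hb, tendsto_natCast_atTop_atTop.eventually (eventually_ge_atTop (3 : ℝ)),
      tendsto_natCast_atTop_atTop.eventually (eventually_mul_pow_le_exp 2 (6 * C / (d * ε))
        (6 * C / (d * ε) + 3) zero_le_two (by positivity) (by positivity) 1 (half_pos hb0))]
      with k hk hk3 hpoly
    have hk3' : (3 : ℝ) ≤ k := hk3
    -- The union bound runs over bins; the number of indices in the window, possibly of exponential
    -- order, never enters.
    have hsub : {V : Lattice d → ℝ | ¬ ∀ n ∈ A k, MassClose κ μ ε V (t n) (m n)}
        ⊆ ⋃ i ∈ (A k).image j, {V | ¬ ∀ n ∈ (A k).filter (fun n => j n = i),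
          MassClose κ μ ε V (t n) (m n)} := by
      intro V hV
      have hV' : ¬ ∀ n ∈ A k, MassClose κ μ ε V (t n) (m n) := hV
      push Not at hV'
      obtain ⟨n, hn, hnV⟩ := hV'
      refine Set.mem_iUnion₂.2 ⟨j n, Finset.mem_image_of_mem j hn, fun hcon => ?_⟩
      exact hnV (hcon n (Finset.mem_filter.2 ⟨hn, rfl⟩))
    refine (measure_mono hsub).trans ((measure_biUnion_finset_le _ _).trans ?_)
    have hterm : ∀ i ∈ (A k).image j, fieldMeasure d μ
        {V | ¬ ∀ n ∈ (A k).filter (fun n => j n = i), MassClose κ μ ε V (t n) (m n)}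
        ≤ ENNReal.ofReal (2 * Real.exp (-(b * k))) := by
      intro i _
      have hmemA : ∀ n ∈ (A k).filter (fun n => j n = i), n ∈ A k := fun n hn =>
        (Finset.mem_filter.1 hn).1
      refine hk _ t m (fun n hn => hAt k n (hmemA n hn))
        (fun n hn => ((hAmem k n).1 (hmemA n hn)).1.1)
        (fun n hn => ((hAmem k n).1 (hmemA n hn)).1.2.1) fun n hn n' hn' => ?_
      have e1 : j n = i := (Finset.mem_filter.1 hn).2
      have e2 : j n' = i := (Finset.mem_filter.1 hn').2
      have h1 := hj2 n
      have h2 := hj1 n'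
      rw [e1] at h1
      rw [e2] at h2
      have h3 : Real.log (2 * m n + 1) ≤ ε + Real.log (2 * m n' + 1) := by linarith
      have h4 := Real.exp_le_exp.2 h3
      rwa [Real.exp_add, Real.exp_log (by positivity), Real.exp_log (by positivity)] at h4
    refine (Finset.sum_le_sum hterm).trans ?_
    rw [Finset.sum_const, nsmul_eq_mul, ← ENNReal.ofReal_natCast,
      ← ENNReal.ofReal_mul (Nat.cast_nonneg _)]
    refine ENNReal.ofReal_le_ofReal ?_
    have h1 : (((A k).image j).card : ℝ) ≤ 6 * C / (d * ε) * k + (6 * C / (d * ε) + 3) := by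
      have h2 : (((A k).image j).card : ℝ) ≤ W k + 1 := by exact_mod_cast hcount k hk3'
      have h3 := (Nat.ceil_lt_add_one (by positivity : 0 ≤ 6 * C * ((k : ℝ) + 1) / (d * ε))).le
      have h4 : 6 * C * ((k : ℝ) + 1) / (d * ε) = 6 * C / (d * ε) * k + 6 * C / (d * ε) := by ring
      simp only [hW] at h2
      push_cast at h2
      linarith
    rw [pow_one] at hpoly
    calc (((A k).image j).card : ℝ) * (2 * Real.exp (-(b * k)))
        ≤ (6 * C / (d * ε) * k + (6 * C / (d * ε) + 3)) * (2 * Real.exp (-(b * k))) := by gcongr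
      _ = 2 * (6 * C / (d * ε) * k + (6 * C / (d * ε) + 3)) * Real.exp (-(b * k)) := by ring
      _ ≤ Real.exp (b / 2 * k) * Real.exp (-(b * k)) := by gcongr
      _ = _ := by rw [← Real.exp_add]; ring_nf
  have hsum : Summable fun k : ℕ => Real.exp (k * (-(b / 2))) :=
    Real.summable_exp_nat_mul_iff.2 (by linarith)
  filter_upwards [ae_eventually_notMem_of_summable hsum hbad] with V hV
  filter_upwards [hfloor.eventually hV] with n hn h1 h2 h3
  have hn' : ∀ n' ∈ A ⌊t n⌋₊, MassClose κ μ ε V (t n') (m n') := not_not.1 hn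
  exact hn' n ((hAmem _ n).2 ⟨⟨h1, h2, h3⟩, rfl⟩)

/-- At the remaining times moment estimates suffice. -/
theorem ae_eventually_abs_sum_sub_le [NeZero d] (hκ : 0 < κ)
    (hexp : ∀ t : ℝ, 0 ≤ t → Integrable (fun y => Real.exp (t * y)) μ)
    (hH : AssumptionH (cgf id μ)) {a ε : ℝ} (ha : 0 < a) (hε0 : 0 < ε) (hε1 : ε ≤ 1)
    {t : ℕ → ℝ} (ht0 : ∀ n, 0 ≤ t n) (hsum : Summable fun n => Real.exp (-t n)) (m : ℕ → ℕ) :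
    ∀ᵐ V ∂(fieldMeasure d μ), ∀ᶠ n in atTop,
      cgf id μ (2 * t n) - 2 * cgf id μ (t n) + a * t n ≤ d * Real.log (2 * m n + 1) →
      ((6 * d * κ + 4) * t n
          ≤ cgf id μ (2 * t n) + cgf id μ (t n) - 2 * cgf id μ (3 / 2 * t n) ∨
        cgf id μ (2 * t n) - 2 * cgf id μ (t n) + (6 * d * κ + 4) * t n
          ≤ d * Real.log (2 * m n + 1)) →
      |∑ x ∈ cube 0 (m n), (fk (cutoff d κ (t n)) κ V (t n) x).toReal
          - (2 * m n + 1) ^ d * meanFK d κ μ (t n)|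
        ≤ ε * ((2 * m n + 1) ^ d * meanFK d κ μ (t n)) := by
  classical
  have ht := tendsto_atTop_of_summable_exp_neg hsum
  set Dir : ℕ → Prop := fun n =>
    cgf id μ (2 * t n) - 2 * cgf id μ (t n) + a * t n ≤ d * Real.log (2 * m n + 1) ∧
      ((6 * d * κ + 4) * t n
          ≤ cgf id μ (2 * t n) + cgf id μ (t n) - 2 * cgf id μ (3 / 2 * t n) ∨
        cgf id μ (2 * t n) - 2 * cgf id μ (t n) + (6 * d * κ + 4) * t n
          ≤ d * Real.log (2 * m n + 1)) with hDir
  set E : ℕ → Set (Lattice d → ℝ) := fun n => {V | Dir n ∧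
    ε * ((2 * m n + 1) ^ d * meanFK d κ μ (t n)) <
      |∑ x ∈ cube 0 (m n), (fk (cutoff d κ (t n)) κ V (t n) x).toReal
          - (2 * m n + 1) ^ d * meanFK d κ μ (t n)|} with hE
  have hbound : ∀ᶠ n in atTop, fieldMeasure d μ (E n) ≤ ENNReal.ofReal (Real.exp (-t n)) := by
    filter_upwards [ht.eventually (eventually_measure_le_secondMoment (d := d) hκ hexp hH hε0 hε1
        one_pos),
      ht.eventually (eventually_measure_le_fractionalMoment (d := d) hκ hexp hε0 hε1)]
      with n h1 h2
    by_cases hn : Dir n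
    · have hsub : E n ⊆ {V | ε * ((2 * m n + 1) ^ d * meanFK d κ μ (t n)) <
          |∑ x ∈ cube 0 (m n), (fk (cutoff d κ (t n)) κ V (t n) x).toReal
          - (2 * m n + 1) ^ d * meanFK d κ μ (t n)|} := fun V hV => hV.2
      have hdt : 0 ≤ (d : ℝ) * κ * t n := mul_nonneg (by positivity) (ht0 n)
      have hat : 0 ≤ a * t n := mul_nonneg ha.le (ht0 n)
      -- In the first case half of (6d κ + 4)t outweighs the loss (3dκ + 1)t of the fractional
      -- moment by t; in the second the volume surplus outweighs the error t of the second moment.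
      rcases hn with ⟨hn1, hn2 | hn2⟩
      · refine (measure_mono hsub).trans ((h2 (m n)).trans
          (ENNReal.ofReal_le_ofReal (Real.exp_le_exp.2 ?_)))
        linarith
      · refine (measure_mono hsub).trans ((h1 (m n)).trans
          (ENNReal.ofReal_le_ofReal (Real.exp_le_exp.2 ?_)))
        linarith [ht0 n]
    · have : E n = ∅ := by
        ext V
        simp [hE, hn]
      rw [this]
      simp
  filter_upwards [ae_eventually_notMem_of_summable hsum hbound] with V hV
  filter_upwards [hV] with n hn h1 h2
  by_contra hcon
  exact hn ⟨⟨h1, h2⟩, not_le.1 hcon⟩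

theorem ae_eventually_abs_div_sub_one_le [NeZero d] (hκ : 0 < κ)
    (hexp : ∀ t : ℝ, 0 ≤ t → Integrable (fun y => Real.exp (t * y)) μ)
    (hH : AssumptionH (cgf id μ)) {a ε : ℝ} (ha : 0 < a) (hε0 : 0 < ε) (hε1 : ε ≤ 1)
    {t : ℕ → ℝ} (ht0 : ∀ n, 0 ≤ t n) (hsum : Summable fun n => Real.exp (-t n)) {m : ℕ → ℕ}
    (hm : ∀ᶠ n in atTop,
      cgf id μ (2 * t n) - 2 * cgf id μ (t n) + a * t n ≤ d * Real.log (2 * m n + 1)) :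
    ∀ᵐ V ∂(fieldMeasure d μ), ∀ᶠ n in atTop,
      |(∑ x ∈ cube 0 (m n), solution κ V (t n) x) / ((2 * m n + 1) ^ d * meanFK d κ μ (t n)) - 1|
        ≤ Real.exp ((4 + 2 * d) * ε) - 1 + ε := by
  have ht := tendsto_atTop_of_summable_exp_neg hsum
  have hrest : ∀ᵐ V ∂(fieldMeasure d μ), ∀ᶠ n in atTop,
      V ∉ {V | ENNReal.ofReal (ε * ((2 * m n + 1) ^ d * meanFK d κ μ (t n)))
        ≤ ∑ x ∈ cube 0 (m n), fkRest (cutoff d κ (t n)) κ V (t n) x} := by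
    refine ae_eventually_notMem_of_summable (hsum.mul_left (1 / ε)) (Eventually.of_forall fun n => ?_)
    refine (measure_sum_fkRest_le hκ hexp (ht0 n) hε0 (m n)).trans (ENNReal.ofReal_le_ofReal ?_)
    rw [one_div_mul_eq_div]
    exact div_le_div_of_nonneg_right (Real.exp_le_exp.2 (by linarith [ht0 n])) hε0.le
  filter_upwards [ae_finiteFK hκ μ hexp, hrest,
    ae_eventually_massClose (d := d) hκ hexp hH ha hε0 hε1
      (by positivity : 0 ≤ 6 * (d : ℝ) * κ + 4) ht0 ht m,
    ae_eventually_abs_sum_sub_le (d := d) hκ hexp hH ha hε0 hε1 ht0 hsum m] with V hV hV1 hV2 hV3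
  filter_upwards [hV1, hV2, hV3, hm] with n h1 h2 h3 hn
  set A := (2 * (m n : ℝ) + 1) ^ d * meanFK d κ μ (t n) with hA
  have hφ := meanFK_pos (d := d) hκ hexp (ht0 n)
  have hA0 : 0 < A := by positivity
  set S := ∑ x ∈ cube 0 (m n), solution κ V (t n) x with hS
  set U := ∑ x ∈ cube 0 (m n), (fk (cutoff d κ (t n)) κ V (t n) x).toReal with hU
  have hSU : S ≤ U + ε * A := hV.sum_solution_le hκ _ (ht0 n) _ (by positivity)
    (not_le.1 (show ¬ ENNReal.ofReal (ε * A)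
      ≤ ∑ x ∈ cube 0 (m n), fkRest (cutoff d κ (t n)) κ V (t n) x from h1)).le
  have hUS : U ≤ S := Finset.sum_le_sum fun x _ => by
    rw [hV.solution_eq_add hκ (cutoff d κ (t n)) (ht0 n)]
    exact le_add_of_nonneg_right ENNReal.toReal_nonneg
  have hd0 : (0 : ℝ) ≤ d := Nat.cast_nonneg d
  have hdε : 0 ≤ d * ε := by positivity
  set y := (4 + 2 * (d : ℝ)) * ε with hy
  have hy1 : y + 1 ≤ Real.exp y := Real.add_one_le_exp y
  have key : (2 - Real.exp y - ε) * A ≤ S ∧ S ≤ (Real.exp y + ε) * A := by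
    -- The complementary case is exactly the near-linear regime of `ae_eventually_massClose` with C
    -- = 6dκ + 4.
    by_cases hdir : (6 * d * κ + 4) * t n
          ≤ cgf id μ (2 * t n) + cgf id μ (t n) - 2 * cgf id μ (3 / 2 * t n) ∨
        cgf id μ (2 * t n) - 2 * cgf id μ (t n) + (6 * d * κ + 4) * t n
          ≤ d * Real.log (2 * m n + 1)
    · have h4 := abs_le.1 (h3 hn hdir)
      have h5 : (1 + ε) * A ≤ Real.exp y * A := by
        refine mul_le_mul_of_nonneg_right ?_ hA0.le
        linarith
      have h6 : 0 ≤ ε * A := by positivity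
      constructor <;> linarith
    · push Not at hdir
      obtain ⟨h4, h5⟩ := h2 hdir.1.le hn hdir.2.le
      rw [← hA, ← hS] at h4
      rw [← hA, ← hU] at h5
      have h6 : 2 - Real.exp y - ε ≤ Real.exp (-((4 + d) * ε)) := by
        have h7 := Real.add_one_le_exp (-((4 + d) * ε))
        linarith
      have h8 := mul_le_mul_of_nonneg_right h6 hA0.le
      constructor <;> linarith
  rw [abs_le]
  constructor
  · rw [le_sub_iff_add_le, le_div_iff₀ hA0]
    linarith [key.1]
  · rw [sub_le_iff_le_add, div_le_iff₀ hA0]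
    linarith [key.2]

/-- The strong law for the spatial average of the solution in the canonical field. -/
theorem ae_tendsto_average [NeZero d] (hκ : 0 < κ)
    (hexp : ∀ t : ℝ, 0 ≤ t → Integrable (fun y => Real.exp (t * y)) μ)
    (hH : AssumptionH (cgf id μ)) {a : ℝ} (ha : 0 < a)
    {t : ℕ → ℝ} (ht0 : ∀ n, 0 ≤ t n) (hsum : Summable fun n => Real.exp (-t n)) {m : ℕ → ℕ}
    (hm : ∀ᶠ n in atTop,
      cgf id μ (2 * t n) - 2 * cgf id μ (t n) + a * t n ≤ d * Real.log (2 * m n + 1)) :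
    ∀ᵐ V ∂(fieldMeasure d μ), Tendsto (fun n =>
      (∑ x ∈ cube 0 (m n), solution κ V (t n) x) / ((2 * m n + 1) ^ d * meanFK d κ μ (t n)))
      atTop (𝓝 1) := by
  have hall : ∀ᵐ V ∂(fieldMeasure d μ), ∀ i : ℕ, ∀ᶠ n in atTop,
      |(∑ x ∈ cube 0 (m n), solution κ V (t n) x) / ((2 * m n + 1) ^ d * meanFK d κ μ (t n)) - 1|
        ≤ Real.exp ((4 + 2 * d) * (1 / (i + 1 : ℝ))) - 1 + 1 / (i + 1 : ℝ) :=
    ae_all_iff.2 fun i => ae_eventually_abs_div_sub_one_le hκ hexp hH ha (by positivity)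
      (by rw [div_le_one (by positivity)]; linarith [(Nat.cast_nonneg i : (0 : ℝ) ≤ i)])
      ht0 hsum hm
  have hlim : Tendsto (fun i : ℕ => Real.exp ((4 + 2 * d) * (1 / (i + 1 : ℝ))) - 1
      + 1 / (i + 1 : ℝ)) atTop (𝓝 0) := by
    have h1 : Tendsto (fun i : ℕ => 1 / ((i : ℝ) + 1)) atTop (𝓝 0) :=
      tendsto_one_div_add_atTop_nhds_zero_nat
    have h2 : Continuous fun u : ℝ => Real.exp ((4 + 2 * d) * u) - 1 + u := by fun_prop
    have h3 := (h2.tendsto 0).comp h1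
    simpa [Function.comp_def] using h3
  filter_upwards [hall] with V hV
  rw [Metric.tendsto_nhds]
  intro δ hδ
  obtain ⟨i, hi⟩ := (hlim.eventually_lt_const hδ).exists
  filter_upwards [hV i] with n hn
  rw [Real.dist_eq]
  exact hn.trans_lt hi

end StrongLaw

end PAM
-- Transfer to the given probability space
theorem theorem2 {Ω : Type*} [MeasurableSpace Ω] (P : Measure Ω) [IsProbabilityMeasure P]
    (d : ℕ) [NeZero d] (κ : ℝ) (hκ : 0 < κ)
    -- the i.i.d. potential, unbounded from above, with all exponential moments
    (ξ : PAM.Lattice d → Ω → ℝ)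
    (hmeas : ∀ x, Measurable (ξ x))
    (hindep : iIndepFun ξ P)
    (hident : ∀ x, IdentDistrib (ξ x) (ξ 0) P P)
    (hunbdd : ∀ h : ℝ, 0 < P {ω | h < ξ 0 ω})
    (hexp : ∀ t : ℝ, 0 ≤ t → Integrable (fun ω => Real.exp (t * ξ 0 ω)) P)
    (hH : PAM.AssumptionH (cgf (ξ 0) P))
    -- the growth condition on the boxes, with a limit in `(0, ∞]`
    (r : ℝ → ℝ) (hr : ∀ t, 0 < t → 0 < r t)
    (hgrowth : ∃ a : EReal, 0 < a ∧
      Tendsto (fun t : ℝ =>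
        ((1 / t * (Real.log ((PAM.box d (r t)).card : ℝ)
          - cgf (ξ 0) P (2 * t) + 2 * cgf (ξ 0) P t) : ℝ) : EReal)) atTop (𝓝 a)) :
    (∀ᵐ ω ∂P, PAM.IsSolution κ (fun x => ξ x ω) (PAM.solution κ (fun x => ξ x ω))) ∧
    ∀ t : ℕ → ℝ, (∀ n, 0 ≤ t n) → Summable (fun n => Real.exp (-t n)) →
      ∀ᵐ ω ∂P, Tendsto (fun n : ℕ =>
        1 / ((PAM.box d (r (t n))).card : ℝ) *
          ∑ x ∈ PAM.box d (r (t n)),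
            (PAM.solution κ (fun y => ξ y ω) (t n) x /
              (∫ ω', PAM.solution κ (fun y => ξ y ω') (t n) 0 ∂P) - 1))
        atTop (𝓝 0) := by
  set μ := P.map (ξ 0) with hμ
  have : IsProbabilityMeasure μ := Measure.isProbabilityMeasure_map (hmeas 0).aemeasurable
  have hpres : MeasurePreserving (fun ω x => ξ x ω) P (PAM.fieldMeasure d μ) := by
    refine ⟨measurable_pi_lambda _ hmeas, ?_⟩
    rw [hindep.map_fun_eq_infinitePi_map hmeas, PAM.fieldMeasure]
    congr 1
    funext x
    exact (hident x).map_eq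
  have hexp' : ∀ t : ℝ, 0 ≤ t → Integrable (fun y => Real.exp (t * y)) μ := fun t ht =>
    (integrable_map_measure (by fun_prop) (hmeas 0).aemeasurable).2 (hexp t ht)
  have hcgf : cgf id μ = cgf (ξ 0) P := by
    funext t
    rw [cgf, cgf, hμ, mgf_id_map (hmeas 0).aemeasurable]
  rw [← hcgf] at hH hgrowth
  refine ⟨?_, fun t ht0 hsum => ?_⟩
  · filter_upwards [hpres.quasiMeasurePreserving.ae (PAM.ae_finiteFK hκ μ hexp')] with ω hω
    exact hω.isSolution hκ
  obtain ⟨a, ha0, ha⟩ := hgrowth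
  -- A real number strictly between 0 and the limit covers finite and infinite limits alike; only an
  -- eventual positive surplus is needed.
  obtain ⟨b, hb0, hba⟩ := EReal.lt_iff_exists_real_btwn.1 ha0
  have hb0' : 0 < b := by exact_mod_cast hb0
  have ht := PAM.tendsto_atTop_of_summable_exp_neg hsum
  have hcard : ∀ n, 0 < t n → ((PAM.box d (r (t n))).card : ℝ) = (2 * ⌊r (t n)⌋₊ + 1) ^ d := by
    intro n hn
    rw [PAM.box_eq_cube (hr _ hn).le, PAM.card_cube]
    push_cast
    rfl
  have hm : ∀ᶠ n in atTop, cgf id μ (2 * t n) - 2 * cgf id μ (t n) + b * t n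
      ≤ d * Real.log (2 * ⌊r (t n)⌋₊ + 1) := by
    filter_upwards [ht.eventually (ha.eventually_const_lt hba), ht.eventually_gt_atTop 0]
      with n h1 h2
    rw [EReal.coe_lt_coe_iff, one_div_mul_eq_div, lt_div_iff₀ h2, hcard n h2, Real.log_pow] at h1
    linarith
  have hmean : ∀ s, ∫ ω, PAM.solution κ (fun y => ξ y ω) s 0 ∂P = PAM.meanFK d κ μ s := by
    intro s
    rw [PAM.meanFK, ← hpres.map_eq, integral_map hpres.measurable.aemeasurable]
    simp_rw [PAM.solution_eq_toReal_fk]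
    exact (PAM.measurable_fk ⊤ κ s 0).ennreal_toReal.aestronglyMeasurable
  filter_upwards [hpres.quasiMeasurePreserving.ae
    (PAM.ae_tendsto_average hκ hexp' hH hb0' ht0 hsum hm)] with ω hω
  have hω' := hω.sub_const 1
  rw [sub_self] at hω'
  refine hω'.congr' ?_
  filter_upwards [ht.eventually_gt_atTop 0] with n hn
  have hφ := PAM.meanFK_pos (d := d) hκ hexp' hn.le
  rw [hmean, hcard n hn, PAM.box_eq_cube (hr _ hn).le, Finset.sum_sub_distrib, Finset.sum_const,
    nsmul_eq_mul, mul_one, PAM.card_cube, ← Finset.sum_div]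
  push_cast
  field_simp
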